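/- All matroids are finite. A matroid $M$ is \emph{frame} if some matroid extending $M$ (possibly of larger rank) has a basis $B$ such that every element is spanned by at most two elements of $B$. An \emph{excluded minor} for the class of frame matroids is a matroid that is not frame but all of whose proper minors are frame. A \emph{$k$-separation} of a matroid $M$ is a partition $(X,Y)$ of its ground set $E(M)$ with $r(X)+r(Y)-r(M)+1=k$ and $|X|,|Y|\ge k$; $M$ is \emph{3-connected} if it has no $l$-separation with $l<3$. The 2-sum of matroids $M_1,M_2$ with $E(M_1)\cap E(M_2)=\{e\}$ is the matroid on $(E(M_1)\cup E(M_2))\setminus\{e\}$ whose circuits are the circuits of $M_1$ and of $M_2$ that avoid $e$, together with the sets $(C_1\cup C_2)\setminus\{e\}$ where $C_i$ is a circuit of $M_i$ containing $e$ for $i=1,2$. For a matroid $N$ and a subset $L\subseteq E(N)$ containing no loop of $N$, let $N\oplus_2 U_{2,4}^{L}$ denote the matroid obtained from $N$ by taking, for each $e\in L$, the 2-sum on $e$ with a copy of $U_{2,4}$ (distinct copies being disjoint, and the copy at $e$ meeting $E(N)$ only in $e$). Let $N_9=U_{2,3}\oplus_2 U_{2,4}^{E(U_{2,3})}$. \textbf{Theorem.}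 Let $N$ be a 3-connected matroid, let $L\subseteq E(N)$, and suppose that $M=N\oplus_2 U_{2,4}^{L}$ is an excluded minor for the class of frame matroids. If $|L|\ge 3$, then $M\cong N_9$. -/

import Mathlib

open Set

universe u v

namespace Matroid

/-- Isomorphism of matroids: a bijection between the ground sets that preserves independence
in both directions. -/
def IsIsoTo {α : Type u} {β : Type v} (M : Matroid α) (N : Matroid β) : Prop :=
  ∃ f : M.E ≃ N.E, ∀ I : Set M.E,
    M.Indep (Subtype.val '' I) ↔ N.Indep (Subtype.val '' (f '' I))

/-- The uniform matroid of rank (at most) `r` on the set `E`. -/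
def uniformOn {α : Type u} (r : ℕ) (E : Set α) : Matroid α :=
  (IndepMatroid.ofBddAugment E (fun I ↦ I ⊆ E ∧ I.encard ≤ r)
    ⟨empty_subset _, by simp⟩
    (fun I J hJ hIJ ↦ ⟨hIJ.trans hJ.1, (encard_le_encard hIJ).trans hJ.2⟩)
    (by
      rintro I J ⟨hIE, hI⟩ ⟨hJE, hJ⟩ hlt
      obtain ⟨e, heJ, heI⟩ : ∃ e ∈ J, e ∉ I := by
        by_contra! h
        exact (encard_le_encard h).not_gt hlt
      refine ⟨e, heJ, heI, insert_subset (hJE heJ) hIE, ?_⟩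
      rw [encard_insert_of_notMem heI]
      exact (Order.add_one_le_of_lt hlt).trans hJ)
    ⟨r, fun I hI ↦ hI.2⟩
    (fun I hI ↦ hI.1)).matroid

/-- A finite matroid is a frame matroid if it has a finite extension that contains a basis `B`
(its frame) such that every element is spanned by (at most) two elements of `B`. The extension
lives on `α ⊕ ℕ`, where `M` sits on the left summand and new elements may be taken from the
right summand. It may have larger rank than `M`. -/
def IsFrame {α : Type u} (M : Matroid α) : Prop :=
  ∃ N : Matroid (α ⊕ ℕ), N.Finite ∧
    (M.map Sum.inl Sum.inl_injective.injOn).IsRestriction N ∧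
    ∃ B, N.IsBase B ∧ ∀ x ∈ N.E, ∃ S ⊆ B, S.encard ≤ 2 ∧ x ∈ N.closure S

/-- An excluded minor for the class of frame matroids: a finite matroid that is not frame,
all of whose proper minors are frame. -/
def IsFrameExcludedMinor {α : Type u} (M : Matroid α) : Prop :=
  M.Finite ∧ ¬ M.IsFrame ∧ ∀ M' : Matroid α, M'.IsStrictMinor M → M'.IsFrame

/-- `(X, Y)` is a `k`-separation of `M`: a partition of the ground set of order
`r(X) + r(Y) - r(M) + 1 = k` (written without subtraction) with `|X|, |Y| ≥ k`. -/
def IsSeparation {α : Type u} (M : Matroid α) (k : ℕ) (X Y : Set α) : Prop :=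
  X ∪ Y = M.E ∧ Disjoint X Y ∧ M.eRk X + M.eRk Y + 1 = M.eRank + k ∧
    (k : ℕ∞) ≤ X.encard ∧ (k : ℕ∞) ≤ Y.encard

/-- A (finite) matroid is `k`-connected if it has no `l`-separation with `l < k`. -/
def IsKConnected {α : Type u} (M : Matroid α) (k : ℕ) : Prop :=
  ∀ l < k, ∀ X Y, ¬ M.IsSeparation l X Y

/-- `M` is the 2-sum of `M₁` and `M₂` on their unique common element `e`: its ground set is
`(E(M₁) ∪ E(M₂)) \ {e}`, and its circuits are the circuits of `M₁` and of `M₂` that avoid `e`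
and the sets `(C₁ ∪ C₂) \ {e}` where `Cᵢ` is a circuit of `Mᵢ` containing `e`. -/
def IsTwoSum {γ : Type u} (M M₁ M₂ : Matroid γ) (e : γ) : Prop :=
  M₁.E ∩ M₂.E = {e} ∧ M.E = (M₁.E ∪ M₂.E) \ {e} ∧
    ∀ C, M.IsCircuit C ↔
      (M₁.IsCircuit C ∧ e ∉ C) ∨ (M₂.IsCircuit C ∧ e ∉ C) ∨
      ∃ C₁ C₂, M₁.IsCircuit C₁ ∧ e ∈ C₁ ∧ M₂.IsCircuit C₂ ∧ e ∈ C₂ ∧ C = (C₁ ∪ C₂) \ {e}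

/-- The elements of `I` in the copy of `U_{2,4}` attached at `e`. -/
def u24Fiber {α : Type u} (I : Set (α ⊕ α × Fin 3)) (e : α) : Set (Fin 3) :=
  {i | Sum.inr (e, i) ∈ I}

/-- The elements of `I` that come from the original matroid, together with those `e` at which
`I` has at least two elements of the attached copy of `U_{2,4}` (so that `I` spans `e` there). -/
def u24Trace {α : Type u} (I : Set (α ⊕ α × Fin 3)) : Set α :=
  {a | Sum.inl a ∈ I} ∪ {e | (u24Fiber I e).Nontrivial}

/-- The ground set of `u24Sum N L`: every `e ∈ L` is replaced by three elements `(e, i)`. -/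
def u24Ground {α : Type u} (N : Matroid α) (L : Set α) : Set (α ⊕ α × Fin 3) :=
  Sum.inl '' (N.E \ L) ∪ Sum.inr '' (L ×ˢ univ)

/-- The independent sets of `u24Sum N L`. -/
def u24Indep {α : Type u} (N : Matroid α) (L : Set α) (I : Set (α ⊕ α × Fin 3)) : Prop :=
  I ⊆ u24Ground N L ∧ (∀ e, u24Fiber I e ≠ univ) ∧ N.Indep (u24Trace I)

theorem u24_insert_ne_univ {S : Set (Fin 3)} (hS : ¬ S.Nontrivial) (i : Fin 3) :
    insert i S ≠ univ := by
  intro h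
  apply hS
  have h0 : (0 : Fin 3) ∈ insert i S := by rw [h]; trivial
  have h1 : (1 : Fin 3) ∈ insert i S := by rw [h]; trivial
  have h2 : (2 : Fin 3) ∈ insert i S := by rw [h]; trivial
  simp only [mem_insert_iff] at h0 h1 h2
  fin_cases i
  · exact ⟨1, by simpa using h1, 2, by simpa using h2, by decide⟩
  · exact ⟨0, by simpa using h0, 2, by simpa using h2, by decide⟩
  · exact ⟨0, by simpa using h0, 1, by simpa using h1, by decide⟩

theorem u24_insert_eq_univ {S : Set (Fin 3)} (hS : S.Nontrivial) {i : Fin 3} (hi : i ∉ S) :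
    insert i S = univ := by
  obtain ⟨a, ha, b, hb, hab⟩ := hS
  ext j
  simp only [mem_insert_iff, mem_univ, iff_true]
  have hia : a ≠ i := fun h ↦ hi (h ▸ ha)
  have hib : b ≠ i := fun h ↦ hi (h ▸ hb)
  have : j = i ∨ j = a ∨ j = b := by omega
  rcases this with h | h | h
  · exact .inl h
  · exact .inr (h ▸ ha)
  · exact .inr (h ▸ hb)

theorem u24Fiber_mono {α : Type u} {I J : Set (α ⊕ α × Fin 3)} (h : I ⊆ J) (e : α) :
    u24Fiber I e ⊆ u24Fiber J e := fun _ hi ↦ h hi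

theorem u24Trace_mono {α : Type u} {I J : Set (α ⊕ α × Fin 3)} (h : I ⊆ J) :
    u24Trace I ⊆ u24Trace J := by
  rintro a (ha | ha)
  · exact .inl (h ha)
  · exact .inr (Set.Nontrivial.mono ha (u24Fiber_mono h a))

theorem u24Indep.subset {α : Type u} {N : Matroid α} {L : Set α} {I J : Set (α ⊕ α × Fin 3)}
    (hJ : u24Indep N L J) (h : I ⊆ J) : u24Indep N L I :=
  ⟨h.trans hJ.1, fun e he ↦ hJ.2.1 e (univ_subset_iff.1 (he ▸ u24Fiber_mono h e)),
    hJ.2.2.subset (u24Trace_mono h)⟩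

theorem inl_mem_u24Ground {α : Type u} {N : Matroid α} {L : Set α} {a : α} :
    Sum.inl a ∈ u24Ground N L ↔ a ∈ N.E ∧ a ∉ L := by
  simp [u24Ground]

theorem inr_mem_u24Ground {α : Type u} {N : Matroid α} {L : Set α} {e : α} {i : Fin 3} :
    Sum.inr (e, i) ∈ u24Ground N L ↔ e ∈ L := by
  simp [u24Ground]

theorem u24Indep.insert_inl {α : Type u} {N : Matroid α} {L : Set α} {I : Set (α ⊕ α × Fin 3)}
    (hI : u24Indep N L I) {a : α} (haL : a ∉ L) (ha : N.Indep (insert a (u24Trace I))) :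
    u24Indep N L (insert (Sum.inl a) I) := by
  refine ⟨insert_subset (inl_mem_u24Ground.2 ⟨ha.subset_ground (mem_insert _ _), haL⟩) hI.1,
    fun e ↦ ?_, ha.subset ?_⟩
  · have : u24Fiber (insert (Sum.inl a) I) e = u24Fiber I e := by ext; simp [u24Fiber]
    rw [this]
    exact hI.2.1 e
  · rintro b (hb | hb)
    · rcases hb with hb | hb
      · exact .inl (Sum.inl_injective hb)
      · exact .inr (.inl hb)
    · have : u24Fiber (insert (Sum.inl a) I) b = u24Fiber I b := by ext; simp [u24Fiber]
      exact .inr (.inr (by rw [mem_ofPred_eq, this] at hb; exact hb))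

theorem u24Fiber_insert_self {α : Type u} (I : Set (α ⊕ α × Fin 3)) (e : α) (i : Fin 3) :
    u24Fiber (insert (Sum.inr (e, i)) I) e = insert i (u24Fiber I e) := by
  ext; simp [u24Fiber]

theorem u24Fiber_insert_ne {α : Type u} (I : Set (α ⊕ α × Fin 3)) {e f : α} (i : Fin 3)
    (h : f ≠ e) : u24Fiber (insert (Sum.inr (e, i)) I) f = u24Fiber I f := by
  ext; simp [u24Fiber, h]

theorem u24Indep.insert_inr {α : Type u} {N : Matroid α} {L : Set α} {I : Set (α ⊕ α × Fin 3)}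
    (hI : u24Indep N L I) {e : α} {i : Fin 3} (heL : e ∈ L)
    (hne : insert i (u24Fiber I e) ≠ univ)
    (ha : (insert i (u24Fiber I e)).Nontrivial → N.Indep (insert e (u24Trace I))) :
    u24Indep N L (insert (Sum.inr (e, i)) I) := by
  refine ⟨insert_subset (inr_mem_u24Ground.2 heL) hI.1, fun f ↦ ?_, ?_⟩
  · by_cases hf : f = e
    · rw [hf, u24Fiber_insert_self]
      exact hne
    · rw [u24Fiber_insert_ne _ _ hf]
      exact hI.2.1 f
  · have hsub : ∀ b ∈ u24Trace (insert (Sum.inr (e, i)) I), b ∈ u24Trace I ∨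
        (b = e ∧ (insert i (u24Fiber I e)).Nontrivial) := by
      rintro b (hb | hb)
      · exact .inl (.inl (by simpa using hb))
      · by_cases hbe : b = e
        · subst hbe
          exact .inr ⟨rfl, by rw [← u24Fiber_insert_self]; exact hb⟩
        · exact .inl (.inr (by rw [mem_ofPred_eq, u24Fiber_insert_ne _ i hbe] at hb; exact hb))
    by_cases hnt : (insert i (u24Fiber I e)).Nontrivial
    · exact (ha hnt).subset fun b hb ↦ (hsub b hb).elim .inr fun h ↦ .inl h.1
    · exact hI.2.2.subset fun b hb ↦ (hsub b hb).elim id fun h ↦ (hnt h.2).elim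

/-- Maximal independent sets restrict to a basis of `N` and meet every copy of `U_{2,4}`. -/
theorem u24_maximal_iff {α : Type u} {N : Matroid α} {L : Set α} {I : Set (α ⊕ α × Fin 3)}
    (hI : u24Indep N L I) :
    Maximal (u24Indep N L) I ↔ N.IsBase (u24Trace I) ∧ ∀ e ∈ L, (u24Fiber I e).Nonempty := by
  constructor
  · intro hmax
    have hnot : ∀ x, x ∉ I → ¬ u24Indep N L (insert x I) := fun x hx h ↦
      hx (hmax.2 h (subset_insert _ _) (mem_insert _ _))
    constructor
    · by_contra hb
      obtain ⟨x, hx, hxi⟩ := hI.2.2.exists_insert_of_not_isBase hb N.exists_isBase.choose_spec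
      by_cases hxL : x ∈ L
      · have hnt : ¬ (u24Fiber I x).Nontrivial := fun h ↦ hx.2 (.inr h)
        have : ∃ i, i ∉ u24Fiber I x := by
          by_contra! h
          exact hI.2.1 x (eq_univ_of_forall h)
        obtain ⟨i, hi⟩ := this
        exact hnot _ hi (hI.insert_inr hxL (u24_insert_ne_univ hnt i) fun _ ↦ hxi)
      · exact hnot _ (fun h ↦ hx.2 (.inl h)) (hI.insert_inl hxL hxi)
    · intro e heL
      by_contra he
      rw [not_nonempty_iff_eq_empty] at he
      have hs : ¬ (insert (0 : Fin 3) (u24Fiber I e)).Nontrivial := by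
        rw [he]
        simp
      refine hnot (Sum.inr (e, 0)) (fun h ↦ ?_)
        (hI.insert_inr heL (u24_insert_ne_univ ?_ 0) fun h ↦ (hs h).elim)
      · have : (0 : Fin 3) ∈ u24Fiber I e := h
        rw [he] at this
        exact this
      · rw [he]
        simp
  · rintro ⟨hb, hne⟩
    refine ⟨hI, fun J hJ hIJ ↦ ?_⟩
    have htr : u24Trace I = u24Trace J := hb.eq_of_subset_indep hJ.2.2 (u24Trace_mono hIJ)
    rintro (a | ⟨e, i⟩) hx
    · have ha : a ∈ u24Trace I := htr ▸ .inl hx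
      rcases ha with ha | ⟨i, hi, -⟩
      · exact ha
      · exact ((inl_mem_u24Ground.1 (hJ.1 hx)).2 (inr_mem_u24Ground.1 (hI.1 hi))).elim
    · by_contra hxI
      have heL : e ∈ L := inr_mem_u24Ground.1 (hJ.1 hx)
      obtain ⟨j, hj⟩ := hne e heL
      have hij : i ≠ j := fun h ↦ hxI (h ▸ hj)
      have heT : e ∈ u24Trace I := htr ▸ .inr ⟨i, hx, j, hIJ hj, hij⟩
      rcases heT with he | he
      · exact (inl_mem_u24Ground.1 (hI.1 he)).2 heL
      · have hsub : insert i (u24Fiber I e) ⊆ u24Fiber J e :=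
          insert_subset hx (u24Fiber_mono hIJ e)
        rw [u24_insert_eq_univ he hxI] at hsub
        exact hJ.2.1 e (univ_subset_iff.1 hsub)

theorem u24_aug {α : Type u} (N : Matroid α) (L : Set α) ⦃I B : Set (α ⊕ α × Fin 3)⦄
    (hI : u24Indep N L I) (hImax : ¬ Maximal (u24Indep N L) I)
    (hB : Maximal (u24Indep N L) B) : ∃ x ∈ B \ I, u24Indep N L (insert x I) := by
  obtain ⟨hBb, hBne⟩ := (u24_maximal_iff hB.prop).1 hB
  rw [u24_maximal_iff hI] at hImax
  by_cases hb : N.IsBase (u24Trace I)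
  · have : ∃ e ∈ L, ¬ (u24Fiber I e).Nonempty := by
      by_contra! h
      exact hImax ⟨hb, h⟩
    obtain ⟨e, heL, he⟩ := this
    rw [not_nonempty_iff_eq_empty] at he
    obtain ⟨i, hi⟩ := hBne e heL
    have hs : ¬ (insert i (u24Fiber I e)).Nontrivial := by
      rw [he]
      simp
    refine ⟨Sum.inr (e, i), ⟨hi, fun h ↦ ?_⟩,
      hI.insert_inr heL (u24_insert_ne_univ ?_ i) fun h ↦ (hs h).elim⟩
    · have : i ∈ u24Fiber I e := h
      rw [he] at this
      exact this
    · rw [he]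
      simp
  · obtain ⟨x, hx, hxi⟩ := hI.2.2.exists_insert_of_not_isBase hb hBb
    rcases hx.1 with hxB | hxB
    · exact ⟨Sum.inl x, ⟨hxB, fun h ↦ hx.2 (.inl h)⟩,
        hI.insert_inl (inl_mem_u24Ground.1 (hB.prop.1 hxB)).2 hxi⟩
    · have hnt : ¬ (u24Fiber I x).Nontrivial := fun h ↦ hx.2 (.inr h)
      have : ∃ i ∈ u24Fiber B x, i ∉ u24Fiber I x := by
        by_contra! h
        exact hnt (Set.Nontrivial.mono hxB h)
      obtain ⟨i, hiB, hi⟩ := this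
      exact ⟨Sum.inr (x, i), ⟨hiB, hi⟩,
        hI.insert_inr (inr_mem_u24Ground.1 (hB.prop.1 hiB)) (u24_insert_ne_univ hnt i)
          fun _ ↦ hxi⟩

theorem u24_maximality {α : Type u} (N : Matroid α) (L : Set α) (X : Set (α ⊕ α × Fin 3))
    (hX : X ⊆ u24Ground N L) : ExistsMaximalSubsetProperty (u24Indep N L) X := by
  intro I hI hIX
  obtain ⟨J, hJ, hIJ⟩ := hI.2.2.subset_isBasis'_of_subset (u24Trace_mono hIX)
  have hT : ∀ e, ∃ T, u24Fiber I e ⊆ T ∧ Maximal (fun T : Set (Fin 3) ↦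
      T ⊆ u24Fiber X e ∧ T ≠ univ ∧ (T.Nontrivial → e ∈ J)) T := fun e ↦
    (toFinite {T : Set (Fin 3) |
      T ⊆ u24Fiber X e ∧ T ≠ univ ∧ (T.Nontrivial → e ∈ J)}).exists_le_maximal
        (show u24Fiber I e ∈ _ from
          ⟨u24Fiber_mono hIX e, hI.2.1 e, fun h ↦ hIJ (.inr h)⟩)
  choose T hIT hTmax using hT
  set K : Set (α ⊕ α × Fin 3) :=
    {x | x ∈ X ∧ Sum.elim (fun a ↦ a ∈ J) (fun p ↦ p.2 ∈ T p.1) x} with hK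
  have hKfib : ∀ e, u24Fiber K e = T e := fun e ↦ by
    ext i
    exact ⟨fun h ↦ h.2, fun h ↦ ⟨(hTmax e).prop.1 h, h⟩⟩
  have hKJ : u24Trace K ⊆ J := by
    rintro a (ha | ha)
    · exact ha.2
    · have ha' : (u24Fiber K a).Nontrivial := ha
      rw [hKfib] at ha'
      exact (hTmax a).prop.2.2 ha'
  have hKi : u24Indep N L K :=
    ⟨fun x hx ↦ hX hx.1, fun e ↦ by rw [hKfib]; exact (hTmax e).prop.2.1,
      hJ.indep.subset hKJ⟩
  have hJK : J ⊆ u24Trace K := by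
    intro a haJ
    rcases hJ.subset haJ with ha | ha
    · exact .inl ⟨ha, haJ⟩
    · refine .inr ?_
      show (u24Fiber K a).Nontrivial
      rw [hKfib]
      by_contra hnt
      have : ∃ i ∈ u24Fiber X a, i ∉ T a := by
        by_contra! h
        exact hnt (Set.Nontrivial.mono ha h)
      obtain ⟨i, hiX, hi⟩ := this
      exact hi ((hTmax a).2 (y := insert i (T a))
        ⟨insert_subset hiX (hTmax a).prop.1, u24_insert_ne_univ hnt i, fun _ ↦ haJ⟩
        (subset_insert _ _) (mem_insert _ _))
  refine ⟨K, ?_, ⟨hKi, fun x hx ↦ hx.1⟩, ?_⟩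
  · rintro (a | ⟨e, i⟩) hx
    · exact ⟨hIX hx, hIJ (.inl hx)⟩
    · exact ⟨hIX hx, hIT e hx⟩
  · rintro K' ⟨hK', hK'X⟩ hKK'
    have htr : J = u24Trace K' :=
      hJ.eq_of_subset_indep hK'.2.2 (hJK.trans (u24Trace_mono hKK')) (u24Trace_mono hK'X)
    rintro (a | ⟨e, i⟩) hx
    · exact ⟨hK'X hx, show a ∈ J from htr ▸ .inl hx⟩
    · refine ⟨hK'X hx, (hTmax e).2 (y := u24Fiber K' e)
        ⟨u24Fiber_mono hK'X e, hK'.2.1 e, fun h ↦ htr ▸ .inr h⟩ ?_ hx⟩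
      rw [← hKfib e]
      exact u24Fiber_mono hKK' e

/-- The matroid obtained from `N` by taking the 2-sum with a copy of `U_{2,4}` on each element of
`L`. The copy at `e ∈ L` has ground set `e, (e, 0), (e, 1), (e, 2)`, so `e` is replaced by the
three elements `(e, i)`. The theorems `u24Sum_empty` and `u24Sum_insert_isTwoSum` below show that
this is the result of performing the 2-sums one after the other, in any order. -/
def u24Sum {α : Type u} (N : Matroid α) (L : Set α) : Matroid (α ⊕ α × Fin 3) :=
  IndepMatroid.matroid
    { E := u24Ground N L
      Indep := u24Indep N L
      indep_empty := by
        have hf : ∀ e, u24Fiber (∅ : Set (α ⊕ α × Fin 3)) e = ∅ := fun e ↦ rfl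
        refine ⟨empty_subset _, fun e ↦ by rw [hf]; exact empty_ne_univ, ?_⟩
        have : u24Trace (∅ : Set (α ⊕ α × Fin 3)) = ∅ := by
          ext
          simp [u24Trace, hf]
        rw [this]
        exact N.empty_indep
      indep_subset := fun _ _ hJ h ↦ hJ.subset h
      indep_aug := u24_aug N L
      indep_maximal := u24_maximality N L
      subset_ground := fun _ h ↦ h.1 }

theorem u24Sum_indep_iff {α : Type u} {N : Matroid α} {L : Set α} {I : Set (α ⊕ α × Fin 3)} :
    (u24Sum N L).Indep I ↔ u24Indep N L I := Iff.rfl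

theorem u24Sum_ground {α : Type u} (N : Matroid α) (L : Set α) :
    (u24Sum N L).E = u24Ground N L := rfl

/-- With no 2-sums taken, `u24Sum N ∅` is `N`, on the left summand. -/
theorem u24Sum_empty {α : Type u} (N : Matroid α) :
    u24Sum N ∅ = N.map Sum.inl Sum.inl_injective.injOn := by
  refine ext_indep (by simp [u24Sum_ground, u24Ground]) fun I hI ↦ ?_
  have hfib : ∀ e, u24Fiber I e = ∅ := fun e ↦
    eq_empty_of_forall_notMem fun i hi ↦ inr_mem_u24Ground.1 (hI hi)
  have htr : u24Trace I = Sum.inl ⁻¹' I := by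
    ext a
    simp [u24Trace, hfib]
  have himg : Sum.inl '' (Sum.inl ⁻¹' I : Set α) = I := by
    refine image_preimage_eq_of_subset ?_
    rintro (a | ⟨e, i⟩) hx
    · exact ⟨a, rfl⟩
    · exact (inr_mem_u24Ground.1 (hI hx)).elim
  rw [u24Sum_indep_iff, map_indep_iff]
  constructor
  · rintro ⟨-, -, h⟩
    exact ⟨_, htr ▸ h, himg.symm⟩
  · rintro ⟨I₀, h, rfl⟩
    refine ⟨hI, fun e ↦ by rw [hfib]; exact empty_ne_univ, ?_⟩
    rw [htr, preimage_image_eq _ Sum.inl_injective]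
    exact h

theorem uniformOn_isCircuit_iff {α : Type u} {r : ℕ} {E C : Set α} :
    (uniformOn r E).IsCircuit C ↔ C ⊆ E ∧ C.encard = r + 1 := by
  have hind : ∀ I, (uniformOn r E).Indep I ↔ I ⊆ E ∧ I.encard ≤ r := fun I ↦ Iff.rfl
  have hE : (uniformOn r E).E = E := rfl
  rw [isCircuit_iff_dep_forall_sdiff_singleton_indep, Dep, hE]
  constructor
  · rintro ⟨⟨h1, h2⟩, h3⟩
    refine ⟨h2, le_antisymm ?_ ?_⟩
    · obtain ⟨x, hx⟩ : C.Nonempty := by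
        rw [nonempty_iff_ne_empty]
        rintro rfl
        exact h1 (empty_indep _)
      rw [← encard_sdiff_singleton_add_one hx]
      gcongr
      exact ((hind _).1 (h3 x hx)).2
    · refine Order.add_one_le_of_lt (lt_of_not_ge fun h ↦ h1 ((hind _).2 ⟨h2, h⟩))
  · rintro ⟨h1, h2⟩
    refine ⟨⟨fun h ↦ ?_, h1⟩, fun x hx ↦ (hind _).2 ⟨sdiff_subset.trans h1, ?_⟩⟩
    · have := ((hind _).1 h).2
      rw [h2] at this
      exact absurd this (by norm_cast; omega)
    · have := encard_sdiff_singleton_add_one hx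
      rw [h2] at this
      exact (ENat.add_left_injective_of_ne_top (n := 1) (by simp) this).le

/-- The copy of `U_{2,4}` attached at `e`, with basepoint `Sum.inl e`. -/
def u24Copy {α : Type u} (e : α) : Matroid (α ⊕ α × Fin 3) :=
  uniformOn 2 (insert (Sum.inl e) (range fun i ↦ Sum.inr (e, i)))

theorem u24Sum_insert_indep_iff {α : Type u} {N : Matroid α} {L : Set α} {e : α}
    (heN : e ∈ N.E) (heL : e ∉ L) {I : Set (α ⊕ α × Fin 3)}
    (hI : I ⊆ u24Ground N (insert e L)) :
    (u24Sum N (insert e L)).Indep I ↔ u24Fiber I e ≠ univ ∧ (u24Sum N L).Indep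
      (I \ range (fun i ↦ Sum.inr (e, i)) ∪ {x | x = Sum.inl e ∧ (u24Fiber I e).Nontrivial}) := by
  set A : Set (α ⊕ α × Fin 3) :=
    I \ range (fun i ↦ Sum.inr (e, i)) ∪ {x | x = Sum.inl e ∧ (u24Fiber I e).Nontrivial} with hA
  have hinl : ∀ a, Sum.inl a ∈ A ↔ Sum.inl a ∈ I ∨ (a = e ∧ (u24Fiber I e).Nontrivial) := by
    intro a
    simp [hA]
  have hinr : ∀ f i, Sum.inr (f, i) ∈ A ↔ Sum.inr (f, i) ∈ I ∧ f ≠ e := by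
    intro f i
    simp [hA, eq_comm]
  have hfe : u24Fiber A e = ∅ := by
    ext i
    simp [u24Fiber, hinr]
  have hff : ∀ f, f ≠ e → u24Fiber A f = u24Fiber I f := by
    intro f hf
    ext i
    simp [u24Fiber, hinr, hf]
  have htr : u24Trace A = u24Trace I := by
    ext a
    by_cases ha : a = e
    · subst ha
      simp [u24Trace, hinl, hfe]
    · simp [u24Trace, hinl, hff a ha, ha]
  have hAg : A ⊆ u24Ground N L := by
    rintro (a | ⟨f, i⟩) hx
    · rw [hinl] at hx
      rw [inl_mem_u24Ground]
      rcases hx with hx | ⟨rfl, -⟩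
      · have := inl_mem_u24Ground.1 (hI hx)
        exact ⟨this.1, fun h ↦ this.2 (.inr h)⟩
      · exact ⟨heN, heL⟩
    · rw [hinr] at hx
      exact inr_mem_u24Ground.2 ((inr_mem_u24Ground.1 (hI hx.1)).resolve_left hx.2)
  rw [u24Sum_indep_iff, u24Sum_indep_iff, u24Indep, u24Indep, htr]
  constructor
  · rintro ⟨-, h2, h3⟩
    refine ⟨h2 e, hAg, fun f ↦ ?_, h3⟩
    by_cases hf : f = e
    · rw [hf, hfe]
      exact empty_ne_univ
    · rw [hff f hf]
      exact h2 f
  · rintro ⟨h1, -, h2, h3⟩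
    refine ⟨hI, fun f ↦ ?_, h3⟩
    by_cases hf : f = e
    · rw [hf]
      exact h1
    · rw [← hff f hf]
      exact h2 f

/-- Going from `L` to `L ∪ {e}` is a 2-sum with a copy of `U_{2,4}` on the element `e`
(which must not be a loop of `N`, as always for 2-sums). -/
theorem u24Sum_insert_isTwoSum {α : Type u} {N : Matroid α} {L : Set α} {e : α}
    (he : N.IsNonloop e) (heL : e ∉ L) :
    (u24Sum N (insert e L)).IsTwoSum (u24Sum N L) (u24Copy e) (Sum.inl e) := by
  have heN := he.mem_ground
  set P : Set (α ⊕ α × Fin 3) := range (fun i ↦ Sum.inr (e, i)) with hP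
  have hUE : (u24Copy e).E = insert (Sum.inl e) P := rfl
  have heP : Sum.inl e ∉ P := by simp [hP]
  have hPg : Disjoint P (u24Ground N L) := by
    rw [disjoint_left]
    rintro _ ⟨i, rfl⟩ h
    exact heL (inr_mem_u24Ground.1 h)
  have heg : Sum.inl e ∈ u24Ground N L := inl_mem_u24Ground.2 ⟨heN, heL⟩
  have hg' : u24Ground N (insert e L) = (u24Ground N L ∪ insert (Sum.inl e) P) \ {Sum.inl e} := by
    ext (a | ⟨f, i⟩)
    · by_cases ha : a = e <;> simp [inl_mem_u24Ground, hP, ha]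
    · simp [inr_mem_u24Ground, hP]
      tauto
  have hg'2 : ∀ x, x ∈ u24Ground N L → x ≠ Sum.inl e → x ∈ u24Ground N (insert e L) := by
    intro x h1 h2
    rw [hg']
    exact ⟨.inl h1, h2⟩
  have hPg' : P ⊆ u24Ground N (insert e L) := by
    rw [hg']
    exact fun x hx ↦ ⟨.inr (.inr hx), fun h ↦ heP (h ▸ hx)⟩
  have heg' : Sum.inl e ∉ u24Ground N (insert e L) := by
    rw [hg']
    simp
  have hfibuniv : ∀ I : Set (α ⊕ α × Fin 3), u24Fiber I e = univ ↔ P ⊆ I := by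
    intro I
    rw [eq_univ_iff_forall, hP, range_subset_iff]
    rfl
  have key : ∀ I : Set (α ⊕ α × Fin 3), I ⊆ u24Ground N (insert e L) →
      ((u24Sum N (insert e L)).Indep I ↔ u24Fiber I e ≠ univ ∧ (u24Sum N L).Indep
        (I \ P ∪ {x | x = Sum.inl e ∧ (u24Fiber I e).Nontrivial})) :=
    fun I hI ↦ u24Sum_insert_indep_iff heN heL hI
  have hsing : (u24Sum N L).Indep {Sum.inl e} := by
    refine ⟨singleton_subset_iff.2 heg, fun f ↦ ?_, ?_⟩
    · have : u24Fiber ({Sum.inl e} : Set (α ⊕ α × Fin 3)) f = ∅ := by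
        ext
        simp [u24Fiber]
      rw [this]
      exact empty_ne_univ
    · refine (indep_singleton.2 he).subset ?_
      rintro a (ha | ha)
      · simpa using ha
      · obtain ⟨i, hi, -⟩ := ha
        simp [u24Fiber] at hi
  -- sets avoiding the new copy
  have keyA : ∀ I : Set (α ⊕ α × Fin 3), I ⊆ u24Ground N L → Sum.inl e ∉ I →
      ((u24Sum N (insert e L)).Indep I ↔ (u24Sum N L).Indep I) := by
    intro I hI heI
    have hf : u24Fiber I e = ∅ :=
      eq_empty_of_forall_notMem fun i hi ↦ heL (inr_mem_u24Ground.1 (hI hi))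
    rw [key I fun x hx ↦ hg'2 x (hI hx) (fun h ↦ heI (h ▸ hx)), hf]
    simp [(hPg.mono_right hI).symm.sdiff_eq_left, empty_ne_univ]
  have c1 : ∀ C, (u24Sum N L).IsCircuit C → Sum.inl e ∉ C →
      (u24Sum N (insert e L)).IsCircuit C := by
    intro C hC heC
    have hCg : C ⊆ u24Ground N L := hC.subset_ground
    rw [isCircuit_iff_dep_forall_sdiff_singleton_indep]
    refine ⟨⟨?_, fun x hx ↦ hg'2 x (hCg hx) fun h ↦ heC (h ▸ hx)⟩, fun x hx ↦ ?_⟩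
    · rw [keyA C hCg heC]
      exact hC.not_indep
    · rw [keyA _ (sdiff_subset.trans hCg) fun h ↦ heC h.1]
      exact hC.sdiff_singleton_indep hx
  have c2 : (u24Sum N (insert e L)).IsCircuit P := by
    rw [isCircuit_iff_dep_forall_sdiff_singleton_indep]
    refine ⟨⟨fun h ↦ ((key P hPg').1 h).1 ((hfibuniv P).2 subset_rfl), hPg'⟩, fun x hx ↦ ?_⟩
    rw [key _ (sdiff_subset.trans hPg')]
    refine ⟨fun h ↦ ((hfibuniv _).1 h hx).2 rfl, hsing.subset ?_⟩
    rintro y (hy | hy)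
    · exact (hy.2 hy.1.1).elim
    · exact hy.1
  have c3 : ∀ C₁ i j, (u24Sum N L).IsCircuit C₁ → Sum.inl e ∈ C₁ → i ≠ j →
      (u24Sum N (insert e L)).IsCircuit
        (C₁ \ {Sum.inl e} ∪ {Sum.inr (e, i), Sum.inr (e, j)}) := by
    intro C₁ i j hC heC hij
    set C := C₁ \ {Sum.inl e} ∪ {Sum.inr (e, i), Sum.inr (e, j)} with hCdef
    have hC₁g : C₁ ⊆ u24Ground N L := hC.subset_ground
    have hC₁P : ∀ x ∈ C₁, x ∉ P := fun x hx h ↦ disjoint_left.1 hPg h (hC₁g hx)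
    have hCg : C ⊆ u24Ground N (insert e L) := by
      rintro x (hx | rfl | rfl)
      · exact hg'2 x (hC₁g hx.1) hx.2
      · exact hPg' ⟨i, rfl⟩
      · exact hPg' ⟨j, rfl⟩
    have hfib : ∀ k, k ∈ u24Fiber C e ↔ k = i ∨ k = j := by
      intro k
      have : Sum.inr (e, k) ∉ C₁ := fun h ↦ hC₁P _ h ⟨k, rfl⟩
      simp [u24Fiber, hCdef, this]
    have hnu : u24Fiber C e ≠ univ := by
      intro h
      have h3 : ∀ k : Fin 3, k = i ∨ k = j := fun k ↦ (hfib k).1 (h ▸ mem_univ k)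
      have h0 := h3 0
      have h1 := h3 1
      have h2 := h3 2
      omega
    rw [isCircuit_iff_dep_forall_sdiff_singleton_indep]
    refine ⟨⟨fun h ↦ hC.not_indep (((key C hCg).1 h).2.subset ?_), hCg⟩, fun x hx ↦ ?_⟩
    · intro x hx
      by_cases hxe : x = Sum.inl e
      · exact .inr ⟨hxe, i, (hfib i).2 (.inl rfl), j, (hfib j).2 (.inr rfl), hij⟩
      · exact .inl ⟨.inl ⟨hx, hxe⟩, hC₁P x hx⟩
    · rw [key _ (sdiff_subset.trans hCg)]
      refine ⟨fun h ↦ hnu (univ_subset_iff.1 (h ▸ u24Fiber_mono sdiff_subset e)), ?_⟩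
      by_cases hxC : x ∈ C₁
      · refine (hC.sdiff_singleton_indep hxC).subset ?_
        have hxe : x ≠ Sum.inl e := by
          rintro rfl
          exact heg' (hCg hx)
        rintro y (⟨⟨hy | rfl | rfl, hy2⟩, hy3⟩ | ⟨rfl, -⟩)
        · exact ⟨hy.1, hy2⟩
        · exact (hy3 ⟨i, rfl⟩).elim
        · exact (hy3 ⟨j, rfl⟩).elim
        · exact ⟨heC, fun h ↦ hxe h.symm⟩
      · refine (hC.sdiff_singleton_indep heC).subset ?_
        rintro y (⟨⟨hy | rfl | rfl, hy2⟩, hy3⟩ | ⟨rfl, h⟩)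
        · exact hy
        · exact (hy3 ⟨i, rfl⟩).elim
        · exact (hy3 ⟨j, rfl⟩).elim
        · exfalso
          obtain ⟨a, ha, b, hb, hab⟩ := h
          have ha2 := (hfib a).1 ha.1
          have hb2 := (hfib b).1 hb.1
          have hai : Sum.inr (e, a) ≠ x := ha.2
          have hbi : Sum.inr (e, b) ≠ x := hb.2
          rcases hx with hx | rfl | rfl
          · exact hxC hx.1
          · have h1 : a ≠ i := fun h ↦ hai (by rw [h])
            have h2 : b ≠ i := fun h ↦ hbi (by rw [h])
            omega
          · have h1 : a ≠ j := fun h ↦ hai (by rw [h])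
            have h2 : b ≠ j := fun h ↦ hbi (by rw [h])
            omega
  -- the circuits of the copy of `U_{2,4}`
  have hUc : ∀ C, (u24Copy e).IsCircuit C ↔ C ⊆ insert (Sum.inl e) P ∧ C.encard = 3 := by
    intro C
    have h3 : ((2 : ℕ) : ℕ∞) + 1 = 3 := by norm_num
    rw [u24Copy, uniformOn_isCircuit_iff, h3]
  have hPcard : P.encard = 3 := by
    have hinj : Function.Injective (fun i : Fin 3 ↦ (Sum.inr (e, i) : α ⊕ α × Fin 3)) := by
      intro i j h
      simpa using h
    rw [hP, ← image_univ, hinj.encard_image]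
    simp
  have hUP : ∀ C, (u24Copy e).IsCircuit C → Sum.inl e ∉ C → C = P := by
    intro C hC heC
    obtain ⟨h1, h2⟩ := (hUc C).1 hC
    refine Set.Finite.eq_of_subset_of_encard_le' (Set.finite_range _)
      ((subset_insert_iff_of_notMem heC).1 h1) ?_
    rw [h2]
    exact hPcard.le
  have hUpair : ∀ C, (u24Copy e).IsCircuit C → Sum.inl e ∈ C → ∃ i j, i ≠ j ∧
      C \ {Sum.inl e} = {Sum.inr (e, i), Sum.inr (e, j)} := by
    intro C hC heC
    obtain ⟨h1, h2⟩ := (hUc C).1 hC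
    have h3 := encard_sdiff_singleton_add_one heC
    rw [h2] at h3
    have h4 : (C \ {Sum.inl e}).encard = 2 :=
      ENat.add_left_injective_of_ne_top (n := 1) (by simp) (h3.trans (by norm_num))
    obtain ⟨x, y, hxy, h5⟩ := encard_eq_two.1 h4
    have hm : ∀ z ∈ C \ {Sum.inl e}, z ∈ P := fun z hz ↦ (h1 hz.1).resolve_left hz.2
    obtain ⟨i, rfl⟩ := hm x (h5 ▸ .inl rfl)
    obtain ⟨j, rfl⟩ := hm y (h5 ▸ .inr rfl)
    exact ⟨i, j, fun h ↦ hxy (by rw [h]), h5⟩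
  have hUtri : ∀ i j, i ≠ j → (u24Copy e).IsCircuit
      {Sum.inl e, Sum.inr (e, i), Sum.inr (e, j)} := by
    intro i j hij
    rw [hUc]
    refine ⟨?_, ?_⟩
    · rintro x (rfl | rfl | rfl)
      · exact .inl rfl
      · exact .inr ⟨i, rfl⟩
      · exact .inr ⟨j, rfl⟩
    · rw [encard_insert_of_notMem (by simp), encard_pair (by simpa using hij)]
      norm_num
  refine ⟨?_, ?_, fun C ↦ ⟨fun hC ↦ ?_, ?_⟩⟩
  · rw [hUE, u24Sum_ground]
    ext x
    constructor
    · rintro ⟨h1, rfl | h2⟩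
      · rfl
      · exact (disjoint_left.1 hPg h2 h1).elim
    · rintro rfl
      exact ⟨heg, .inl rfl⟩
  · rw [hUE, u24Sum_ground, u24Sum_ground, hg']
  · have hCg : C ⊆ u24Ground N (insert e L) := hC.subset_ground
    by_cases hfu : u24Fiber C e = univ
    · have hPC : P = C := c2.eq_of_subset_isCircuit hC ((hfibuniv C).1 hfu)
      refine .inr (.inl ⟨?_, fun h ↦ heg' (hCg h)⟩)
      rw [← hPC, hUc]
      exact ⟨subset_insert _ _, hPcard⟩
    · have hni : ¬ (u24Sum N L).Indep
          (C \ P ∪ {x | x = Sum.inl e ∧ (u24Fiber C e).Nontrivial}) := fun h ↦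
        hC.not_indep ((key C hCg).2 ⟨hfu, h⟩)
      have hsub : (C \ P ∪ {x | x = Sum.inl e ∧ (u24Fiber C e).Nontrivial}) ⊆
          (u24Sum N L).E := by
        rintro x (hx | ⟨rfl, -⟩)
        · have := hCg hx.1
          rw [hg'] at this
          rcases this with ⟨h | h | h, h2⟩
          · exact h
          · exact (h2 h).elim
          · exact (hx.2 h).elim
        · exact heg
      obtain ⟨C₁, hC₁s, hC₁⟩ := (show (u24Sum N L).Dep _ from ⟨hni, hsub⟩).exists_isCircuit_subset
      by_cases heC₁ : Sum.inl e ∈ C₁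
      · have hnt : (u24Fiber C e).Nontrivial := by
          rcases hC₁s heC₁ with h | h
          · exact (heg' (hCg h.1)).elim
          · exact h.2
        obtain ⟨i, hi, j, hj, hij⟩ := hnt
        have hss : C₁ \ {Sum.inl e} ∪ {Sum.inr (e, i), Sum.inr (e, j)} ⊆ C := by
          rintro x (hx | rfl | rfl)
          · exact (hC₁s hx.1).elim (fun h ↦ h.1) fun h ↦ (hx.2 h.1).elim
          · exact hi
          · exact hj
        have heq := (c3 C₁ i j hC₁ heC₁ hij).eq_of_subset_isCircuit hC hss
        refine .inr (.inr ⟨C₁, _, hC₁, heC₁, hUtri i j hij, .inl rfl, ?_⟩)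
        rw [← heq, union_sdiff_distrib]
        congr 1
        ext x
        simp only [mem_insert_iff, mem_singleton_iff, mem_sdiff]
        constructor
        · rintro (rfl | rfl) <;> simp
        · rintro ⟨h1 | h1, h2⟩
          · exact (h2 h1).elim
          · exact h1
      · have hss : C₁ ⊆ C := fun x hx ↦
          (hC₁s hx).elim (fun h ↦ h.1) fun h ↦ (heC₁ (h.1 ▸ hx)).elim
        have heq := (c1 C₁ hC₁ heC₁).eq_of_subset_isCircuit hC hss
        exact .inl (heq ▸ ⟨hC₁, heC₁⟩)
  · rintro (⟨h1, h2⟩ | ⟨h1, h2⟩ | ⟨C₁, C₂, h1, h2, h3, h4, rfl⟩)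
    · exact c1 C h1 h2
    · rw [hUP C h1 h2]
      exact c2
    · obtain ⟨i, j, hij, h5⟩ := hUpair C₂ h3 h4
      rw [union_sdiff_distrib, h5]
      exact c3 C₁ i j h1 h2 hij

/-- The matroid `N₉`, obtained from `U_{2,3}` by taking the 2-sum with a copy of `U_{2,4}` on
each of its three elements. -/
def nNine : Matroid (Fin 3 ⊕ Fin 3 × Fin 3) :=
  u24Sum (uniformOn 2 (univ : Set (Fin 3))) univ

end Matroid

/-! Since `L ⊆ N.E`, either `N` has at least four elements or `L = N.E` has exactly three. Three
elements leave only rank one and rank two, as 3-connectivity forbids loops and coloops. In rank one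
the matroid is frame, all of `N` being represented by a single frame element; in rank two `N` is
`U_{2,3}` and the result is `N₉`. The real content is that four or more elements contradict
minimality.

Take distinct `e, f, g ∈ L`. Contracting one element of the copy of `U_{2,4}` at `e` and deleting
another undoes the 2-sum at `e`, so the matroid with copies at `L \ {e}` is frame; represent it over
a frame `B` whose size is its rank. Deleting the triangle at some `l` leaves a set of rank `|B| -
1`. The connectivity of `N \ l` forces this set to span all of `B` except one element `a`, and then
the triangle lies on a line through `a` and another frame element `x`
(`IsFrameRep.exists_line_of_isKConnected`). Replacing each triangle by its `x` and discarding the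
elements `a` gives a frame representation of `N` itself in which every element of `L \ {e}` is a
frame element (`IsFrameRep.exists_isFrameRep_of_u24Sum`).

If `e` is parallel to a frame element, all of `L` can be placed in the frame. One new frame element
for each `l ∈ L` then accommodates its copy of `U_{2,4}`, so the whole matroid is frame
(`IsFrameRep.isFrame_u24Sum`), which is impossible. Otherwise `e` lies properly on a line spanned by
two frame elements `u, v`. Since `N` is 3-connected, linking supplies a set whose contraction makes
the lines `{f, g}` and `{u, v}` coincide, with `e` parallel to neither `f` nor `g`; hence some
circuit of `N` contains `e, f, g` (`IsFrameRep.exists_isCircuit`). Contracting the rest of this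
circuit, together with its copies, exhibits `N₉` as a proper minor. But `N₉` is not frame, by a
count of the frame elements that support its three triangles (`not_isFrame_u24Sum_uniformOn`).

The tool used throughout is that when `P` is pair-spanned by an independent set `B`, distinct
parallel classes of `B` in the contraction `Q ／ P` are independent of each other
(`PairSpanned.notMem_closure_union`). -/

namespace Matroid

/-! ### Rank calculus, and parallel classes of a frame after contraction -/

section Rank

variable {β : Type*} {Q : Matroid β} {X Y S T U B P I : Set β} {x y b c : β}

/-- The rank of a set, as a natural number (meaningful for matroids of finite rank). -/
noncomputable def rk (Q : Matroid β) (X : Set β) : ℕ := (Q.eRk X).toNat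

theorem coe_rk (Q : Matroid β) [Q.RankFinite] (X : Set β) : (Q.rk X : ℕ∞) = Q.eRk X :=
  ENat.natCast_toNat (eRk_ne_top_iff.2 (Q.isRkFinite_set X))

theorem rk_mono (Q : Matroid β) [Q.RankFinite] (h : X ⊆ Y) : Q.rk X ≤ Q.rk Y := by
  have := Q.eRk_mono h
  rw [← coe_rk, ← coe_rk] at this
  exact_mod_cast this

theorem rk_submod (Q : Matroid β) [Q.RankFinite] (X Y : Set β) :
    Q.rk (X ∩ Y) + Q.rk (X ∪ Y) ≤ Q.rk X + Q.rk Y := by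
  have := Q.eRk_inter_add_eRk_union_le X Y
  simp only [← coe_rk] at this
  exact_mod_cast this

theorem rk_union_le (Q : Matroid β) [Q.RankFinite] (X Y : Set β) :
    Q.rk (X ∪ Y) ≤ Q.rk X + Q.rk Y := by
  have := Q.rk_submod X Y
  omega

@[simp] theorem rk_empty (Q : Matroid β) : Q.rk ∅ = 0 := by
  simp [rk]

@[simp] theorem rk_closure (Q : Matroid β) (X : Set β) : Q.rk (Q.closure X) = Q.rk X := by
  simp [rk]

theorem rk_le_ncard (Q : Matroid β) (hX : X.Finite) : Q.rk X ≤ X.ncard := by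
  rw [rk, ncard_def]
  exact ENat.toNat_le_toNat (Q.eRk_le_encard X) (by simpa using hX)

theorem rk_singleton_le (Q : Matroid β) (x : β) : Q.rk {x} ≤ 1 := by
  simpa using Q.rk_le_ncard (finite_singleton x)

theorem rk_insert_le (Q : Matroid β) [Q.RankFinite] (x : β) (X : Set β) :
    Q.rk (insert x X) ≤ Q.rk X + 1 := by
  have := Q.eRk_insert_le_add_one x X
  simp only [← coe_rk] at this
  exact_mod_cast this

theorem rk_insert_of_notMem_closure [Q.RankFinite] (hx : x ∈ Q.E) (h : x ∉ Q.closure X) :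
    Q.rk (insert x X) = Q.rk X + 1 := by
  have := eRk_insert_eq_add_one (M := Q) (e := x) ⟨hx, h⟩
  simp only [← coe_rk] at this
  exact_mod_cast this

theorem mem_closure_of_rk_insert_le [Q.RankFinite] (hx : x ∈ Q.E)
    (h : Q.rk (insert x X) ≤ Q.rk X) : x ∈ Q.closure X := by
  by_contra hcon
  have := rk_insert_of_notMem_closure hx hcon
  omega

theorem rk_le_of_inter_ground_subset_closure [Q.RankFinite] (h : X ∩ Q.E ⊆ Q.closure Y) :
    Q.rk X ≤ Q.rk Y := by
  have h1 := Q.rk_mono h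
  rw [rk_closure] at h1
  have h2 : Q.rk (X ∩ Q.E) = Q.rk X := by rw [rk, eRk_inter_ground, rk]
  omega

theorem rk_le_of_subset_closure [Q.RankFinite] (h : X ⊆ Q.closure Y) : Q.rk X ≤ Q.rk Y :=
  rk_le_of_inter_ground_subset_closure (inter_subset_left.trans h)

theorem rk_insert_of_mem_closure [Q.RankFinite] (h : x ∈ Q.closure X) :
    Q.rk (insert x X) = Q.rk X := by
  rw [← rk_closure, closure_insert_eq_of_mem_closure h, rk_closure]

theorem rk_congr_closure (h : Q.closure X = Q.closure Y) : Q.rk X = Q.rk Y := by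
  rw [← rk_closure, h, rk_closure]

theorem Indep.rk_eq_ncard (hI : Q.Indep I) : Q.rk I = I.ncard := by
  rw [rk, hI.eRk_eq_encard, ncard_def]

theorem indep_of_ncard_le_rk [Q.RankFinite] (hI : I.Finite) (h : I.ncard ≤ Q.rk I) :
    Q.Indep I := by
  rw [indep_iff_eRk_eq_encard_of_finite hI, ← coe_rk, ← hI.cast_ncard_eq]
  exact_mod_cast le_antisymm (Q.rk_le_ncard hI) h

theorem subset_closure_of_rk_le [Q.RankFinite] (hXY : X ⊆ Y) (hY : Y ⊆ Q.E)
    (h : Q.rk Y ≤ Q.rk X) : Y ⊆ Q.closure X := fun _ hy ↦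
  mem_closure_of_rk_insert_le (hY hy) ((Q.rk_mono (insert_subset hy hXY)).trans h)

/-- Exchange for closures. -/
theorem mem_closure_insert_swap (h : x ∈ Q.closure (insert y X)) (hx : x ∉ Q.closure X) :
    y ∈ Q.closure (insert x X) :=
  (Q.closure_exchange ⟨h, hx⟩).1

theorem mem_closure_pair_swap (h : x ∈ Q.closure {b, c}) (hx : x ∉ Q.closure {c}) :
    b ∈ Q.closure {x, c} :=
  mem_closure_insert_swap h hx

/-- Sets spanned by disjoint subsets of an independent set are skew. -/
theorem rk_add_rk_le_of_subset_closure [Q.RankFinite] (hB : Q.Indep B) (hT : T ⊆ B) (hU : U ⊆ B)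
    (hTU : Disjoint T U) (hX : X ⊆ Q.closure T) (hY : Y ⊆ Q.closure U) :
    Q.rk X + Q.rk Y ≤ Q.rk (X ∪ Y) := by
  -- The first inequality replaces `X` by `T` next to `Y`, the second replaces `Y` by `U` next to
  -- `T`. Modularity holds exactly for the disjoint independent sets `T` and `U`.
  have h1 := Q.rk_submod (X ∪ Y) (X ∪ T)
  have h2 := Q.rk_submod (T ∪ Y) (Y ∪ U)
  have h3 : Q.rk (X ∪ T) ≤ Q.rk T :=
    rk_le_of_subset_closure (union_subset hX (Q.subset_closure T (hT.trans hB.subset_ground)))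
  have h4 : Q.rk (Y ∪ U) ≤ Q.rk U :=
    rk_le_of_subset_closure (union_subset hY (Q.subset_closure U (hU.trans hB.subset_ground)))
  have h5 : Q.rk (T ∪ U) = Q.rk T + Q.rk U := by
    have hfT := (hB.subset hT).finite
    have hfU := (hB.subset hU).finite
    rw [(hB.subset hT).rk_eq_ncard, (hB.subset hU).rk_eq_ncard,
      (hB.subset (union_subset hT hU)).rk_eq_ncard, ncard_union_eq hTU hfT hfU]
  have h6 : Q.rk X ≤ Q.rk ((X ∪ Y) ∩ (X ∪ T)) := Q.rk_mono fun a ha ↦ ⟨.inl ha, .inl ha⟩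
  have h7 : Q.rk Y ≤ Q.rk ((T ∪ Y) ∩ (Y ∪ U)) := Q.rk_mono fun a ha ↦ ⟨.inr ha, .inl ha⟩
  have h8 : Q.rk (T ∪ U) ≤ Q.rk (T ∪ Y ∪ (Y ∪ U)) := Q.rk_mono (by grind)
  have h9 : Q.rk (T ∪ Y) ≤ Q.rk (X ∪ Y ∪ (X ∪ T)) := Q.rk_mono (by grind)
  omega

/-- Every element of `P` is spanned by at most two elements of `B`. -/
def PairSpanned (Q : Matroid β) (B P : Set β) : Prop :=
  ∀ x ∈ P, ∃ b ∈ B, ∃ c ∈ B, x ∈ Q.closure {b, c}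

theorem PairSpanned.mono (h : Q.PairSpanned B P) (hXP : X ⊆ P) : Q.PairSpanned B X :=
  fun x hx ↦ h x (hXP hx)

theorem PairSpanned.subset_closure (h : Q.PairSpanned B P) : P ⊆ Q.closure B := by
  intro x hx
  obtain ⟨b, hb, c, hc, hx⟩ := h x hx
  exact Q.closure_subset_closure (by grind) hx

/-- The elements of `B` which are parallel to `b` after contracting `P`. -/
def parallelClass (Q : Matroid β) (B P : Set β) (b : β) : Set β :=
  {c ∈ B | c ∈ Q.closure (insert b P) ∧ c ∉ Q.closure P}

/-- If `x` lay properly on a line through `c` in the class and `c'` outside it, exchange would put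
`c` in the closure of `insert c' P`. Then `c` and `c'` would be parallel modulo `P`, or `c` would be
a loop there. So `P` splits along each parallel class. -/
theorem PairSpanned.mem_closure_or (h : Q.PairSpanned B P)
    (hx : x ∈ P) : x ∈ Q.closure (Q.parallelClass B P b) ∨
      x ∈ Q.closure (B \ Q.parallelClass B P b) := by
  set W := Q.parallelClass B P b with hW
  have hPE : P ⊆ Q.E := h.subset_closure.trans (Q.closure_subset_ground _)
  have key : ∀ c ∈ W, ∀ c' ∈ B, c' ∉ W → x ∈ Q.closure {c, c'} → x ∈ Q.closure {c'} := by
    intro c hc c' hc' hc'W hxc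
    by_contra hxc'
    have h1 : c ∈ Q.closure {x, c'} := mem_closure_pair_swap hxc hxc'
    have h2 : c ∈ Q.closure (insert c' P) := Q.closure_subset_closure (by grind) h1
    by_cases hc'P : c' ∈ Q.closure P
    · rw [closure_insert_eq_of_mem_closure hc'P] at h2
      exact hc.2.2 h2
    · have h3 : c' ∈ Q.closure (insert c P) := mem_closure_insert_swap h2 hc.2.2
      have h4 : insert c P ⊆ Q.closure (insert b P) := insert_subset hc.2.1
        ((Q.subset_closure P hPE).trans (Q.closure_subset_closure (subset_insert _ _)))
      exact hc'W ⟨hc', Q.closure_subset_closure_of_subset_closure h4 h3, hc'P⟩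
  obtain ⟨c, hc, c', hc', hxc⟩ := h x hx
  by_cases h1 : c ∈ W <;> by_cases h2 : c' ∈ W
  · exact .inl (Q.closure_subset_closure (by grind) hxc)
  · exact .inr (Q.closure_subset_closure (by grind) (key c h1 c' hc' h2 hxc))
  · rw [pair_comm] at hxc
    exact .inr (Q.closure_subset_closure (by grind) (key c' h2 c hc h1 hxc))
  · exact .inr (Q.closure_subset_closure (by grind) hxc)

/-- `P` splits into a part spanned by the class of `b` and a part spanned by the rest of `B`, and
these two parts of `B` are skew. If `b` were spanned by `P` and the other classes, it would
therefore be spanned by the first part of `P` alone. -/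
theorem PairSpanned.notMem_closure_union [Q.RankFinite] (h : Q.PairSpanned B P) (hB : Q.Indep B)
    (hb : b ∈ B) (hbP : b ∉ Q.closure P) :
    b ∉ Q.closure (P ∪ (B \ Q.parallelClass B P b)) := by
  set W := Q.parallelClass B P b with hW
  have hPE : P ⊆ Q.E := h.subset_closure.trans (Q.closure_subset_ground _)
  have hbE : b ∈ Q.E := hB.subset_ground hb
  have hbW : b ∈ W := ⟨hb, Q.mem_closure_of_mem' (mem_insert _ _), hbP⟩
  intro hcl
  have hWB : W ⊆ B := fun c hc ↦ hc.1
  set PW := P ∩ Q.closure W with hPW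
  have hVE : B \ W ⊆ Q.E := sdiff_subset.trans hB.subset_ground
  have h1 : P ∪ (B \ W) ⊆ Q.closure (PW ∪ (B \ W)) := by
    refine union_subset (fun x hx ↦ ?_) (Q.subset_closure_of_subset' subset_union_right)
    rcases h.mem_closure_or hx (b := b) with hx' | hx'
    · exact Q.mem_closure_of_mem' (.inl ⟨hx, hx'⟩) (hPE hx)
    · exact Q.closure_subset_closure subset_union_right hx'
  have h2 : b ∈ Q.closure (PW ∪ (B \ W)) := Q.closure_subset_closure_of_subset_closure h1 hcl
  have h3 := rk_add_rk_le_of_subset_closure (X := insert b PW) (Y := B \ W) hB hWB sdiff_subset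
    disjoint_sdiff_right (insert_subset (Q.mem_closure_of_mem' hbW) inter_subset_right)
    (Q.subset_closure _)
  have h4 : Q.rk (insert b PW ∪ (B \ W)) = Q.rk (PW ∪ (B \ W)) := by
    rw [insert_union, rk_insert_of_mem_closure h2]
  have h5 := Q.rk_union_le PW (B \ W)
  exact hbP (Q.closure_subset_closure inter_subset_left
    (mem_closure_of_rk_insert_le (X := PW) hbE (by omega)))

end Rank

/-! ### Three collinear elements, each spanned by two frame elements -/

section Triangle

variable {β : Type*} {Q : Matroid β} {B : Set β} {f g h : β}

/-- Closures of subsets of an independent set intersect in the closure of the intersection. -/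
theorem Indep.mem_closure_singleton_of_notMem {S : Set β} {b c x : β} (hB : Q.Indep B)
    (hb : b ∈ B) (hc : c ∈ B) (hS : S ⊆ B) (hx : x ∈ Q.closure {b, c}) (hxS : x ∈ Q.closure S)
    (hbS : b ∉ S) : x ∈ Q.closure {c} := by
  have hI : Q.Indep ({b, c} ∪ S) := hB.subset (by grind)
  have : x ∈ Q.closure ({b, c} ∩ S) := by
    rw [hI.closure_inter_eq_inter_closure]
    exact ⟨hx, hxS⟩
  exact Q.closure_subset_closure (by grind) this

/-- If three elements, two of which are in the span of the others, are each spanned by two elements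
of the independent set `B`, then two of them lie on a common line spanned by `B`, or they form a
triangle. -/
theorem Indep.exists_line_or_triangle (hB : Q.Indep B) (hp : Q.PairSpanned B {f, g, h})
    (hf : f ∈ Q.closure {g, h}) (hg : g ∈ Q.closure {f, h}) :
    (∃ b ∈ B, ∃ c ∈ B, (f ∈ Q.closure {b, c} ∧ g ∈ Q.closure {b, c}) ∨
      (f ∈ Q.closure {b, c} ∧ h ∈ Q.closure {b, c}) ∨
      (g ∈ Q.closure {b, c} ∧ h ∈ Q.closure {b, c})) ∨
    ∃ a ∈ B, ∃ b ∈ B, ∃ c ∈ B, a ≠ b ∧ b ≠ c ∧ a ≠ c ∧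
      f ∈ Q.closure {b, c} ∧ g ∈ Q.closure {a, c} ∧ h ∈ Q.closure {a, b} := by
  by_contra hcon
  push Not at hcon
  obtain ⟨hl, ht⟩ := hcon
  have mono : ∀ {x : β} {S T : Set β}, S ⊆ T → x ∈ Q.closure S → x ∈ Q.closure T :=
    fun hST hx ↦ Q.closure_subset_closure hST hx
  have span : ∀ {x y z : β} {S T : Set β}, x ∈ Q.closure {y, z} → y ∈ Q.closure S →
      z ∈ Q.closure T → x ∈ Q.closure (S ∪ T) := fun hx hy hz ↦
    Q.closure_subset_closure_of_subset_closure
      (insert_subset (mono subset_union_left hy) (singleton_subset_iff.2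
        (mono subset_union_right hz))) hx
  -- Once the lines of `f` and `g` share `c` and those of `f` and `h` share `b`, the remaining ends
  -- `a` and `a'` must agree: otherwise `a` is missing from the other two lines, whose union spans
  -- `g`, and `g` collapses onto `c`.
  have fin : ∀ a ∈ B, ∀ a' ∈ B, ∀ b ∈ B, ∀ c ∈ B, f ∈ Q.closure {b, c} → g ∈ Q.closure {a, c} →
      h ∈ Q.closure {a', b} → False := by
    intro a ha a' ha' b hb c hc hfb hga hha
    have hgc : g ∉ Q.closure {c} := fun hgc ↦
      (hl b hb c hc).1 hfb (mono (by simp) hgc)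
    have hab : a ≠ b := fun hab ↦ (hl b hb c hc).1 hfb (hab ▸ hga)
    have hac : a ≠ c := fun hac ↦ hgc (by simpa [hac] using hga)
    have hbc : b ≠ c := fun hbc ↦
      (hl a ha c hc).1 (mono (by simp [hbc]) hfb) hga
    obtain rfl : a = a' := by
      by_contra haa
      exact hgc (hB.mem_closure_singleton_of_notMem ha hc (S := {b, c} ∪ {a', b})
        (by clear * - hb hc ha'; grind) hga (span hg hfb hha) (by clear * - haa hab hac; grind))
    exact ht a ha b hb c hc hab hbc hac hfb hga hha
  obtain ⟨b0, hb0, c0, hc0, h0⟩ := hp f (by simp)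
  obtain ⟨b1, hb1, c1, hc1, h1⟩ := hp g (by simp)
  obtain ⟨b2, hb2, c2, hc2, h2⟩ := hp h (by simp)
  have n1 : f ∉ Q.closure {b1, c1} := fun h ↦ (hl b1 hb1 c1 hc1).1 h h1
  have n2 : f ∉ Q.closure {b2, c2} := fun h ↦ (hl b2 hb2 c2 hc2).2.1 h h2
  have hsp : f ∈ Q.closure ({b1, c1} ∪ {b2, c2}) := span hf h1 h2
  have hsub : {b1, c1} ∪ {b2, c2} ⊆ B := by
    clear * - hb1 hc1 hb2 hc2; grind
  -- Both ends of a line carrying `f` occur among the ends of the lines of `g` and `h`. If one end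
  -- does not, `f` is spanned by the other end alone, and so lies on one of those two lines or is a
  -- loop; both are excluded.
  have hmem : ∀ b ∈ B, ∀ c ∈ B, f ∈ Q.closure {b, c} → b ∈ ({b1, c1} ∪ {b2, c2} : Set β) := by
    intro b hb c hc hfb
    by_contra hcon
    have h3 : f ∈ Q.closure {c} := hB.mem_closure_singleton_of_notMem hb hc hsub hfb hsp hcon
    by_cases hc1 : c ∈ ({b1, c1} : Set β)
    · exact n1 (mono (by simpa using hc1) h3)
    by_cases hc2 : c ∈ ({b2, c2} : Set β)
    · exact n2 (mono (by simpa using hc2) h3)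
    have h4 := hB.mem_closure_singleton_of_notMem hc hb hsub (b := c) (c := b)
      (pair_comm b c ▸ hfb) hsp (by
        simp only [mem_union, not_or]; exact ⟨hc1, hc2⟩)
    have h5 : f ∈ Q.closure ({b} ∩ {c}) := by
      rw [(hB.subset (by clear * - hb hc; grind)).closure_inter_eq_inter_closure]
      exact ⟨h4, h3⟩
    by_cases hbc : b = c
    · have h6 : f ∈ Q.closure ({c} ∩ ({b1, c1} ∪ {b2, c2})) := by
        rw [(hB.subset (union_subset (singleton_subset_iff.2 hc)
          hsub)).closure_inter_eq_inter_closure]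
        exact ⟨h3, hsp⟩
      refine n1 (mono ?_ h6)
      rintro x ⟨rfl, hx⟩
      exact (hx.elim hc1 hc2).elim
    · refine n1 (mono ?_ h5)
      rintro x ⟨rfl, rfl⟩
      exact (hbc rfl).elim
  -- The two ends of the line of `f` cannot both belong to the line of `g`, nor both to that of `h`.
  -- So each of those lines receives one end, which is the configuration settled by `fin`.
  have hm0 := hmem b0 hb0 c0 hc0 h0
  have hm1 := hmem c0 hc0 b0 hb0 (pair_comm b0 c0 ▸ h0)
  have no1 : ¬ (b0 ∈ ({b1, c1} : Set β) ∧ c0 ∈ ({b1, c1} : Set β)) := fun hh ↦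
    n1 (mono (pair_subset hh.1 hh.2) h0)
  have no2 : ¬ (b0 ∈ ({b2, c2} : Set β) ∧ c0 ∈ ({b2, c2} : Set β)) := fun hh ↦
    n2 (mono (pair_subset hh.1 hh.2) h0)
  have cross : ∀ b ∈ B, ∀ c ∈ B, f ∈ Q.closure {b, c} → c ∈ ({b1, c1} : Set β) →
      b ∈ ({b2, c2} : Set β) → False := by
    intro b hb c hc hfb hcm hbm
    have e1 : ∃ a ∈ B, ({b1, c1} : Set β) = {a, c} := by
      rcases hcm with rfl | rfl
      · exact ⟨c1, hc1, pair_comm _ _⟩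
      · exact ⟨b1, hb1, rfl⟩
    have e2 : ∃ a ∈ B, ({b2, c2} : Set β) = {a, b} := by
      rcases hbm with rfl | rfl
      · exact ⟨c2, hc2, pair_comm _ _⟩
      · exact ⟨b2, hb2, rfl⟩
    obtain ⟨a, ha, e1⟩ := e1
    obtain ⟨a', ha', e2⟩ := e2
    exact fin a ha a' ha' b hb c hc hfb (e1 ▸ h1) (e2 ▸ h2)
  rcases hm0 with hm0 | hm0 <;> rcases hm1 with hm1 | hm1
  · exact no1 ⟨hm0, hm1⟩
  · exact cross c0 hc0 b0 hb0 (pair_comm b0 c0 ▸ h0) hm0 hm1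
  · exact cross b0 hb0 c0 hc0 h0 hm1 hm0
  · exact no2 ⟨hm0, hm1⟩

end Triangle

/-- A version of Tutte's linking theorem for two sets `X` and `Y` that need not be disjoint. -/
theorem exists_linking {β : Type*} (Q : Matroid β) [Q.RankFinite] (X Y : Set β) (k : ℕ)
    {E : Set β} (hE : E.Finite) : ∀ C : Set β,
    (∀ A ⊆ E, Q.rk (X ∪ Y ∪ E ∪ C) + Q.rk C + k ≤ Q.rk (X ∪ A ∪ C) + Q.rk (Y ∪ E \ A ∪ C)) →
    ∃ P ⊆ E, Q.rk (P ∪ C) + Q.rk (P ∪ X ∪ Y ∪ C) + k ≤ Q.rk (P ∪ X ∪ C) + Q.rk (P ∪ Y ∪ C) := by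
  induction E, hE using Set.Finite.induction_on with
  | empty =>
    intro C h
    refine ⟨∅, subset_rfl, ?_⟩
    have := h ∅ subset_rfl
    simp only [union_empty, empty_union, sdiff_empty] at this ⊢
    omega
  | @insert g E hg hE ih =>
    intro C h
    by_contra hcon
    push Not at hcon
    -- If no `P` works, then both options for `g` fail: deleting it (dropping it from `E`) and
    -- contracting it (moving it into `C`). Each failure supplies a set violating the cut condition.
    have h1 : ∃ A ⊆ E, Q.rk (X ∪ A ∪ C) + Q.rk (Y ∪ E \ A ∪ C) <
        Q.rk (X ∪ Y ∪ E ∪ C) + Q.rk C + k := by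
      by_contra! hA
      obtain ⟨P, hP, hP'⟩ := ih C hA
      have := hcon P (hP.trans (subset_insert _ _))
      omega
    have h2 : ∃ A ⊆ E, Q.rk (X ∪ A ∪ insert g C) + Q.rk (Y ∪ E \ A ∪ insert g C) <
        Q.rk (X ∪ Y ∪ E ∪ insert g C) + Q.rk (insert g C) + k := by
      by_contra! hA
      obtain ⟨P, hP, hP'⟩ := ih (insert g C) hA
      have := hcon (insert g P) (insert_subset_insert hP)
      have e : ∀ Z, P ∪ Z ∪ insert g C = insert g P ∪ Z ∪ C := fun Z ↦ by clear * -; grind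
      have e' : P ∪ insert g C = insert g P ∪ C := by clear * -; grind
      rw [e X, e Y, union_assoc P, e (X ∪ Y), e', ← union_assoc] at hP'
      omega
    obtain ⟨A₁, hA₁, h1⟩ := h1
    obtain ⟨A₂, hA₂, h2⟩ := h2
    have h3 := h (insert g (A₁ ∪ A₂)) (insert_subset_insert (union_subset hA₁ hA₂))
    have h4 := h (A₁ ∩ A₂) (inter_subset_left.trans (hA₁.trans (subset_insert _ _)))
    -- Uncrossing `A₁` and `A₂`. The cut condition for their intersection and for their union with
    -- `g` contradicts the two failures: two strict inequalities gain 2, while `rk_insert_le` loses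
    -- at most 1.
    have s1 := Q.rk_submod (X ∪ A₁ ∪ C) (X ∪ A₂ ∪ insert g C)
    have s2 := Q.rk_submod (Y ∪ E \ A₁ ∪ C) (Y ∪ E \ A₂ ∪ insert g C)
    have m1 := Q.rk_mono (show X ∪ A₁ ∩ A₂ ∪ C ⊆ (X ∪ A₁ ∪ C) ∩ (X ∪ A₂ ∪ insert g C) by
      clear * -; grind)
    have m2 := Q.rk_mono (show X ∪ insert g (A₁ ∪ A₂) ∪ C ⊆
      (X ∪ A₁ ∪ C) ∪ (X ∪ A₂ ∪ insert g C) by clear * -; grind)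
    have m3 := Q.rk_mono (show Y ∪ insert g E \ insert g (A₁ ∪ A₂) ∪ C ⊆
      (Y ∪ E \ A₁ ∪ C) ∩ (Y ∪ E \ A₂ ∪ insert g C) by clear * -; grind)
    have m4 := Q.rk_mono (show Y ∪ insert g E \ (A₁ ∩ A₂) ∪ C ⊆
      (Y ∪ E \ A₁ ∪ C) ∪ (Y ∪ E \ A₂ ∪ insert g C) by clear * -; grind)
    have m5 := Q.rk_mono (show X ∪ Y ∪ E ∪ C ⊆ X ∪ Y ∪ insert g E ∪ C by clear * -; grind)
    have m6 : X ∪ Y ∪ E ∪ insert g C = X ∪ Y ∪ insert g E ∪ C := by clear * -; grind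
    have m7 := Q.rk_insert_le g C
    rw [m6] at h2
    omega

/-! ### Triangles and sets of corank one or two relative to a frame -/

section Frame

variable {β : Type*} {Q : Matroid β} {B R P : Set β} {a f g h : β}

theorem closure_pair_subset_of_rk_eq_two [Q.RankFinite] {b c : β} (hb : b ∈ Q.E) (hc : c ∈ Q.E)
    (hf : f ∈ Q.closure {b, c}) (hg : g ∈ Q.closure {b, c}) (hfg : Q.rk {f, g} = 2) :
    Q.closure {b, c} ⊆ Q.closure {f, g} := by
  have hfE := mem_ground_of_mem_closure hf
  have hgE := mem_ground_of_mem_closure hg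
  have h1 : {b, c} ∪ {f, g} ⊆ Q.E := union_subset (pair_subset hb hc) (pair_subset hfE hgE)
  have h2 : Q.rk ({b, c} ∪ {f, g}) ≤ Q.rk {f, g} := by
    have h3 : Q.rk ({b, c} ∪ {f, g}) ≤ Q.rk {b, c} := rk_le_of_subset_closure
      (union_subset (Q.subset_closure _ (pair_subset hb hc)) (pair_subset hf hg))
    have h4 := Q.rk_le_ncard (toFinite {b, c})
    have h5 := ncard_insert_le b {c}
    rw [ncard_singleton] at h5
    omega
  exact Q.closure_subset_closure_of_subset_closure
    (subset_union_left.trans (subset_closure_of_rk_le subset_union_right h1 h2))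

/-- Three elements that form a circuit. -/
structure IsTriangle (Q : Matroid β) (f g h : β) : Prop where
  fst_mem : f ∈ Q.E
  snd_mem : g ∈ Q.E
  thd_mem : h ∈ Q.E
  rk_fst_snd : Q.rk {f, g} = 2
  rk_fst_thd : Q.rk {f, h} = 2
  rk_snd_thd : Q.rk {g, h} = 2
  rk_eq : Q.rk {f, g, h} = 2

theorem IsTriangle.rotate (hT : Q.IsTriangle f g h) : Q.IsTriangle g h f where
  fst_mem := hT.snd_mem
  snd_mem := hT.thd_mem
  thd_mem := hT.fst_mem
  rk_fst_snd := hT.rk_snd_thd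
  rk_fst_thd := by rw [pair_comm]; exact hT.rk_fst_snd
  rk_snd_thd := by rw [pair_comm]; exact hT.rk_fst_thd
  rk_eq := by rw [← hT.rk_eq, insert_comm f, pair_comm f]

theorem IsTriangle.swap (hT : Q.IsTriangle f g h) : Q.IsTriangle g f h where
  fst_mem := hT.snd_mem
  snd_mem := hT.fst_mem
  thd_mem := hT.thd_mem
  rk_fst_snd := by rw [pair_comm]; exact hT.rk_fst_snd
  rk_fst_thd := hT.rk_snd_thd
  rk_snd_thd := hT.rk_fst_thd
  rk_eq := by rw [← hT.rk_eq, insert_comm f]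

theorem IsTriangle.mem_closure [Q.RankFinite] (hT : Q.IsTriangle f g h) :
    f ∈ Q.closure {g, h} :=
  mem_closure_of_rk_insert_le hT.fst_mem (by rw [hT.rk_eq, hT.rk_snd_thd])

theorem IsTriangle.subset_closure [Q.RankFinite] (hT : Q.IsTriangle f g h) :
    {f, g, h} ⊆ Q.closure {f, g} := by
  rintro x (rfl | rfl | rfl)
  · exact Q.mem_closure_of_mem' (by simp) hT.fst_mem
  · exact Q.mem_closure_of_mem' (by simp) hT.snd_mem
  · exact hT.rotate.rotate.mem_closure

/-- For a genuine triangle, any two of its elements span the line, so the collinear case improves: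
the frame line and the triangle span each other. -/
theorem Indep.exists_line_or_triangle_of_isTriangle [Q.RankFinite] (hB : Q.Indep B)
    (hp : Q.PairSpanned B {f, g, h}) (hT : Q.IsTriangle f g h) :
    (∃ b ∈ B, ∃ c ∈ B, b ≠ c ∧ {f, g, h} ⊆ Q.closure {b, c} ∧ {b, c} ⊆ Q.closure {f, g, h}) ∨
    ∃ a ∈ B, ∃ b ∈ B, ∃ c ∈ B, a ≠ b ∧ b ≠ c ∧ a ≠ c ∧
      f ∈ Q.closure {b, c} ∧ g ∈ Q.closure {a, c} ∧ h ∈ Q.closure {a, b} := by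
  have key : ∀ f g h, Q.IsTriangle f g h → ∀ b ∈ B, ∀ c ∈ B, f ∈ Q.closure {b, c} →
      g ∈ Q.closure {b, c} → b ≠ c ∧ {f, g, h} ⊆ Q.closure {b, c} ∧
        {b, c} ⊆ Q.closure {f, g, h} := by
    intro f g h hT b hb c hc hf hg
    have h1 := closure_pair_subset_of_rk_eq_two (hB.subset_ground hb) (hB.subset_ground hc) hf hg
      hT.rk_fst_snd
    refine ⟨?_, hT.subset_closure.trans (closure_subset_closure_of_subset_closure
      (pair_subset hf hg)), ?_⟩
    · rintro rfl
      have h2 : Q.rk {f, g} ≤ Q.rk {b} := rk_le_of_subset_closure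
        (by rw [pair_eq_singleton] at hf hg; exact pair_subset hf hg)
      have h3 := Q.rk_singleton_le b
      have h4 := hT.rk_fst_snd
      omega
    · exact (Q.subset_closure _ (pair_subset (hB.subset_ground hb) (hB.subset_ground hc))).trans
        (h1.trans (Q.closure_subset_closure (by
          rw [insert_comm f, insert_comm, pair_comm]
          simp only [insert_subset_iff, mem_insert_iff, true_or, or_true,
            singleton_subset_iff, mem_singleton_iff, and_self])))
  have e1 : ({g, h, f} : Set β) = {f, g, h} := by rw [insert_comm f, pair_comm f]
  have e2 : ({h, f, g} : Set β) = {f, g, h} := by rw [insert_comm h, pair_comm h]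
  rcases hB.exists_line_or_triangle hp hT.mem_closure
    hT.swap.mem_closure with
    ⟨b, hb, c, hc, ⟨h1, h2⟩ | ⟨h1, h2⟩ | ⟨h1, h2⟩⟩ | h1
  · exact .inl ⟨b, hb, c, hc, key f g h hT b hb c hc h1 h2⟩
  · have := key h f g hT.rotate.rotate b hb c hc h2 h1
    rw [e2] at this
    exact .inl ⟨b, hb, c, hc, this⟩
  · have := key g h f hT.rotate b hb c hc h1 h2
    rw [e1] at this
    exact .inl ⟨b, hb, c, hc, this⟩
  · exact .inr h1

/-- Every frame line carrying one of the three elements must pass through `a`, since otherwise that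
element lies in the span of `B \ {a}`. The three sides of a triangle have no common vertex, which
leaves only the collinear case. -/
theorem PairSpanned.exists_line [Q.RankFinite] (hB : Q.Indep B)
    (hp : Q.PairSpanned B {f, g, h}) (hT : Q.IsTriangle f g h)
    (hF : ∀ x ∈ ({f, g, h} : Set β), x ∉ Q.closure (B \ {a})) :
    ∃ x ∈ B, x ≠ a ∧ {f, g, h} ⊆ Q.closure {a, x} ∧ {a, x} ⊆ Q.closure {f, g, h} := by
  have hmem : ∀ x ∈ ({f, g, h} : Set β), ∀ b ∈ B, ∀ c ∈ B, x ∈ Q.closure {b, c} →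
      a = b ∨ a = c := by
    intro x hx b hb c hc hxbc
    by_contra! hcon
    refine hF x hx (Q.closure_subset_closure ?_ hxbc)
    exact pair_subset ⟨hb, fun h ↦ hcon.1 h.symm⟩ ⟨hc, fun h ↦ hcon.2 h.symm⟩
  rcases hB.exists_line_or_triangle_of_isTriangle hp hT with ⟨b, hb, c, hc, hbc, h1, h2⟩ |
    ⟨d, hd, b, hb, c, hc, hdb, hbc, hdc, h1, h2, h3⟩
  · rcases hmem f (by simp) b hb c hc (h1 (by simp)) with rfl | rfl
    · exact ⟨c, hc, hbc.symm, h1, h2⟩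
    · rw [pair_comm b] at h1 h2
      exact ⟨b, hb, hbc, h1, h2⟩
  · have h4 := hmem f (by simp) b hb c hc h1
    have h5 := hmem g (by simp) d hd c hc h2
    have h6 := hmem h (by simp) d hd b hb h3
    clear * - h4 h5 h6 hdb hbc hdc
    grind

/-- Three elements of distinct parallel classes modulo `P` are independent there, because no class
is spanned by `P` and the others. Hence `P` has corank at least three. -/
theorem PairSpanned.rk_add_three_le [Q.RankFinite] (hB : Q.Indep B) (hP : Q.PairSpanned B P)
    {b₁ b₂ b₃ : β} (h₁ : b₁ ∈ B) (h₂ : b₂ ∈ B) (h₃ : b₃ ∈ B) (h₁P : b₁ ∉ Q.closure P)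
    (h₂P : b₂ ∉ Q.closure P) (h₃P : b₃ ∉ Q.closure P) (h₁₂ : b₂ ∉ Q.closure (insert b₁ P))
    (h₁₃ : b₃ ∉ Q.closure (insert b₁ P)) (h₂₃ : b₃ ∉ Q.closure (insert b₂ P)) :
    Q.rk P + 3 ≤ B.ncard := by
  have hE := hB.subset_ground
  have e1 : b₁ ∉ Q.closure (insert b₂ (insert b₃ P)) := fun hcl ↦
    hP.notMem_closure_union hB h₁ h₁P (Q.closure_subset_closure (by
      rintro x (rfl | rfl | hx)
      · exact .inr ⟨h₂, fun h ↦ h₁₂ h.2.1⟩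
      · exact .inr ⟨h₃, fun h ↦ h₁₃ h.2.1⟩
      · exact .inl hx) hcl)
  have e2 : b₂ ∉ Q.closure (insert b₃ P) := fun hcl ↦
    h₂₃ (mem_closure_insert_swap hcl h₂P)
  have r1 := rk_insert_of_notMem_closure (hE h₁) e1
  have r2 := rk_insert_of_notMem_closure (hE h₂) e2
  have r3 := rk_insert_of_notMem_closure (hE h₃) h₃P
  have hBcl := Q.subset_closure B hE
  have r4 : Q.rk (insert b₁ (insert b₂ (insert b₃ P))) ≤ Q.rk B := rk_le_of_subset_closure
    (insert_subset (hBcl h₁) (insert_subset (hBcl h₂) (insert_subset (hBcl h₃) hP.subset_closure)))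
  rw [hB.rk_eq_ncard] at r4
  omega

/-- If `R` has corank one, then it splits along the basis elements that it spans. -/
theorem PairSpanned.mem_closure_inter_or_sdiff [Q.RankFinite] (hB : Q.Indep B)
    (hR : Q.PairSpanned B R) (hr : B.ncard = Q.rk R + 1) :
    (B \ Q.closure R).Nonempty ∧
      ∀ x ∈ R, x ∈ Q.closure (B ∩ Q.closure R) ∨ x ∈ Q.closure (B \ Q.closure R) := by
  have hE := hB.subset_ground
  have hne : (B \ Q.closure R).Nonempty := by
    by_contra hcon
    rw [not_nonempty_iff_eq_empty, sdiff_eq_empty] at hcon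
    have := rk_le_of_subset_closure hcon
    rw [hB.rk_eq_ncard] at this
    omega
  refine ⟨hne, ?_⟩
  obtain ⟨b, hb, hbR⟩ := hne
  -- In corank one, any two elements of `B` outside the closure of `R` are parallel modulo `R`, so
  -- there is a single class along which to split.
  have hW : Q.parallelClass B R b = B \ Q.closure R := by
    refine subset_antisymm (fun c hc ↦ ⟨hc.1, hc.2.2⟩) fun c hc ↦ ?_
    refine ⟨hc.1, ?_, hc.2⟩
    by_contra hcb
    have r1 := rk_insert_of_notMem_closure (hE hc.1) hcb
    have r2 := rk_insert_of_notMem_closure (hE hb) hbR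
    have hBcl := Q.subset_closure B hE
    have r3 : Q.rk (insert c (insert b R)) ≤ Q.rk B := rk_le_of_subset_closure
      (insert_subset (hBcl hc.1) (insert_subset (hBcl hb) hR.subset_closure))
    rw [hB.rk_eq_ncard] at r3
    omega
  intro x hx
  have := hR.mem_closure_or hx (b := b)
  rw [hW, sdiff_sdiff_right_self] at this
  exact this.symm

/-- If `R` lies on the side `B ∩ Q.closure R`, then that side has `|B| - 1` elements by rank, so it
misses exactly one. If `R` lies on the other side, no element of `B` can be spanned by `R`, since it
would be spanned by elements of `B` other than itself. -/
theorem PairSpanned.disjoint_or_exists_singleton [Q.RankFinite] (hB : Q.Indep B)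
    (hR : Q.PairSpanned B R) (hr : B.ncard = Q.rk R + 1)
    (hconn : (∀ x ∈ R, x ∈ Q.closure (B ∩ Q.closure R)) ∨
      ∀ x ∈ R, x ∈ Q.closure (B \ Q.closure R)) :
    (∀ b ∈ B, b ∉ Q.closure R) ∨ ∃ a ∈ B, R ⊆ Q.closure (B \ {a}) ∧ B \ {a} ⊆ Q.closure R := by
  rcases hconn with h1 | h1
  · right
    obtain ⟨a, ha⟩ := (hR.mem_closure_inter_or_sdiff hB hr).1
    have h2 : Q.rk R ≤ Q.rk (B ∩ Q.closure R) := rk_le_of_subset_closure h1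
    rw [(hB.subset inter_subset_left).rk_eq_ncard] at h2
    have h3 : B ∩ Q.closure R ⊆ B \ {a} := fun x hx ↦ ⟨hx.1, fun h ↦ ha.2 (h ▸ hx.2)⟩
    have h4 := ncard_sdiff_singleton_add_one ha.1 hB.finite
    have h5 : B ∩ Q.closure R = B \ {a} :=
      eq_of_subset_of_ncard_le h3 (by omega) hB.finite.sdiff
    exact ⟨a, ha.1, h5 ▸ h1, h5 ▸ inter_subset_right⟩
  · left
    intro b hb hbR
    have h2 : b ∈ Q.closure (B \ Q.closure R) :=
      closure_subset_closure_of_subset_closure h1 hbR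
    have h3 := hB.closure_inter_eq_self_of_subset (J := B \ Q.closure R) sdiff_subset
    exact (h3.subset ⟨h2, hb⟩).2 hbR

/-- A triangle spanned by `R`, whose removal from `R` decreases the rank by one, cannot exist if
`R` spans no element of `B`. -/
theorem PairSpanned.false_of_isTriangle [Q.RankFinite] (hB : Q.Indep B) (hR : Q.PairSpanned B R)
    (hBR : ∀ b ∈ B, b ∉ Q.closure R) (hT : Q.IsTriangle f g h) (hF : {f, g, h} ⊆ R)
    (hPR : P ⊆ R) (hP : B.ncard ≤ Q.rk P + 2)
    (hFP : ∀ x ∈ ({f, g, h} : Set β), x ∉ Q.closure P) : False := by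
  have hRE : R ⊆ Q.E := hR.subset_closure.trans (Q.closure_subset_ground _)
  have hRcl := Q.subset_closure R hRE
  rcases hB.exists_line_or_triangle_of_isTriangle (hR.mono hF) hT with
    ⟨b, hb, c, hc, -, -, h2⟩ | ⟨a, ha, b, hb, c, hc, hab, hbc, hac, h1, h2, h3⟩
  · exact hBR b hb (Q.closure_subset_closure hF (h2 (by simp)))
  -- If the two ends of a side were parallel modulo `P`, the element on that side would be parallel
  -- to them too, and `R` would span a frame element. So the three vertices lie in distinct classes
  -- modulo `P`, which contradicts corank at most two.
  · have key : ∀ x ∈ ({f, g, h} : Set β), ∀ b ∈ B, ∀ c ∈ B, x ∈ Q.closure {b, c} →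
        c ∉ Q.closure (insert b P) := by
      intro x hx b hb c hc hxbc hcb
      have e1 : x ∈ Q.closure (insert b P) := closure_subset_closure_of_subset_closure
        (pair_subset (Q.mem_closure_of_mem' (mem_insert _ _) (hB.subset_ground hb)) hcb) hxbc
      have e2 := mem_closure_insert_swap e1 (hFP x hx)
      exact hBR b hb (Q.closure_subset_closure (insert_subset (hF hx) hPR) e2)
    have hBP : ∀ b ∈ B, b ∉ Q.closure P := fun b hb hbP ↦
      hBR b hb (Q.closure_subset_closure hPR hbP)
    have := (hR.mono hPR).rk_add_three_le hB ha hb hc (hBP a ha) (hBP b hb) (hBP c hc)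
      (key h (by simp) a ha b hb h3) (key g (by simp) a ha c hc h2) (key f (by simp) b hb c hc h1)
    omega

end Frame

/-! ### Ranks and triangles in the 2-sum with copies of `U_{2,4}` -/

section U24

variable {α : Type u} {N : Matroid α} {L Z : Set α} {l : α}

/-- The element of `N` to which an element of `u24Sum N L` belongs. -/
def u24Proj : α ⊕ α × Fin 3 → α := Sum.elim id Prod.fst

/-- The elements of `u24Sum N L` that replace the elements of `Z`. -/
def u24Lift (N : Matroid α) (L Z : Set α) : Set (α ⊕ α × Fin 3) :=
  {p ∈ u24Ground N L | u24Proj p ∈ Z}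

theorem inl_mem_u24Lift {a : α} : Sum.inl a ∈ u24Lift N L Z ↔ (a ∈ N.E ∧ a ∉ L) ∧ a ∈ Z := by
  rw [u24Lift, mem_sep_iff, inl_mem_u24Ground]
  rfl

theorem inr_mem_u24Lift {i : Fin 3} : Sum.inr (l, i) ∈ u24Lift N L Z ↔ l ∈ L ∧ l ∈ Z := by
  rw [u24Lift, mem_sep_iff, inr_mem_u24Ground]
  rfl

theorem u24Lift_subset : u24Lift N L Z ⊆ (u24Sum N L).E := fun _ h ↦ h.1

theorem u24Lift_mono {Z' : Set α} (h : Z ⊆ Z') : u24Lift N L Z ⊆ u24Lift N L Z' :=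
  fun _ hp ↦ ⟨hp.1, h hp.2⟩

theorem u24Lift_ground (hL : L ⊆ N.E) : u24Lift N L N.E = (u24Sum N L).E := by
  refine subset_antisymm u24Lift_subset ?_
  rintro (a | ⟨l, i⟩) h
  · have h1 := inl_mem_u24Ground.1 h
    exact ⟨h, h1.1⟩
  · exact ⟨h, hL (inr_mem_u24Ground.1 h)⟩

theorem u24Sum_finite (hN : N.Finite) (hL : L ⊆ N.E) : (u24Sum N L).Finite := by
  have hE := hN.ground_finite
  refine ⟨?_⟩
  rw [u24Sum_ground, u24Ground]
  exact (hE.sdiff.image _).union (((hE.subset hL).prod finite_univ).image _)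

/-- A single element of a copy never spans the basepoint, so it may be added to any independent set
that avoids the copy. -/
theorem inr_notMem_closure_u24Sum {X : Set (α ⊕ α × Fin 3)} {i : Fin 3} (hl : l ∈ L)
    (hX : ∀ j, Sum.inr (l, j) ∉ X) : Sum.inr (l, i) ∉ (u24Sum N L).closure X := by
  obtain ⟨J, hJ⟩ := (u24Sum N L).exists_isBasis' X
  have hf : u24Fiber J l = ∅ := eq_empty_of_forall_notMem fun j hj ↦ hX j (hJ.subset hj)
  have hs : ¬ (insert i (u24Fiber J l)).Nontrivial := by
    rw [hf]
    simp
  have hI : (u24Sum N L).Indep (insert (Sum.inr (l, i)) J) :=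
    u24Indep.insert_inr hJ.indep hl (u24_insert_ne_univ (by rw [hf]; simp) i)
      fun h ↦ (hs h).elim
  rw [← hJ.closure_eq_closure, hJ.indep.mem_closure_iff']
  exact fun h ↦ hX i (hJ.subset (h.2 hI))

/-- Each attached copy raises the rank by one: one element of every copy over `Z` is free, and a
second one acts as the basepoint in `N`. -/
theorem rk_u24Lift (hN : N.Finite) (hL : L ⊆ N.E) (hZ : Z ⊆ N.E) :
    (u24Sum N L).rk (u24Lift N L Z) = N.rk Z + (Z ∩ L).ncard := by
  classical
  have := u24Sum_finite hN hL
  obtain ⟨I, hI⟩ := N.exists_isBasis Z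
  have hZfin : Z.Finite := hN.ground_finite.subset hZ
  -- A basis of the lift: `(a, 0)` for all `a ∈ Z ∩ L`, and for each `a` in a basis `I` of `Z`
  -- either `a` itself or, over `L`, the second element `(a, 1)`. The trace of this set is `I`.
  set s : α → α ⊕ α × Fin 3 := fun a ↦ if a ∈ L then Sum.inr (a, 1) else Sum.inl a with hs
  set t : α → α ⊕ α × Fin 3 := fun a ↦ Sum.inr (a, 0) with ht
  have hps : ∀ a, u24Proj (s a) = a := fun a ↦ by
    by_cases h : a ∈ L <;> simp [hs, h, u24Proj]
  set J := t '' (Z ∩ L) ∪ s '' I with hJ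
  have hinl : ∀ a, Sum.inl a ∈ J ↔ a ∈ I ∧ a ∉ L := by
    intro a
    simp only [hJ, ht, hs, mem_union, mem_image, reduceCtorEq, and_false, exists_false, false_or]
    constructor
    · rintro ⟨b, hb, hba⟩
      by_cases h : b ∈ L
      · simp [h] at hba
      · simp only [h, if_false, Sum.inl.injEq] at hba
        exact hba ▸ ⟨hb, h⟩
    · rintro ⟨ha, haL⟩
      exact ⟨a, ha, by simp [haL]⟩
  have h0 : ∀ a, Sum.inr (a, 0) ∈ J ↔ a ∈ Z ∧ a ∈ L := by
    intro a
    simp only [hJ, ht, hs, mem_union, mem_image, Sum.inr.injEq, Prod.mk.injEq, and_true,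
      exists_eq_right, mem_inter_iff]
    refine or_iff_left ?_
    rintro ⟨b, hb, hba⟩
    by_cases h : b ∈ L <;> simp [h] at hba
  have h1 : ∀ a, Sum.inr (a, 1) ∈ J ↔ a ∈ I ∧ a ∈ L := by
    intro a
    simp only [hJ, ht, hs, mem_union, mem_image, Sum.inr.injEq, Prod.mk.injEq]
    constructor
    · rintro (⟨b, -, -, h⟩ | ⟨b, hb, hba⟩)
      · simp at h
      · by_cases h : b ∈ L
        · simp only [h, if_true, Sum.inr.injEq, Prod.mk.injEq, and_true] at hba
          exact hba ▸ ⟨hb, h⟩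
        · simp [h] at hba
    · rintro ⟨ha, haL⟩
      exact .inr ⟨a, ha, by simp [haL]⟩
  have h2 : ∀ a, Sum.inr (a, 2) ∉ J := by
    rintro a (⟨b, -, h⟩ | ⟨b, -, hba⟩)
    · simp [ht] at h
    · by_cases h : b ∈ L <;> simp [hs, h] at hba
  have hJZ : J ⊆ u24Lift N L Z := by
    rintro (a | ⟨l, i⟩) hp
    · have := (hinl a).1 hp
      exact inl_mem_u24Lift.2 ⟨⟨hZ (hI.subset this.1), this.2⟩, hI.subset this.1⟩
    · rw [inr_mem_u24Lift]
      obtain rfl | rfl | rfl : i = 0 ∨ i = 1 ∨ i = 2 := by omega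
      · exact ((h0 l).1 hp).symm
      · exact ⟨((h1 l).1 hp).2, hI.subset ((h1 l).1 hp).1⟩
      · exact (h2 l hp).elim
  have hJi : (u24Sum N L).Indep J := by
    refine ⟨fun p hp ↦ (hJZ hp).1, fun e he ↦ h2 e (show 2 ∈ u24Fiber J e by rw [he]; trivial), ?_⟩
    refine hI.indep.subset ?_
    rintro a (ha | ⟨i, hi, j, hj, hij⟩)
    · exact ((hinl a).1 ha).1
    · obtain rfl | rfl | rfl : i = 0 ∨ i = 1 ∨ i = 2 := by omega
      · obtain rfl | rfl | rfl : j = 0 ∨ j = 1 ∨ j = 2 := by omega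
        · exact (hij rfl).elim
        · exact ((h1 a).1 hj).1
        · exact (h2 a hj).elim
      · exact ((h1 a).1 hi).1
      · exact (h2 a hi).elim
  have hdep : ∀ {K : Set (α ⊕ α × Fin 3)} {a : α}, (u24Sum N L).Indep K → J ⊆ K →
      a ∈ u24Trace K → a ∈ Z → a ∈ I := by
    intro K a hK hJK ha haZ
    by_contra haI
    refine (hI.insert_dep ⟨haZ, haI⟩).not_indep (hK.2.2.subset (insert_subset ha fun b hb ↦ ?_))
    by_cases hbL : b ∈ L
    · exact .inr ⟨0, hJK ((h0 b).2 ⟨hI.subset hb, hbL⟩), 1, hJK ((h1 b).2 ⟨hb, hbL⟩), by simp⟩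
    · exact .inl (hJK ((hinl b).2 ⟨hb, hbL⟩))
  have hcl : u24Lift N L Z ⊆ (u24Sum N L).closure J := by
    intro p hp
    rw [hJi.mem_closure_iff']
    refine ⟨hp.1, fun hK ↦ ?_⟩
    have hsub := subset_insert p J
    obtain a | ⟨l, i⟩ := p
    · obtain ⟨⟨-, haL⟩, haZ⟩ := inl_mem_u24Lift.1 hp
      exact (hinl a).2 ⟨hdep hK hsub (.inl (mem_insert _ _)) haZ, haL⟩
    · obtain ⟨hlL, hlZ⟩ := inr_mem_u24Lift.1 hp
      have h0' : (0 : Fin 3) ∈ u24Fiber (insert (Sum.inr (l, i)) J) l :=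
        hsub ((h0 l).2 ⟨hlZ, hlL⟩)
      have hi' : i ∈ u24Fiber (insert (Sum.inr (l, i)) J) l := mem_insert _ _
      by_cases hi0 : i = 0
      · exact hi0 ▸ (h0 l).2 ⟨hlZ, hlL⟩
      have hlI : l ∈ I := hdep hK hsub (.inr ⟨0, h0', i, hi', fun h ↦ hi0 h.symm⟩) hlZ
      obtain rfl | rfl : i = 1 ∨ i = 2 := by omega
      · exact (h1 l).2 ⟨hlI, hlL⟩
      · refine (hK.2.1 l (eq_univ_of_forall fun j ↦ ?_)).elim
        obtain rfl | rfl | rfl : j = 0 ∨ j = 1 ∨ j = 2 := by omega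
        · exact h0'
        · exact hsub ((h1 l).2 ⟨hlI, hlL⟩)
        · exact hi'
  have hrk : (u24Sum N L).rk (u24Lift N L Z) = (u24Sum N L).rk J :=
    le_antisymm (rk_le_of_subset_closure hcl) (rk_mono _ hJZ)
  have hdisj : Disjoint (t '' (Z ∩ L)) (s '' I) := by
    rw [disjoint_left]
    rintro _ ⟨a, -, rfl⟩ ⟨b, -, hb⟩
    by_cases h : b ∈ L <;> simp [hs, ht, h] at hb
  have hIfin := hZfin.subset hI.subset
  rw [hrk, hJi.rk_eq_ncard, hJ, ncard_union_eq hdisj ((hZfin.inter_of_left _).image _)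
    (hIfin.image _), ncard_image_of_injective _ (fun a b h ↦ by simpa [ht] using h),
    ncard_image_of_injective _ (fun a b h ↦ by rw [← hps a, h, hps]), ← hI.indep.rk_eq_ncard,
    rk_congr_closure hI.closure_eq_closure, add_comm]

theorem u24Sum_isTriangle (hN : N.Finite) (hL : L ⊆ N.E) (hl : l ∈ L) (hnl : N.IsNonloop l) :
    (u24Sum N L).IsTriangle (Sum.inr (l, 0)) (Sum.inr (l, 1)) (Sum.inr (l, 2)) := by
  have hmem : ∀ i, Sum.inr (l, i) ∈ (u24Sum N L).E := fun i ↦ inr_mem_u24Ground.2 hl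
  have hpair : ∀ i j : Fin 3, i ≠ j →
      (u24Sum N L).rk {Sum.inr (l, i), Sum.inr (l, j)} = 2 := by
    intro i j hij
    have hI : (u24Sum N L).Indep {Sum.inr (l, i), Sum.inr (l, j)} := by
      refine ⟨pair_subset (hmem i) (hmem j), fun e he ↦ ?_, hnl.indep.subset ?_⟩
      · have h3 : ∀ k : Fin 3, k = i ∨ k = j := fun k ↦ by
          have : k ∈ u24Fiber {Sum.inr (l, i), Sum.inr (l, j)} e := he ▸ mem_univ k
          simp only [u24Fiber, mem_ofPred_eq, mem_insert_iff, Sum.inr.injEq, Prod.mk.injEq,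
            mem_singleton_iff] at this
          exact this.imp And.right And.right
        have h0 := h3 0
        have h1 := h3 1
        have h2 := h3 2
        omega
      · rintro a (ha | ⟨k, hk, -⟩)
        · simp at ha
        · simp only [u24Fiber, mem_ofPred_eq, mem_insert_iff, Sum.inr.injEq, Prod.mk.injEq,
            mem_singleton_iff] at hk
          exact hk.elim And.left And.left
    rw [hI.rk_eq_ncard, ncard_pair (by simpa using hij)]
  refine ⟨hmem 0, hmem 1, hmem 2, hpair 0 1 (by simp), hpair 0 2 (by simp), hpair 1 2 (by simp), ?_⟩
  have h1 := rk_u24Lift hN hL (Z := {l}) (singleton_subset_iff.2 (hL hl))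
  rw [hnl.indep.rk_eq_ncard, inter_eq_left.2 (singleton_subset_iff.2 hl), ncard_singleton] at h1
  refine Eq.trans ?_ h1
  congr 1
  ext (a | ⟨b, i⟩)
  · rw [inl_mem_u24Lift]
    simp only [mem_insert_iff, reduceCtorEq, mem_singleton_iff, or_self, false_iff, not_and]
    rintro ⟨-, h⟩ rfl
    exact h hl
  · rw [inr_mem_u24Lift]
    simp only [mem_insert_iff, Sum.inr.injEq, Prod.mk.injEq, mem_singleton_iff]
    constructor
    · rintro (⟨rfl, -⟩ | ⟨rfl, -⟩ | ⟨rfl, -⟩) <;> exact ⟨hl, rfl⟩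
    · rintro ⟨-, rfl⟩
      simp only [true_and]
      omega

end U24

/-! ### Frame representations with a frame of minimum size -/

section FrameRep

variable {γ : Type*} {β : Type*} {M : Matroid γ} {Q : Matroid β} {B X : Set β} {φ : γ → β} {b : β}

/-- The map `φ` realizes `M` in the matroid `Q` (up to repetition of elements), in such a way that
all elements of `M` are spanned by at most two elements of the independent set `B`. -/
structure IsFrameRep (M : Matroid γ) (Q : Matroid β) (B : Set β) (φ : γ → β) : Prop where
  indep : Q.Indep B
  rk_image : ∀ X ⊆ M.E, Q.rk (φ '' X) = M.rk X
  pairSpanned : Q.PairSpanned B (φ '' M.E)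

theorem rk_contract_singleton_of_notMem_closure [Q.RankFinite] (hb : b ∈ Q.E)
    (hbX : b ∉ Q.closure X) : (Q ／ {b}).rk X = Q.rk X := by
  obtain ⟨I, hI⟩ := Q.exists_isBasis' X
  have hbI : b ∉ Q.closure I := hI.closure_eq_closure ▸ hbX
  have hbX' : b ∉ X := fun h ↦ hbX (Q.mem_closure_of_mem' h hb)
  have hins : Q.Indep (insert b I) := (hI.indep.notMem_closure_iff hb).1 hbI |>.1
  have hI' : (Q ／ {b}).Indep I := by
    rw [(indep_singleton.1 (hins.subset (by simp))).contractElem_indep_iff]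
    exact ⟨fun h ↦ hbX' (hI.subset h), hins⟩
  have h1 : Q.rk X = I.ncard := by
    rw [← hI.indep.rk_eq_ncard, rk_congr_closure hI.closure_eq_closure]
  rw [h1, ← hI'.rk_eq_ncard]
  refine le_antisymm (rk_le_of_inter_ground_subset_closure ?_) (rk_mono _ hI.subset)
  rintro x ⟨hx, hxE⟩
  rw [contract_closure_eq]
  refine ⟨Q.closure_subset_closure subset_union_left ?_, hxE.2⟩
  rw [hI.closure_eq_closure]
  exact Q.mem_closure_of_mem' hx hxE.1

/-- A frame element that the image does not span can be contracted without changing any rank of `M`;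
it simply disappears from the pairs. An element spanned by `b` alone would be parallel to `b`,
against the hypothesis on `b`. -/
theorem IsFrameRep.contract [Q.RankFinite] (h : M.IsFrameRep Q B φ)
    (hM : ∀ x ∈ M.E, M.IsNonloop x) (hb : b ∈ B) (hbM : b ∉ Q.closure (φ '' M.E)) :
    M.IsFrameRep (Q ／ {b}) (B \ {b}) φ where
  indep := h.indep.diff_indep_contract_of_subset (singleton_subset_iff.2 hb)
  rk_image X hX := by
    rw [rk_contract_singleton_of_notMem_closure (h.indep.subset_ground hb)
      (fun hcl ↦ hbM (Q.closure_subset_closure (image_mono hX) hcl)), h.rk_image X hX]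
  pairSpanned := by
    rintro _ ⟨y, hy, rfl⟩
    have hyE : φ y ∈ Q.E :=
      Q.closure_subset_ground _ (h.pairSpanned.subset_closure (mem_image_of_mem φ hy))
    have hyb : φ y ≠ b := fun hyb ↦ hbM
      (Q.mem_closure_of_mem' (hyb ▸ mem_image_of_mem φ hy) (h.indep.subset_ground hb))
    have hcl : ∀ {S : Set β} {c d : β}, φ y ∈ Q.closure S → S ⊆ {c, d} ∪ {b} →
        φ y ∈ (Q ／ {b}).closure {c, d} := by
      intro S c d hS hSb
      rw [contract_closure_eq]
      exact ⟨Q.closure_subset_closure hSb hS, hyb⟩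
    obtain ⟨c, hc, d, hd, hcd⟩ := h.pairSpanned _ (mem_image_of_mem φ hy)
    by_cases hcb : c = b
    · by_cases hdb : d = b
      · subst hcb hdb
        rw [pair_eq_singleton] at hcd
        have hny : φ y ∉ Q.closure ∅ := by
          intro hy0
          have h1 := rk_le_of_subset_closure (singleton_subset_iff.2 hy0)
          have h2 := h.rk_image {y} (singleton_subset_iff.2 hy)
          rw [image_singleton, (hM y hy).indep.rk_eq_ncard, ncard_singleton] at h2
          rw [rk_empty] at h1
          omega
        have h3 : d ∈ Q.closure {φ y} := by
          have := mem_closure_insert_swap (X := ∅) (y := d) (by simpa using hcd) hny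
          simpa using this
        exact (hbM (Q.closure_subset_closure
          (singleton_subset_iff.2 (mem_image_of_mem φ hy)) h3)).elim
      · exact ⟨d, ⟨hd, hdb⟩, d, ⟨hd, hdb⟩, hcl hcd (by rw [hcb, pair_eq_singleton, pair_comm]; rfl)⟩
    · by_cases hdb : d = b
      · exact ⟨c, ⟨hc, hcb⟩, c, ⟨hc, hcb⟩, hcl hcd (by rw [hdb, pair_eq_singleton]; rfl)⟩
      · exact ⟨c, ⟨hc, hcb⟩, d, ⟨hd, hdb⟩, hcl hcd subset_union_left⟩

/-- Unspanned frame elements are contracted one at a time. When none is left, the frame and the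
image span each other. -/
theorem IsFrameRep.exists_ncard_eq (hM : ∀ x ∈ M.E, M.IsNonloop x) (n : ℕ) :
    ∀ (Q : Matroid β) (B : Set β), Q.RankFinite → M.IsFrameRep Q B φ → B.ncard = n →
      ∃ (Q' : Matroid β) (B' : Set β), Q'.RankFinite ∧ M.IsFrameRep Q' B' φ ∧
        B'.ncard = M.rk M.E := by
  induction n with
  | zero =>
    intro Q B hQ h hB
    refine ⟨Q, B, hQ, h, ?_⟩
    have h1 := rk_le_of_subset_closure h.pairSpanned.subset_closure
    rw [h.indep.rk_eq_ncard, h.rk_image _ subset_rfl] at h1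
    omega
  | succ n ih =>
    intro Q B hQ h hB
    by_cases hcl : B ⊆ Q.closure (φ '' M.E)
    · refine ⟨Q, B, hQ, h, ?_⟩
      have h1 := rk_le_of_subset_closure h.pairSpanned.subset_closure
      have h2 := rk_le_of_subset_closure hcl
      rw [h.indep.rk_eq_ncard, h.rk_image _ subset_rfl] at h1 h2
      omega
    · obtain ⟨b, hb, hbM⟩ := not_subset.1 hcl
      refine ih (Q ／ {b}) (B \ {b}) inferInstance (h.contract hM hb hbM) ?_
      have := ncard_sdiff_singleton_add_one hb h.indep.finite
      omega

theorem IsFrame.exists_isFrameRep (h : M.IsFrame) (hM : ∀ x ∈ M.E, M.IsNonloop x) :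
    ∃ (Q : Matroid (γ ⊕ ℕ)) (B : Set (γ ⊕ ℕ)), Q.RankFinite ∧ M.IsFrameRep Q B Sum.inl ∧
      B.ncard = M.rk M.E := by
  obtain ⟨Q, hQ, ⟨R, hR, hMR⟩, B, hB, hBQ⟩ := h
  have hRE : Sum.inl '' M.E = R := by
    have := congrArg Matroid.E hMR
    simpa using this
  have hrk : ∀ X ⊆ M.E, Q.rk (Sum.inl '' X) = M.rk X := by
    intro X hX
    have h1 := M.eRk_map Sum.inl_injective.injOn (β := γ ⊕ ℕ) hX
    rw [hMR, restrict_eRk_eq _ (hRE ▸ image_mono hX)] at h1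
    rw [rk, h1, rk]
  refine IsFrameRep.exists_ncard_eq hM B.ncard Q B inferInstance ⟨hB.indep, hrk, ?_⟩ rfl
  rintro _ ⟨y, hy, rfl⟩
  obtain ⟨S, hSB, hS, hyS⟩ := hBQ (Sum.inl y) (hR (hRE ▸ mem_image_of_mem _ hy))
  have hSfin : S.Finite := finite_of_encard_le_coe (k := 2) hS
  have hS2 : S.ncard ≤ 2 := by
    rw [← hSfin.cast_ncard_eq] at hS
    exact_mod_cast hS
  obtain hS0 | hS0 := S.eq_empty_or_nonempty
  · have h1 := rk_le_of_subset_closure (singleton_subset_iff.2 hyS)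
    have h2 := hrk {y} (singleton_subset_iff.2 hy)
    rw [image_singleton, (hM y hy).indep.rk_eq_ncard, ncard_singleton] at h2
    rw [hS0, rk_empty] at h1
    omega
  · obtain ⟨b, hb⟩ := hS0
    have h1 := ncard_sdiff_singleton_add_one hb hSfin
    obtain hS1 | ⟨c, hc⟩ := (S \ {b}).eq_empty_or_nonempty
    · exact ⟨b, hSB hb, b, hSB hb, Q.closure_subset_closure (by
        rw [pair_eq_singleton]; exact sdiff_eq_empty.1 hS1) hyS⟩
    · refine ⟨b, hSB hb, c, hSB hc.1, Q.closure_subset_closure (fun x hx ↦ ?_) hyS⟩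
      by_contra hxbc
      have h2 : ({b, c, x} : Set (γ ⊕ ℕ)) ⊆ S :=
        insert_subset hb (pair_subset hc.1 hx)
      have h3 := ncard_le_ncard h2 hSfin
      have h4 : ({b, c, x} : Set (γ ⊕ ℕ)).ncard = 3 := by
        rw [ncard_eq_three]
        exact ⟨b, c, x, fun h ↦ hc.2 h.symm, fun h ↦ hxbc (.inl h.symm),
          fun h ↦ hxbc (.inr h.symm), rfl⟩
      omega

/-- This is the way back to `IsFrame`: any injective-on-independent-sets realization in an ambient
type can be pulled back to `γ ⊕ ℕ`, with the finite frame numbered by an initial segment of `ℕ`. -/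
theorem isFrame_of_indep_iff (hM : M.Finite) (hB : Q.Indep B) (hBfin : B.Finite)
    (hI : ∀ I ⊆ M.E, M.Indep I ↔ Q.Indep (φ '' I) ∧ InjOn φ I)
    (hp : Q.PairSpanned B (φ '' M.E)) : M.IsFrame := by
  -- The type `β` may be empty, so `none` serves as the value of the numbering outside `Iio
  -- B.ncard`.
  obtain ⟨e, he⟩ : ∃ e : ℕ → Option β, BijOn e (Iio B.ncard) (some '' B) := by
    have hfin := hBfin.image some
    have hcard : (some '' B).ncard = B.ncard :=
      ncard_image_of_injective _ (Option.some_injective β)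
    have : Fintype (some '' B : Set (Option β)) := hfin.fintype
    have hc : Fintype.card (some '' B : Set (Option β)) = B.ncard := by
      rw [← Nat.card_eq_fintype_card, Nat.card_coe_set_eq, hcard]
    let eq := (Fintype.equivFinOfCardEq hc).symm
    refine ⟨fun n ↦ if h : n < B.ncard then (eq ⟨n, h⟩).1 else none, ?_, ?_, ?_⟩
    · intro n hn
      rw [mem_Iio] at hn
      simp only [hn, dif_pos]
      exact (eq ⟨n, hn⟩).2
    · intro n hn m hm hnm
      rw [mem_Iio] at hn hm
      simp only [hn, hm, dif_pos] at hnm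
      have := eq.injective (Subtype.ext hnm)
      simpa using this
    · intro x hx
      refine ⟨(eq.symm ⟨x, hx⟩).1, (eq.symm ⟨x, hx⟩).2, ?_⟩
      have : ((eq.symm ⟨x, hx⟩).1 : ℕ) < B.ncard := (eq.symm ⟨x, hx⟩).2
      simp [this]
  set Q' : Matroid (Option β) := Q.map some (Option.some_injective β).injOn with hQ'
  -- Pulling back along `g` gives every frame element a name of its own in `ℕ`; elements of `M` with
  -- the same image become parallel.
  set g : γ ⊕ ℕ → Option β := Sum.elim (fun x ↦ some (φ x)) e with hg
  set R : Set (γ ⊕ ℕ) := Sum.inl '' M.E ∪ Sum.inr '' Iio B.ncard with hR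
  have hB' : Q'.Indep (some '' B) := hB.map _ _
  have hφE : ∀ x ∈ M.E, φ x ∈ Q.E := fun x hx ↦
    Q.closure_subset_ground _ (hp.subset_closure (mem_image_of_mem φ hx))
  have hgl : ∀ I : Set γ, g '' (Sum.inl '' I) = some '' (φ '' I) := fun I ↦ by
    rw [image_image, image_image]; rfl
  have hgr : ∀ S : Set ℕ, g '' (Sum.inr '' S) = e '' S := fun I ↦ by
    rw [image_image]; rfl
  have hRE : R ⊆ (Q'.comap g).E := by
    rw [comap_ground_eq]
    rintro _ (⟨x, hx, rfl⟩ | ⟨n, hn, rfl⟩)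
    · exact mem_image_of_mem some (hφE x hx)
    · exact hB'.subset_ground (he.mapsTo hn)
  have hcl : ∀ S ⊆ R, ((Q'.comap g) ↾ R).closure S = g ⁻¹' Q'.closure (g '' S) ∩ R := by
    intro S hS
    rw [restrict_closure_eq _ hS hRE, comap_closure_eq]
  refine ⟨(Q'.comap g) ↾ R, ⟨?_⟩, ⟨Sum.inl '' M.E, subset_union_left, ?_⟩,
    Sum.inr '' Iio B.ncard, ?_, ?_⟩
  · exact (hM.ground_finite.image _).union ((finite_Iio _).image _)
  · refine ext_indep (by simp) fun I hIE ↦ ?_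
    obtain ⟨J, hJ, rfl⟩ := subset_image_iff.1 hIE
    rw [map_image_indep_iff hJ, restrict_indep_iff, restrict_indep_iff, comap_indep_iff, hgl,
      hQ', map_image_indep_iff (by
        rintro _ ⟨x, hx, rfl⟩
        exact hφE x (hJ hx)), hI J hJ]
    have hinj : InjOn g (Sum.inl '' J) ↔ InjOn φ J := by
      constructor
      · intro h x hx y hy hxy
        exact Sum.inl_injective (h (mem_image_of_mem _ hx) (mem_image_of_mem _ hy)
          (congrArg some hxy))
      · rintro h _ ⟨x, hx, rfl⟩ _ ⟨y, hy, rfl⟩ hxy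
        exact congrArg Sum.inl (h hx hy (Option.some_injective β hxy))
    rw [hinj]
    have h1 : Sum.inl '' J ⊆ R := (image_mono hJ).trans subset_union_left
    tauto
  · rw [isBase_iff_indep_closure_eq, hcl _ subset_union_right, hgr, he.image_eq,
      restrict_indep_iff, comap_indep_iff, hgr, he.image_eq]
    refine ⟨⟨⟨hB', ?_⟩, subset_union_right⟩, ?_⟩
    · rintro _ ⟨n, hn, rfl⟩ _ ⟨m, hm, rfl⟩ hnm
      exact congrArg Sum.inr (he.injOn hn hm hnm)
    · rw [restrict_ground_eq, inter_eq_right]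
      rintro _ (⟨x, hx, rfl⟩ | ⟨n, hn, rfl⟩)
      · rw [mem_preimage, hQ', map_closure_eq, preimage_image_eq _ (Option.some_injective β)]
        exact mem_image_of_mem some (hp.subset_closure (mem_image_of_mem φ hx))
      · exact Q'.subset_closure _ hB'.subset_ground (he.mapsTo hn)
  · rintro _ (⟨x, hx, rfl⟩ | ⟨n, hn, rfl⟩)
    · obtain ⟨b, hb, c, hc, hx'⟩ := hp _ (mem_image_of_mem φ hx)
      obtain ⟨i, hi, hib⟩ := he.surjOn (mem_image_of_mem some hb)
      obtain ⟨j, hj, hjc⟩ := he.surjOn (mem_image_of_mem some hc)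
      refine ⟨{Sum.inr i, Sum.inr j}, pair_subset (mem_image_of_mem _ hi) (mem_image_of_mem _ hj),
        (encard_insert_le _ _).trans (by rw [encard_singleton]; norm_num), ?_⟩
      rw [hcl _ ((pair_subset (mem_image_of_mem _ hi)
        (mem_image_of_mem _ hj)).trans subset_union_right)]
      refine ⟨?_, .inl (mem_image_of_mem _ hx)⟩
      have h1 : g '' {Sum.inr i, Sum.inr j} = some '' {b, c} := by
        rw [image_pair, image_pair]
        simp only [hg, Sum.elim_inr, hib, hjc]
      rw [mem_preimage, h1, hQ', map_closure_eq, preimage_image_eq _ (Option.some_injective β)]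
      exact mem_image_of_mem some hx'
    · have hn' : Sum.inr n ∈ (Sum.inr '' Iio B.ncard : Set (γ ⊕ ℕ)) := mem_image_of_mem _ hn
      exact ⟨{Sum.inr n}, singleton_subset_iff.2 hn', by simp,
        mem_closure_of_mem' _ rfl (.inr hn')⟩

end FrameRep

/-! ### Consequences of 3-connectivity -/

section Connectivity

variable {α : Type u} {N : Matroid α} {X : Set α} {x y l m : α}

theorem rk_ground_le_rk_add_rk [N.RankFinite] (hX : X ⊆ N.E) :
    N.rk N.E ≤ N.rk X + N.rk (N.E \ X) := by
  have h := N.rk_union_le X (N.E \ X)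
  rwa [union_sdiff_cancel hX] at h

theorem IsKConnected.ncard_lt_or_ncard_lt {n k : ℕ} (hN : N.Finite) (h : N.IsKConnected n)
    (hX : X ⊆ N.E) (hk : k < n) (hr : N.rk X + N.rk (N.E \ X) + 1 = N.rk N.E + k) :
    X.ncard < k ∨ (N.E \ X).ncard < k := by
  by_contra! hc
  have hE := hN.ground_finite
  refine h k hk X (N.E \ X) ⟨union_sdiff_cancel hX, disjoint_sdiff_right, ?_, ?_, ?_⟩
  · rw [← eRk_ground, ← coe_rk, ← coe_rk, ← coe_rk]
    exact_mod_cast hr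
  · rw [← (hE.subset hX).cast_ncard_eq]
    exact_mod_cast hc.1
  · rw [← hE.sdiff.cast_ncard_eq]
    exact_mod_cast hc.2

theorem IsKConnected.eq_empty_or_eq_empty {n : ℕ} (hN : N.Finite) (h : N.IsKConnected n)
    (hn : 1 < n) (hX : X ⊆ N.E) (hr : N.rk X + N.rk (N.E \ X) ≤ N.rk N.E) :
    X = ∅ ∨ N.E \ X = ∅ := by
  have hE := hN.ground_finite
  have h1 := rk_ground_le_rk_add_rk hX
  have h2 := h.ncard_lt_or_ncard_lt hN hX hn (by omega)
  rwa [Nat.lt_one_iff, Nat.lt_one_iff, ncard_eq_zero (hE.subset hX), ncard_eq_zero hE.sdiff] at h2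

theorem IsKConnected.ncard_le_one_or_ncard_le_one (hN : N.Finite) (h : N.IsKConnected 3)
    (hX : X ⊆ N.E) (hr : N.rk X + N.rk (N.E \ X) ≤ N.rk N.E + 1) :
    X.ncard ≤ 1 ∨ (N.E \ X).ncard ≤ 1 := by
  have h1 := rk_ground_le_rk_add_rk hX
  obtain hr | hr := hr.lt_or_eq
  · refine (h.eq_empty_or_eq_empty hN (by omega) hX (by omega)).imp ?_ ?_ <;>
    · intro h0
      simp [h0]
  · have := h.ncard_lt_or_ncard_lt hN hX (k := 2) (by omega) (by omega)
    omega

theorem IsKConnected.isNonloop {n : ℕ} (hN : N.Finite) (h : N.IsKConnected n) (hn : 1 < n)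
    (hE : 2 ≤ N.E.ncard) (hx : x ∈ N.E) : N.IsNonloop x := by
  rw [← not_isLoop_iff]
  intro hl
  have h1 := rk_le_of_subset_closure (Q := N) (X := {x}) (Y := ∅) (singleton_subset_iff.2 hl)
  rw [rk_empty] at h1
  have h2 := N.rk_mono (X := N.E \ {x}) sdiff_subset
  have h3 := ncard_sdiff_singleton_add_one hx hN.ground_finite
  obtain h | h := h.eq_empty_or_eq_empty hN hn (singleton_subset_iff.2 hx) (by omega)
  · simp at h
  · rw [h, ncard_empty] at h3
    omega

variable (hN : N.Finite) (h : N.IsKConnected 3) (hE : 4 ≤ N.E.ncard)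
include hN h hE

theorem IsKConnected.rk_sdiff_pair (hl : l ∈ N.E) (hm : m ∈ N.E) :
    N.rk (N.E \ {l, m}) = N.rk N.E := by
  obtain rfl | hne := eq_or_ne l m
  · rw [pair_eq_singleton]
    have h3 := ncard_sdiff_singleton_add_one hl hN.ground_finite
    have h1 := N.rk_singleton_le l
    refine le_antisymm (rk_mono _ sdiff_subset) ?_
    by_contra! hc
    obtain h | h := h.eq_empty_or_eq_empty hN (by omega) (singleton_subset_iff.2 hl) (by omega)
    · simp at h
    · rw [h, ncard_empty] at h3
      omega
  have h1 := N.rk_le_ncard (toFinite {l, m})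
  have h2 := ncard_pair hne
  have h3 := ncard_sdiff_add_ncard_of_subset (pair_subset hl hm) hN.ground_finite
  refine le_antisymm (rk_mono _ sdiff_subset) ?_
  by_contra! hc
  have := h.ncard_le_one_or_ncard_le_one hN (pair_subset hl hm) (by omega)
  omega

/-- A 3-connected matroid on at least four elements has no coloop. -/
theorem IsKConnected.rk_sdiff_singleton (hl : l ∈ N.E) : N.rk (N.E \ {l}) = N.rk N.E := by
  have := h.rk_sdiff_pair hN hE hl hl
  rwa [pair_eq_singleton] at this

/-- This says that `N \ l` is connected. Adding `l` to either side of a separation raises the rank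
by at most one, so both resulting bipartitions of `N.E` have a side with at most one element. With
at least four elements in all, one original side is empty. -/
theorem IsKConnected.eq_empty_or_eq_empty_of_sdiff (hl : l ∈ N.E) (hX : X ⊆ N.E \ {l})
    (hr : N.rk X + N.rk ((N.E \ {l}) \ X) ≤ N.rk N.E) : X = ∅ ∨ (N.E \ {l}) \ X = ∅ := by
  have hfin := hN.ground_finite
  have hXE := hX.trans sdiff_subset
  have hlX : l ∉ X := fun h ↦ (hX h).2 rfl
  have hXf := hfin.subset hXE
  have hYf : ((N.E \ {l}) \ X).Finite := hfin.sdiff.sdiff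
  have e1 : N.E \ insert l X = (N.E \ {l}) \ X := by
    rw [← union_singleton, union_comm, sdiff_sdiff]
  have e2 : N.E \ X = insert l ((N.E \ {l}) \ X) := by
    ext z
    simp only [mem_sdiff, mem_insert_iff, mem_singleton_iff]
    by_cases hz : z = l
    · simp [hz, hl, hlX]
    · simp [hz]
  have hlY : l ∉ (N.E \ {l}) \ X := fun h ↦ h.1.2 rfl
  have n1 := ncard_sdiff_add_ncard_of_subset hXE hfin
  have n2 := ncard_insert_of_notMem hlX hXf
  have n3 := ncard_insert_of_notMem hlY hYf
  rw [← e2] at n3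
  have r1 := N.rk_insert_le l X
  have r2 := N.rk_insert_le l ((N.E \ {l}) \ X)
  rw [← e2] at r2
  have c1 := h.ncard_le_one_or_ncard_le_one hN (insert_subset hl hXE) (by rw [e1]; omega)
  have c2 := h.ncard_le_one_or_ncard_le_one hN hXE (by omega)
  rw [e1] at c1
  rw [← ncard_eq_zero hXf, ← ncard_eq_zero hYf]
  omega

end Connectivity

/-! ### Each attached triangle lies on a line through a private frame element -/

section Structure

variable {α : Type u} {β : Type*} {γ : Type*} {N : Matroid α} {M : Matroid γ} {Q : Matroid β}
  {B : Set β} {φ : γ → β} {L : Set α} {l : α} {f g h : γ}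

theorem IsFrameRep.mem_ground (hR : M.IsFrameRep Q B φ) (hf : f ∈ M.E) : φ f ∈ Q.E :=
  Q.closure_subset_ground _ (hR.pairSpanned.subset_closure (mem_image_of_mem φ hf))

theorem IsFrameRep.mem_closure_image_iff [Q.RankFinite] [M.RankFinite] (hR : M.IsFrameRep Q B φ)
    (hf : f ∈ M.E) {X : Set γ} (hX : X ⊆ M.E) :
    φ f ∈ Q.closure (φ '' X) ↔ f ∈ M.closure X := by
  have h1 := hR.rk_image X hX
  have h2 := hR.rk_image (insert f X) (insert_subset hf hX)
  rw [image_insert_eq] at h2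
  constructor
  · intro hc
    have := rk_insert_of_mem_closure hc
    exact mem_closure_of_rk_insert_le hf (by omega)
  · intro hc
    have := rk_insert_of_mem_closure hc
    exact mem_closure_of_rk_insert_le (hR.mem_ground hf) (by omega)

theorem IsFrameRep.isTriangle (hR : M.IsFrameRep Q B φ) (hT : M.IsTriangle f g h) :
    Q.IsTriangle (φ f) (φ g) (φ h) := by
  have hf := hT.fst_mem
  have hg := hT.snd_mem
  have hh := hT.thd_mem
  refine ⟨hR.mem_ground hf, hR.mem_ground hg, hR.mem_ground hh, ?_, ?_, ?_, ?_⟩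
  · rw [← image_pair, hR.rk_image _ (pair_subset hf hg), hT.rk_fst_snd]
  · rw [← image_pair, hR.rk_image _ (pair_subset hf hh), hT.rk_fst_thd]
  · rw [← image_pair, hR.rk_image _ (pair_subset hg hh), hT.rk_snd_thd]
  · rw [← image_pair, ← image_insert_eq, hR.rk_image _ (insert_subset hf (pair_subset hg hh)),
      hT.rk_eq]

theorem u24Lift_singleton (hl : l ∈ L) :
    u24Lift N L {l} = {Sum.inr (l, 0), Sum.inr (l, 1), Sum.inr (l, 2)} := by
  ext (a | ⟨b, i⟩)
  · rw [inl_mem_u24Lift]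
    simp only [mem_insert_iff, reduceCtorEq, mem_singleton_iff, or_self, iff_false, not_and]
    rintro ⟨-, h⟩ rfl
    exact h hl
  · rw [inr_mem_u24Lift]
    simp only [mem_insert_iff, Sum.inr.injEq, Prod.mk.injEq, mem_singleton_iff]
    constructor
    · rintro ⟨-, rfl⟩
      simp only [true_and]
      omega
    · rintro (⟨rfl, -⟩ | ⟨rfl, -⟩ | ⟨rfl, -⟩) <;> exact ⟨hl, rfl⟩

/-- Two of the three elements lie on the same side, and they span the third. -/
theorem IsTriangle.subset_closure_or_subset_closure [Q.RankFinite] {f g h : β}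
    (hT : Q.IsTriangle f g h) {S T : Set β}
    (hST : ∀ x ∈ ({f, g, h} : Set β), x ∈ Q.closure S ∨ x ∈ Q.closure T) :
    {f, g, h} ⊆ Q.closure S ∨ {f, g, h} ⊆ Q.closure T := by
  have key : ∀ {a b : β} {S : Set β}, {f, g, h} ⊆ Q.closure {a, b} → a ∈ Q.closure S →
      b ∈ Q.closure S → {f, g, h} ⊆ Q.closure S := fun h1 ha hb ↦
    h1.trans (Q.closure_subset_closure_of_subset_closure (pair_subset ha hb))
  have h1 := hT.subset_closure
  have h2 : {f, g, h} ⊆ Q.closure {g, h} := by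
    have := hT.rotate.subset_closure
    rwa [pair_comm h f, insert_comm g f] at this
  have h3 : {f, g, h} ⊆ Q.closure {h, f} := by
    have := hT.rotate.rotate.subset_closure
    rwa [insert_comm h f, pair_comm h g] at this
  have hf := hST f (by simp)
  have hg := hST g (by simp)
  have hh := hST h (by simp)
  rcases hf with hf | hf <;> rcases hg with hg | hg <;> rcases hh with hh | hh
  · exact .inl (key h1 hf hg)
  · exact .inl (key h1 hf hg)
  · exact .inl (key h3 hh hf)
  · exact .inr (key h2 hg hh)
  · exact .inl (key h2 hg hh)
  · exact .inr (key h3 hh hf)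
  · exact .inr (key h1 hf hg)
  · exact .inr (key h1 hf hg)

/-- The complement `R` of the triangle at `l` has corank one and so splits along the frame.
Connectivity of `N \ l` puts `R` on one side, and a second triangle, available since `2 ≤ L.ncard`,
rules out the case where `R` spans no frame element. So `R` spans `B \ {a}`, a hyperplane missing
the triangle at `l`, whose line must then pass through `a`. -/
theorem IsFrameRep.exists_line_of_isKConnected [Q.RankFinite] (hN : N.Finite)
    (h3 : N.IsKConnected 3) (hE : 4 ≤ N.E.ncard) (hL : L ⊆ N.E) (hL2 : 2 ≤ L.ncard)
    {φ : α ⊕ α × Fin 3 → β} (hR : (u24Sum N L).IsFrameRep Q B φ)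
    (hB : B.ncard = (u24Sum N L).rk (u24Sum N L).E) (hl : l ∈ L) :
    ∃ a ∈ B, ∃ x ∈ B, x ≠ a ∧ φ '' u24Lift N L {l} ⊆ Q.closure {a, x} ∧
      {a, x} ⊆ Q.closure (φ '' u24Lift N L {l}) ∧
      φ '' u24Lift N L (N.E \ {l}) ⊆ Q.closure (B \ {a}) := by
  have hMfin := u24Sum_finite hN hL
  have hlE := hL hl
  have hLfin := hN.ground_finite.subset hL
  have hnl : ∀ {m}, m ∈ L → N.IsNonloop m := fun hm ↦
    h3.isNonloop hN (by omega) (by omega) (hL hm)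
  have hT : ∀ {m}, m ∈ L → Q.IsTriangle (φ (Sum.inr (m, 0))) (φ (Sum.inr (m, 1)))
      (φ (Sum.inr (m, 2))) := fun hm ↦ hR.isTriangle (u24Sum_isTriangle hN hL hm (hnl hm))
  have hTi : ∀ {m}, m ∈ L → φ '' u24Lift N L {m} =
      {φ (Sum.inr (m, 0)), φ (Sum.inr (m, 1)), φ (Sum.inr (m, 2))} := fun hm ↦ by
    rw [u24Lift_singleton hm, image_insert_eq, image_pair]
  have hrk : ∀ {Z}, Z ⊆ N.E → Q.rk (φ '' u24Lift N L Z) = N.rk Z + (Z ∩ L).ncard := fun hZ ↦ by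
    rw [hR.rk_image _ u24Lift_subset, rk_u24Lift hN hL hZ]
  have hB' : B.ncard = N.rk N.E + L.ncard := by
    rw [hB, ← u24Lift_ground hL, rk_u24Lift hN hL subset_rfl, inter_eq_right.2 hL]
  set R := φ '' u24Lift N L (N.E \ {l}) with hRdef
  have hRp : Q.PairSpanned B R := hR.pairSpanned.mono (image_mono u24Lift_subset)
  have hn1 : ∀ {Z m}, m ∈ L → L ⊆ insert m Z → m ∉ Z → (Z ∩ L).ncard + 1 = L.ncard := by
    intro Z m hm hZ hmZ
    rw [← ncard_sdiff_singleton_add_one hm hLfin]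
    congr 2
    ext z
    simp only [mem_inter_iff, mem_sdiff, mem_singleton_iff]
    constructor
    · rintro ⟨h1, h2⟩
      exact ⟨h2, fun h ↦ hmZ (h ▸ h1)⟩
    · rintro ⟨h1, h2⟩
      exact ⟨(hZ h1).resolve_left h2, h1⟩
  have hn2 := hn1 (Z := N.E \ {l}) hl (fun z hz ↦ or_iff_not_imp_left.2 fun h ↦ ⟨hL hz, h⟩)
    (fun h ↦ h.2 rfl)
  -- Deleting `l` keeps the rank of `N`, so only the summand counting the copies drops, by one.
  have hRr : B.ncard = Q.rk R + 1 := by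
    rw [hRdef, hrk sdiff_subset, h3.rk_sdiff_singleton hN hE hlE]
    omega
  have hF : ∀ {m Z}, m ∈ L → m ∉ Z → ∀ x ∈ ({φ (Sum.inr (m, 0)), φ (Sum.inr (m, 1)),
      φ (Sum.inr (m, 2))} : Set β), x ∉ Q.closure (φ '' u24Lift N L Z) := by
    intro m Z hm hmZ
    have : ∀ i, φ (Sum.inr (m, i)) ∉ Q.closure (φ '' u24Lift N L Z) := by
      intro i
      rw [hR.mem_closure_image_iff (inr_mem_u24Ground.2 hm) u24Lift_subset]
      exact inr_notMem_closure_u24Sum hm fun j hj ↦ hmZ (inr_mem_u24Lift.1 hj).2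
    rintro x (rfl | rfl | rfl)
    exacts [this 0, this 1, this 2]
  have hmemL : ∀ {p}, p ∈ u24Lift N L N.E → p ∈ u24Lift N L {u24Proj p} := fun hp ↦ ⟨hp.1, rfl⟩
  obtain ⟨-, hTU⟩ := PairSpanned.mem_closure_inter_or_sdiff hR.indep hRp hRr
  set T := B ∩ Q.closure R
  set U := B \ Q.closure R
  have hside : ∀ z ∈ N.E \ {l}, φ '' u24Lift N L {z} ⊆ Q.closure T ∨
      φ '' u24Lift N L {z} ⊆ Q.closure U := by
    intro z hz
    have hz' : φ '' u24Lift N L {z} ⊆ R := image_mono (u24Lift_mono (singleton_subset_iff.2 hz))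
    by_cases hzL : z ∈ L
    · rw [hTi hzL] at hz' ⊢
      exact (hT hzL).subset_closure_or_subset_closure fun x hx ↦ hTU x (hz' hx)
    · have : u24Lift N L {z} = {Sum.inl z} := by
        ext (a | ⟨b, i⟩)
        · simp only [inl_mem_u24Lift, mem_singleton_iff, Sum.inl.injEq]
          exact ⟨fun h ↦ h.2, fun h ↦ ⟨h ▸ ⟨hz.1, hzL⟩, h⟩⟩
        · simp only [inr_mem_u24Lift, mem_singleton_iff, reduceCtorEq, iff_false]
          exact fun h ↦ hzL (h.2 ▸ h.1)
      rw [this, image_singleton] at hz' ⊢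
      simpa using hTU _ (singleton_subset_iff.1 hz')
  -- Since every triangle lies wholly on one side, the splitting of `R` comes from a bipartition
  -- `(Z, W)` of the ground set of `N \ l`.
  set Z := {z ∈ N.E \ {l} | φ '' u24Lift N L {z} ⊆ Q.closure T} with hZ
  set W := (N.E \ {l}) \ Z with hW
  have hZs : φ '' u24Lift N L Z ⊆ Q.closure T := by
    rintro _ ⟨p, hp, rfl⟩
    exact hp.2.2 (mem_image_of_mem φ ⟨hp.1, rfl⟩)
  have hWs : φ '' u24Lift N L W ⊆ Q.closure U := by
    rintro _ ⟨p, hp, rfl⟩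
    exact (hside _ hp.2.1).resolve_left (fun h ↦ hp.2.2 ⟨hp.2.1, h⟩)
      (mem_image_of_mem φ ⟨hp.1, rfl⟩)
  have hZE : Z ⊆ N.E := fun z hz ↦ hz.1.1
  have hWE : W ⊆ N.E := fun z hz ↦ hz.1.1
  have hZW : Z ∪ W = N.E \ {l} := union_sdiff_cancel fun z hz ↦ hz.1
  have hZWL : (Z ∩ L).ncard + (W ∩ L).ncard = ((N.E \ {l}) ∩ L).ncard := by
    rw [← ncard_union_eq (disjoint_left.2 fun z hz hw ↦ hw.1.2 hz.1) (hLfin.inter_of_right _)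
      (hLfin.inter_of_right _), ← union_inter_distrib_right, hZW]
  -- The sides are skew, so after the copies are subtracted the ranks of `Z` and `W` in `N` sum to
  -- at most the rank of `N`. This is a separation of `N \ l` unless a side is empty.
  have hskew := rk_add_rk_le_of_subset_closure hR.indep (inter_subset_left : T ⊆ B)
    (sdiff_subset : U ⊆ B) (disjoint_left.2 fun b hb hb' ↦ hb'.2 hb.2) hZs hWs
  have hle : Q.rk (φ '' u24Lift N L Z ∪ φ '' u24Lift N L W) ≤ Q.rk R := by
    refine rk_mono _ (union_subset (image_mono (u24Lift_mono ?_)) (image_mono (u24Lift_mono ?_)))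
    · exact fun z hz ↦ hz.1
    · exact fun z hz ↦ hz.1
  rw [hrk hZE, hrk hWE] at hskew
  have hconn := h3.eq_empty_or_eq_empty_of_sdiff hN hE hlE (X := Z) (fun z hz ↦ hz.1)
    (by rw [← hW]; omega)
  have hconn' : (∀ x ∈ R, x ∈ Q.closure T) ∨ ∀ x ∈ R, x ∈ Q.closure U := by
    rw [← hW] at hconn
    obtain h0 | h0 := hconn
    · rw [h0, empty_union] at hZW
      rw [hZW] at hWs
      exact .inr hWs
    · rw [h0, union_empty] at hZW
      rw [hZW] at hZs
      exact .inl hZs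
  obtain hall | ⟨a, ha, hRa, haR⟩ := PairSpanned.disjoint_or_exists_singleton hR.indep hRp hRr hconn'
  · obtain ⟨m, hm, hml⟩ : ∃ m ∈ L, m ≠ l := exists_ne_of_one_lt_ncard (by omega) l
    refine (PairSpanned.false_of_isTriangle hR.indep hRp hall (hT hm)
      (P := φ '' u24Lift N L (N.E \ {l, m})) ?_ (image_mono (u24Lift_mono ?_)) ?_
      (hF hm fun h ↦ h.2 (.inr rfl))).elim
    · rw [← hTi hm]
      exact image_mono (u24Lift_mono (singleton_subset_iff.2 ⟨hL hm, hml⟩))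
    · exact sdiff_subset_sdiff_right (by simp)
    -- Removing the triangles at both `l` and `m` leaves corank exactly two, because `N` keeps its
    -- rank when `l` and `m` are deleted.
    · have h1 : (N.E \ {l, m}) ∩ L = ((N.E \ {l}) ∩ L) \ {m} := by
        ext z
        simp only [mem_inter_iff, mem_sdiff, mem_insert_iff, mem_singleton_iff]
        tauto
      have h2 := ncard_sdiff_singleton_add_one (show m ∈ (N.E \ {l}) ∩ L from ⟨⟨hL hm, hml⟩, hm⟩)
        (hLfin.inter_of_right _)
      rw [hrk sdiff_subset, h3.rk_sdiff_pair hN hE hlE (hL hm), h1]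
      omega
  · have hcl : Q.closure (B \ {a}) ⊆ Q.closure R :=
      Q.closure_subset_closure_of_subset_closure haR
    have hFl := hF (Z := N.E \ {l}) hl fun h ↦ h.2 rfl
    obtain ⟨x, hx, hxa, h1, h2⟩ := PairSpanned.exists_line hR.indep
      (hTi hl ▸ hR.pairSpanned.mono (image_mono u24Lift_subset)) (hT hl)
      (fun y hy hy' ↦ hFl y hy (hcl hy'))
    rw [← hTi hl] at h1 h2
    exact ⟨a, ha, x, hx, hxa, h1, h2, hRa⟩

end Structure

/-! ### Representing `N` with the elements of `L` in the frame -/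

section JointRep

variable {α : Type u} {β : Type*} {N : Matroid α} {Q : Matroid β}
  {B B' P : Set β} {L : Set α}

/-- Intersecting a spanning pair with `B'` loses nothing, by the intersection property of closures
within an independent set. -/
theorem PairSpanned.of_subset (hp : Q.PairSpanned B P) (hB : Q.Indep B) (hB' : B' ⊆ B)
    (hne : B'.Nonempty) (hP : P ⊆ Q.closure B') : Q.PairSpanned B' P := by
  intro x hx
  obtain ⟨b, hb, c, hc, hxbc⟩ := hp x hx
  have h1 : x ∈ Q.closure ({b, c} ∩ B') := by
    rw [(hB.subset (union_subset (pair_subset hb hc) hB')).closure_inter_eq_inter_closure]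
    exact ⟨hxbc, hP hx⟩
  obtain ⟨d, hd⟩ := hne
  by_cases hb' : b ∈ B'
  · by_cases hc' : c ∈ B'
    · exact ⟨b, hb', c, hc', hxbc⟩
    · refine ⟨b, hb', b, hb', Q.closure_subset_closure ?_ h1⟩
      rintro y ⟨rfl | rfl, hy⟩
      · simp
      · exact (hc' hy).elim
  · by_cases hc' : c ∈ B'
    · refine ⟨c, hc', c, hc', Q.closure_subset_closure ?_ h1⟩
      rintro y ⟨rfl | rfl, hy⟩
      · exact (hb' hy).elim
      · simp
    · refine ⟨d, hd, d, hd, Q.closure_subset_closure ?_ h1⟩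
      rintro y ⟨rfl | rfl, hy⟩
      · exact (hb' hy).elim
      · exact (hc' hy).elim

/-- The triangle at `l` spans `{a l, x l}`. Using `x l` as the basepoint and dropping the private
elements `a l` undoes all 2-sums at once, in the same ambient matroid. -/
theorem IsFrameRep.exists_isFrameRep_of_u24Sum [Q.RankFinite] (hN : N.Finite)
    (h3 : N.IsKConnected 3) (hE : 4 ≤ N.E.ncard) (hL : L ⊆ N.E) (hL2 : 2 ≤ L.ncard)
    {φ : α ⊕ α × Fin 3 → β} (hR : (u24Sum N L).IsFrameRep Q B φ)
    (hB : B.ncard = (u24Sum N L).rk (u24Sum N L).E) :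
    ∃ (B' : Set β) (ψ : α → β), N.IsFrameRep Q B' ψ ∧ B'.ncard = N.rk N.E ∧ ∀ l ∈ L, ψ l ∈ B' := by
  classical
  have hMfin := u24Sum_finite hN hL
  have hLfin := hN.ground_finite.subset hL
  have hline := fun l (hl : l ∈ L) ↦ hR.exists_line_of_isKConnected hN h3 hE hL hL2 hB hl
  obtain ⟨l₀, hl₀⟩ : L.Nonempty := (ncard_pos hLfin).1 (by omega)
  have : Nonempty β := Exists.nonempty (hline l₀ hl₀)
  choose! a ha x hx hxa hF hF' hrest using hline
  set A := a '' L with hA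
  have hAB : A ⊆ B := image_subset_iff.2 ha
  -- The triangle at `m ≠ l` is part of the rest relative to `l`, so its line avoids `a l`. Hence
  -- the `a l` are distinct, and none of them is an `x m`.
  have hne : ∀ l ∈ L, ∀ m ∈ L, m ≠ l → a m ≠ a l ∧ x m ≠ a l := by
    intro l hl m hm hml
    have h1 : {a m, x m} ⊆ Q.closure (B \ {a l}) := (hF' m hm).trans
      (Q.closure_subset_closure_of_subset_closure ((image_mono (u24Lift_mono
        (singleton_subset_iff.2 (show m ∈ N.E \ {l} from ⟨hL hm, hml⟩)))).trans (hrest l hl)))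
    have h2 := (hR.indep.notMem_closure_sdiff_of_mem (ha l hl))
    exact ⟨fun h ↦ h2 (h ▸ h1 (.inl rfl)), fun h ↦ h2 (h ▸ h1 (.inr rfl))⟩
  have hxA : ∀ l ∈ L, x l ∉ A := by
    rintro l hl ⟨m, hm, hml⟩
    by_cases hlm : l = m
    · exact hxa l hl (by rw [← hml, hlm])
    · exact (hne m hm l hl hlm).2 hml.symm
  have hinj : InjOn a L := by
    intro l hl m hm hlm
    by_contra h
    exact (hne m hm l hl h).1 hlm
  set ψ : α → β := fun y ↦ if y ∈ L then x y else φ (Sum.inl y) with hψ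
  have hψL : ∀ l ∈ L, ψ l = x l := fun l hl ↦ by simp [hψ, hl]
  have hψL' : ∀ y, y ∉ L → ψ y = φ (Sum.inl y) := fun y hy ↦ by simp [hψ, hy]
  have hxB' : ∀ l ∈ L, x l ∈ B \ A := fun l hl ↦ ⟨hx l hl, hxA l hl⟩
  have hψcl : ψ '' N.E ⊆ Q.closure (B \ A) := by
    rintro _ ⟨y, hy, rfl⟩
    by_cases hyL : y ∈ L
    · rw [hψL y hyL]
      exact Q.mem_closure_of_mem' (hxB' y hyL) (hR.indep.subset_ground (hx y hyL))
    · rw [hψL' y hyL, show B \ A = ⋂₀ ((fun l ↦ B \ {a l}) '' L) by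
        ext b
        simp only [hA, mem_sdiff, mem_image, not_exists, not_and, sInter_image, mem_iInter,
          mem_singleton_iff]
        exact ⟨fun h l hl ↦ ⟨h.1, fun h' ↦ h.2 l hl h'.symm⟩,
          fun h ↦ ⟨(h l₀ hl₀).1, fun l hl h' ↦ (h l hl).2 h'.symm⟩⟩,
        hR.indep.closure_sInter_eq_biInter_closure_of_forall_subset
          (Set.Nonempty.image _ ⟨l₀, hl₀⟩) (by
            rintro _ ⟨l, -, rfl⟩
            exact sdiff_subset)]
      simp only [mem_image, iInter_exists, biInter_and', iInter_iInter_eq_right, mem_iInter]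
      intro l hl
      exact hrest l hl (mem_image_of_mem φ
        (inl_mem_u24Lift.2 ⟨⟨hy, hyL⟩, hy, fun h ↦ hyL (h ▸ hl)⟩))
  have hn1 := ncard_sdiff_add_ncard_of_subset hAB hR.indep.finite
  have hAc : A.ncard = L.ncard := hinj.ncard_image
  rw [hB, ← u24Lift_ground hL, rk_u24Lift hN hL subset_rfl, inter_eq_right.2 hL] at hn1
  refine ⟨B \ A, ψ, ⟨hR.indep.subset sdiff_subset, fun Z hZ ↦ ?_, ?_⟩, by omega,
    fun l hl ↦ hψL l hl ▸ hxB' l hl⟩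
  · have h1 := hR.rk_image _ (u24Lift_subset (Z := Z))
    rw [rk_u24Lift hN hL hZ] at h1
    have h2 : Q.rk (a '' (Z ∩ L)) = (Z ∩ L).ncard := by
      rw [(hR.indep.subset ((image_mono inter_subset_right).trans hAB)).rk_eq_ncard,
        (hinj.mono inter_subset_right).ncard_image]
    have h3 := rk_add_rk_le_of_subset_closure hR.indep (sdiff_subset : B \ A ⊆ B) hAB
      disjoint_sdiff_left ((image_mono hZ).trans hψcl)
      ((image_mono inter_subset_right).trans (Q.subset_closure A (hAB.trans hR.indep.subset_ground)))
      (X := ψ '' Z) (Y := a '' (Z ∩ L))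
    have h4 := Q.rk_union_le (ψ '' Z) (a '' (Z ∩ L))
    -- The lift of `Z` and the set `ψ '' Z ∪ a '' (Z ∩ L)` span each other, and the second is a
    -- union of skew parts. So the rank of `ψ '' Z` is that of the lift minus `|Z ∩ L|`.
    have hUE : ψ '' Z ∪ a '' (Z ∩ L) ⊆ Q.E :=
      union_subset (((image_mono hZ).trans hψcl).trans (Q.closure_subset_ground _))
        (((image_mono inter_subset_right).trans hAB).trans hR.indep.subset_ground)
    have h5 : Q.rk (φ '' u24Lift N L Z) ≤ Q.rk (ψ '' Z ∪ a '' (Z ∩ L)) := by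
      refine rk_le_of_subset_closure ?_
      rintro _ ⟨y | ⟨l, i⟩, hp, rfl⟩
      · obtain ⟨⟨-, hyL⟩, hyZ⟩ := inl_mem_u24Lift.1 hp
        exact Q.mem_closure_of_mem' (.inl ⟨y, hyZ, hψL' y hyL⟩) (hR.mem_ground hp.1)
      · obtain ⟨hlL, hlZ⟩ := inr_mem_u24Lift.1 hp
        refine Q.closure_subset_closure ?_ (hF l hlL (mem_image_of_mem φ ⟨hp.1, rfl⟩))
        exact pair_subset (.inr ⟨l, ⟨hlZ, hlL⟩, rfl⟩) (.inl ⟨l, hlZ, hψL l hlL⟩)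
    have h6 : Q.rk (ψ '' Z ∪ a '' (Z ∩ L)) ≤ Q.rk (φ '' u24Lift N L Z) := by
      have h7 : ∀ l ∈ Z ∩ L, {a l, x l} ⊆ Q.closure (φ '' u24Lift N L Z) := fun l hl ↦
        (hF' l hl.2).trans (Q.closure_subset_closure
          (image_mono (u24Lift_mono (singleton_subset_iff.2 hl.1))))
      refine rk_le_of_subset_closure (union_subset ?_ ?_)
      · rintro _ ⟨y, hy, rfl⟩
        by_cases hyL : y ∈ L
        · rw [hψL y hyL]
          exact h7 y ⟨hy, hyL⟩ (.inr rfl)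
        · rw [hψL' y hyL]
          have hp := inl_mem_u24Lift.2 ⟨⟨hZ hy, hyL⟩, hy⟩
          exact Q.mem_closure_of_mem' (mem_image_of_mem φ hp) (hR.mem_ground hp.1)
      · rintro _ ⟨l, hl, rfl⟩
        exact h7 l hl (.inl rfl)
    omega
  · rintro _ ⟨y, hy, rfl⟩
    by_cases hyL : y ∈ L
    · refine ⟨x y, hxB' y hyL, x y, hxB' y hyL, ?_⟩
      rw [hψL y hyL]
      exact Q.mem_closure_of_mem' (.inl rfl) (hR.indep.subset_ground (hx y hyL))
    · refine PairSpanned.of_subset (P := {ψ y}) (hR.pairSpanned.mono ?_) hR.indep sdiff_subset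
        ⟨_, hxB' l₀ hl₀⟩ ((singleton_subset_iff.2 (mem_image_of_mem ψ hy)).trans hψcl) _ rfl
      rw [hψL' y hyL]
      exact singleton_subset_iff.2 (mem_image_of_mem φ (inl_mem_u24Ground.2 ⟨hy, hyL⟩))

end JointRep

/-! ### Transporting the 2-sum along an embedding -/

section Transport

variable {α : Type u} {α' : Type v} {N : Matroid α} {N' : Matroid α'} {L : Set α} {h : α → α'}
  {J : Set (α ⊕ α × Fin 3)}

/-- The map between the ground sets of matroids `u24Sum` that is induced by a map `h`. -/
def u24Map (h : α → α') : α ⊕ α × Fin 3 → α' ⊕ α' × Fin 3 := Sum.map h (Prod.map h id)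

theorem u24Map_inl (a : α) : u24Map h (Sum.inl a) = Sum.inl (h a) := rfl

theorem u24Map_inr (a : α) (i : Fin 3) : u24Map h (Sum.inr (a, i)) = Sum.inr (h a, i) := rfl

theorem u24Map_injOn (hL : L ⊆ N.E) (hinj : InjOn h N.E) : InjOn (u24Map h) (u24Ground N L) := by
  rintro (a | ⟨a, i⟩) ha (b | ⟨b, j⟩) hb hab
  · rw [u24Map_inl, u24Map_inl, Sum.inl.injEq] at hab
    rw [hinj (inl_mem_u24Ground.1 ha).1 (inl_mem_u24Ground.1 hb).1 hab]
  · simp [u24Map_inl, u24Map_inr] at hab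
  · simp [u24Map_inl, u24Map_inr] at hab
  · rw [u24Map_inr, u24Map_inr, Sum.inr.injEq, Prod.mk.injEq] at hab
    rw [hinj (hL (inr_mem_u24Ground.1 ha)) (hL (inr_mem_u24Ground.1 hb)) hab.1, hab.2]

theorem u24Trace_subset (hL : L ⊆ N.E) (hJ : J ⊆ u24Ground N L) : u24Trace J ⊆ N.E := by
  rintro a (ha | ⟨i, hi, -⟩)
  · exact (inl_mem_u24Ground.1 (hJ ha)).1
  · exact hL (inr_mem_u24Ground.1 (hJ hi))

theorem u24Indep_iff_u24Indep_image (hL : L ⊆ N.E) (hinj : InjOn h N.E)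
    (hE : MapsTo h N.E N'.E) (hI : ∀ Z ⊆ N.E, N.Indep Z ↔ N'.Indep (h '' Z))
    (hJ : J ⊆ u24Ground N L) : u24Indep N L J ↔ u24Indep N' (h '' L) (u24Map h '' J) := by
  have hinl : ∀ {a}, a ∈ N.E → (Sum.inl (h a) ∈ u24Map h '' J ↔ Sum.inl a ∈ J) := by
    intro a ha
    constructor
    · rintro ⟨b | ⟨b, i⟩, hb, hba⟩
      · rw [u24Map_inl, Sum.inl.injEq] at hba
        rwa [← hinj (inl_mem_u24Ground.1 (hJ hb)).1 ha hba]
      · simp [u24Map_inr] at hba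
    · exact fun h' ↦ ⟨_, h', rfl⟩
  have hinr : ∀ {a i}, a ∈ N.E → (Sum.inr (h a, i) ∈ u24Map h '' J ↔ Sum.inr (a, i) ∈ J) := by
    intro a i ha
    constructor
    · rintro ⟨b | ⟨b, j⟩, hb, hba⟩
      · simp [u24Map_inl] at hba
      · rw [u24Map_inr, Sum.inr.injEq, Prod.mk.injEq] at hba
        rwa [← hinj (hL (inr_mem_u24Ground.1 (hJ hb))) ha hba.1, ← hba.2]
    · exact fun h' ↦ ⟨_, h', rfl⟩
  have hfib : ∀ {a}, a ∈ N.E → u24Fiber (u24Map h '' J) (h a) = u24Fiber J a := fun ha ↦ by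
    ext i
    exact hinr ha
  have hfib' : ∀ {c}, c ∉ h '' N.E → u24Fiber (u24Map h '' J) c = ∅ := by
    intro c hc
    refine eq_empty_of_forall_notMem ?_
    rintro i ⟨b | ⟨b, j⟩, hb, hba⟩
    · simp [u24Map_inl] at hba
    · rw [u24Map_inr, Sum.inr.injEq, Prod.mk.injEq] at hba
      exact hc ⟨b, hL (inr_mem_u24Ground.1 (hJ hb)), hba.1⟩
  have htr : u24Trace (u24Map h '' J) = h '' u24Trace J := by
    ext c
    constructor
    · rintro (⟨b | ⟨b, i⟩, hb, hbc⟩ | hc)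
      · rw [u24Map_inl, Sum.inl.injEq] at hbc
        exact ⟨b, .inl hb, hbc⟩
      · simp [u24Map_inr] at hbc
      · by_cases hcE : c ∈ h '' N.E
        · obtain ⟨a, ha, rfl⟩ := hcE
          rw [mem_ofPred_eq, hfib ha] at hc
          exact ⟨a, .inr hc, rfl⟩
        · rw [mem_ofPred_eq, hfib' hcE] at hc
          simp at hc
    · rintro ⟨a, ha, rfl⟩
      have haE := u24Trace_subset hL hJ ha
      rcases ha with ha | ha
      · exact .inl ((hinl haE).2 ha)
      · refine .inr ?_
        rw [mem_ofPred_eq, hfib haE]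
        exact ha
  have hgr : u24Map h '' J ⊆ u24Ground N' (h '' L) := by
    rintro _ ⟨a | ⟨a, i⟩, ha, rfl⟩
    · have h1 := inl_mem_u24Ground.1 (hJ ha)
      refine inl_mem_u24Ground.2 ⟨hE h1.1, ?_⟩
      rintro ⟨b, hb, hba⟩
      exact h1.2 (hinj (hL hb) h1.1 hba ▸ hb)
    · exact inr_mem_u24Ground.2 (mem_image_of_mem h (inr_mem_u24Ground.1 (hJ ha)))
  rw [u24Indep, u24Indep, htr, hI _ (u24Trace_subset hL hJ)]
  refine and_congr (iff_of_true hJ hgr) (and_congr_left fun _ ↦ ⟨fun h1 c ↦ ?_, fun h1 a ↦ ?_⟩)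
  · by_cases hcE : c ∈ h '' N.E
    · obtain ⟨a, ha, rfl⟩ := hcE
      rw [hfib ha]
      exact h1 a
    · rw [hfib' hcE]
      exact empty_ne_univ
  · by_cases ha : a ∈ N.E
    · rw [← hfib ha]
      exact h1 _
    · intro h2
      have : (0 : Fin 3) ∈ u24Fiber J a := h2 ▸ mem_univ _
      exact ha (hL (inr_mem_u24Ground.1 (hJ this)))

end Transport

/-! ### Attaching copies of `U_{2,4}` at frame elements gives a frame matroid -/

section Joint

variable {α : Type u} {β : Type v} {N : Matroid α} {Q : Matroid β} {B : Set β} {ψ : α → β}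
  {L : Set α} {S : Set α} {a b l : α} {i : Fin 3}

theorem IsFrameRep.indep_iff [Q.RankFinite] (hN : N.Finite) (hR : N.IsFrameRep Q B ψ) {I : Set α}
    (hI : I ⊆ N.E) : N.Indep I ↔ Q.Indep (ψ '' I) ∧ InjOn ψ I := by
  have hIf := hN.ground_finite.subset hI
  have h1 := hR.rk_image I hI
  constructor
  · intro h
    rw [h.rk_eq_ncard] at h1
    have h2 := Q.rk_le_ncard (hIf.image ψ)
    have h3 := ncard_image_le (f := ψ) hIf
    exact ⟨indep_of_ncard_le_rk (hIf.image ψ) (by omega),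
      injOn_of_ncard_image_eq (by omega) hIf⟩
  · rintro ⟨h, hinj⟩
    rw [h.rk_eq_ncard, hinj.ncard_image] at h1
    exact indep_of_ncard_le_rk hIf h1.le

theorem inl_mem_closure_u24Sum (hS : (u24Sum N L).Indep (Sum.inl '' S)) (haL : a ∉ L)
    (ha : a ∈ N.closure S) : Sum.inl a ∈ (u24Sum N L).closure (Sum.inl '' S) := by
  have htr : ∀ T : Set α, T ⊆ u24Trace (Sum.inl '' T) := fun T b hb ↦ .inl (mem_image_of_mem _ hb)
  have hSi : N.Indep S := hS.2.2.subset (htr S)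
  rw [hS.mem_closure_iff']
  refine ⟨inl_mem_u24Ground.2 ⟨mem_ground_of_mem_closure ha, haL⟩, fun h ↦ ?_⟩
  rw [← image_insert_eq] at h
  exact mem_image_of_mem _ ((hSi.mem_closure_iff'.1 ha).2 (h.2.2.subset (htr _)))

theorem inr_mem_closure_u24Sum (hl : l ∈ L) (hI : (u24Sum N L).Indep {Sum.inl b, Sum.inr (l, 0)})
    (hlb : ¬ N.Indep {l, b}) :
    Sum.inr (l, i) ∈ (u24Sum N L).closure {Sum.inl b, Sum.inr (l, 0)} := by
  rw [hI.mem_closure_iff']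
  refine ⟨inr_mem_u24Ground.2 hl, fun h ↦ ?_⟩
  by_contra hi
  have hi0 : i ≠ 0 := by
    rintro rfl
    simp at hi
  refine hlb (h.2.2.subset (pair_subset (.inr ⟨i, mem_insert _ _, 0, ?_, hi0⟩) (.inl ?_)))
  · exact .inr (.inr rfl)
  · exact .inr (.inl rfl)

/-- If all elements at which a copy of `U_{2,4}` is attached are represented in the frame, then
the 2-sum is a frame matroid. -/
theorem IsFrameRep.isFrame_u24Sum [Q.RankFinite] (hN : N.Finite) (hR : N.IsFrameRep Q B ψ)
    (hL : L ⊆ N.E) (hψ : ∀ l ∈ L, ψ l ∈ B) : (u24Sum N L).IsFrame := by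
  -- The map `ψ` need not be injective, and a frame element must survive the 2-sum performed at an
  -- element represented by it. The pullback along `g` contains both: `N` on the right, with each `l
  -- ∈ L` parallel to its frame element on the left.
  set g : β ⊕ α → β := Sum.elim id ψ with hg
  set Q₁ := Q.comap g with hQ₁
  have hgr : ∀ Z : Set α, g '' (Sum.inr '' Z) = ψ '' Z := fun Z ↦ by
    rw [image_image]; rfl
  have hgl : ∀ S : Set β, g '' (Sum.inl '' S) = S := fun S ↦ by
    rw [image_image]; exact image_id S
  have hN₁ : ∀ Z ⊆ N.E, N.Indep Z ↔ Q₁.Indep (Sum.inr '' Z) := by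
    intro Z hZ
    rw [hR.indep_iff hN hZ, comap_indep_iff, hgr]
    refine and_congr_right fun _ ↦ ⟨?_, fun h x hx y hy hxy ↦ ?_⟩
    · rintro h _ ⟨x, hx, rfl⟩ _ ⟨y, hy, rfl⟩ hxy
      rw [h hx hy hxy]
    · exact Sum.inr_injective (h (mem_image_of_mem _ hx) (mem_image_of_mem _ hy) hxy)
  have hE₁ : MapsTo Sum.inr N.E Q₁.E := fun x hx ↦ hR.mem_ground hx
  set L₁ : Set (β ⊕ α) := Sum.inr '' L with hL₁
  -- The new frame adds `(l, 0)` for every `l ∈ L`. The frame element `ψ l` is parallel to the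
  -- basepoint, so together with `(l, 0)` it spans the whole copy at `l`.
  set B₂ : Set ((β ⊕ α) ⊕ (β ⊕ α) × Fin 3) :=
    Sum.inl '' (Sum.inl '' B) ∪ (fun l ↦ Sum.inr (Sum.inr l, 0)) '' L with hB₂
  have hfib : ∀ f, u24Fiber B₂ f ⊆ {0} := by
    rintro f i (⟨x, -, hx⟩ | ⟨l, -, hl⟩)
    · simp at hx
    · simp only [Sum.inr.injEq, Prod.mk.injEq] at hl
      exact hl.2.symm
  have hB₁ : Q₁.Indep (Sum.inl '' B) := by
    rw [comap_indep_iff, hgl]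
    refine ⟨hR.indep, ?_⟩
    rintro _ ⟨x, -, rfl⟩ _ ⟨y, -, rfl⟩ hxy
    exact congrArg _ hxy
  have hB₂i : (u24Sum Q₁ L₁).Indep B₂ := by
    refine ⟨?_, fun f hf ↦ ?_, hB₁.subset ?_⟩
    · rintro _ (⟨_, ⟨x, hx, rfl⟩, rfl⟩ | ⟨l, hl, rfl⟩)
      · exact inl_mem_u24Ground.2 ⟨hB₁.subset_ground (mem_image_of_mem _ hx), by simp [hL₁]⟩
      · exact inr_mem_u24Ground.2 (mem_image_of_mem _ hl)
    · have := hfib f (hf ▸ mem_univ 1)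
      simp at this
    · rintro f ((⟨x, hx, hf⟩ | ⟨l, -, hl⟩) | hf)
      · exact Sum.inl_injective hf ▸ hx
      · simp at hl
      · exact (not_nontrivial_singleton (Set.Nontrivial.mono hf (hfib f))).elim
  refine isFrame_of_indep_iff (Q := u24Sum Q₁ L₁) (φ := u24Map Sum.inr) (u24Sum_finite hN hL) hB₂i
    (((hR.indep.finite.image _).image _).union ((hN.ground_finite.subset hL).image _))
    (fun I hI ↦ ?_) ?_
  · rw [u24Sum_indep_iff,
      u24Indep_iff_u24Indep_image hL Sum.inr_injective.injOn hE₁ hN₁ hI, u24Sum_indep_iff]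
    exact (and_iff_left ((u24Map_injOn hL Sum.inr_injective.injOn).mono hI)).symm
  · have hBm : ∀ {b}, b ∈ B → Sum.inl (Sum.inl b) ∈ B₂ := fun hb ↦
      .inl (mem_image_of_mem _ (mem_image_of_mem _ hb))
    rintro _ ⟨y | ⟨l, i⟩, hp, rfl⟩
    · obtain ⟨hy, hyL⟩ := inl_mem_u24Ground.1 hp
      obtain ⟨b, hb, c, hc, hbc⟩ := hR.pairSpanned _ (mem_image_of_mem ψ hy)
      refine ⟨_, hBm hb, _, hBm hc, ?_⟩
      have := inl_mem_closure_u24Sum (N := Q₁) (L := L₁) (S := {Sum.inl b, Sum.inl c})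
        (a := Sum.inr y) (hB₂i.subset ?_) (by simpa [hL₁] using hyL) ?_
      · rwa [image_pair] at this
      · rw [image_pair]
        exact pair_subset (hBm hb) (hBm hc)
      · rw [hQ₁, comap_closure_eq, image_pair]
        exact hbc
    · have hl := inr_mem_u24Ground.1 hp
      have hl₁ : Sum.inr (Sum.inr l, 0) ∈ B₂ := .inr (mem_image_of_mem _ hl)
      refine ⟨_, hBm (hψ l hl), _, hl₁, ?_⟩
      refine inr_mem_closure_u24Sum (mem_image_of_mem _ hl)
        (hB₂i.subset (pair_subset (hBm (hψ l hl)) hl₁)) fun h ↦ ?_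
      have := (comap_indep_iff.1 h).2 (mem_insert _ _) (mem_insert_of_mem _ rfl) rfl
      simp at this

end Joint

/-! ### Undoing one 2-sum by a proper minor -/

section Minors

variable {α : Type u} {γ : Type*} {δ : Type*} {β : Type*} {N : Matroid α} {M : Matroid γ}
  {M' : Matroid δ} {Q : Matroid β} {B : Set β} {φ : δ → β} {k : γ → δ} {L C S : Set α} {e : α}

theorem rk_image_of_indep_iff [M.RankFinite] [M'.RankFinite] (hk : InjOn k M.E)
    (hE : MapsTo k M.E M'.E) (hI : ∀ I ⊆ M.E, M.Indep I ↔ M'.Indep (k '' I)) {X : Set γ}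
    (hX : X ⊆ M.E) : M'.rk (k '' X) = M.rk X := by
  obtain ⟨I, hIX⟩ := M.exists_isBasis X
  have hIE := hIX.indep.subset_ground
  have h1 : M.rk X = I.ncard := by
    rw [← hIX.indep.rk_eq_ncard, rk_congr_closure hIX.closure_eq_closure]
  have h2 := (hI I hIE).1 hIX.indep
  rw [h1, ← (hk.mono hIE).ncard_image, ← h2.rk_eq_ncard]
  refine le_antisymm (rk_le_of_subset_closure ?_) (rk_mono _ (image_mono hIX.subset))
  rintro _ ⟨x, hx, rfl⟩
  rw [h2.mem_closure_iff']
  refine ⟨hE (hX hx), fun h ↦ ?_⟩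
  rw [← image_insert_eq, ← hI _ (insert_subset (hX hx) hIE)] at h
  exact mem_image_of_mem k (hIX.mem_of_insert_indep hx h)

theorem IsFrameRep.comp [M.RankFinite] [M'.RankFinite] (hR : M'.IsFrameRep Q B φ)
    (hk : InjOn k M.E) (hE : MapsTo k M.E M'.E)
    (hI : ∀ I ⊆ M.E, M.Indep I ↔ M'.Indep (k '' I)) : M.IsFrameRep Q B (φ ∘ k) where
  indep := hR.indep
  rk_image X hX := by
    rw [image_comp, hR.rk_image _ ((image_mono hX).trans hE.image_subset),
      rk_image_of_indep_iff hk hE hI hX]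
  pairSpanned := by
    rw [image_comp]
    exact hR.pairSpanned.mono (image_mono hE.image_subset)

theorem u24Sum_isNonloop (hN : ∀ x ∈ N.E, N.IsNonloop x) (hL : L ⊆ N.E) {p : α ⊕ α × Fin 3}
    (hp : p ∈ (u24Sum N L).E) : (u24Sum N L).IsNonloop p := by
  have hf : ∀ l, ¬ (u24Fiber {p} l).Nontrivial := by
    rintro l ⟨i, hi, j, hj, hij⟩
    have h1 : Sum.inr (l, i) = p := hi
    have h2 : Sum.inr (l, j) = p := hj
    rw [← h2] at h1
    exact hij (by simpa using h1)
  rw [← indep_singleton]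
  refine ⟨singleton_subset_iff.2 hp, fun l hl ↦ hf l ?_, ?_⟩
  · rw [hl]
    exact nontrivial_univ
  · have h1 : u24Trace {p} ⊆ N.E := u24Trace_subset hL (singleton_subset_iff.2 hp)
    obtain h0 | ⟨a, ha⟩ := (u24Trace {p}).eq_empty_or_nonempty
    · rw [h0]
      exact N.empty_indep
    · refine (hN a (h1 ha)).indep.subset fun b hb ↦ ?_
      have ha' : Sum.inl a = p := ha.resolve_right (hf a)
      have hb' : Sum.inl b = p := hb.resolve_right (hf b)
      exact Sum.inl_injective (hb'.trans ha'.symm)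

/-- Contracting one and deleting another element of a copy of `U_{2,4}` undoes the 2-sum. -/
theorem indep_contract_delete_u24Sum_iff (hN : ∀ x ∈ N.E, N.IsNonloop x) (hL : insert e L ⊆ N.E)
    (heL : e ∉ L) {k : α ⊕ α × Fin 3 → α ⊕ α × Fin 3} (hke : k (Sum.inl e) = Sum.inr (e, 2))
    (hk : ∀ p, p ≠ Sum.inl e → k p = p) {I : Set (α ⊕ α × Fin 3)} (hI : I ⊆ u24Ground N L) :
    (((u24Sum N (insert e L)) ／ {Sum.inr (e, 0)}) ＼ {Sum.inr (e, 1)}).Indep (k '' I) ↔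
      (u24Sum N L).Indep I := by
  have heN := hL (mem_insert e L)
  have he0 := u24Sum_isNonloop hN hL (p := Sum.inr (e, 0)) (inr_mem_u24Ground.2 (.inl rfl))
  have hinr : ∀ i, Sum.inr (e, i) ∉ I := fun i hi ↦ heL (inr_mem_u24Ground.1 (hI hi))
  have hmem : ∀ p, p ∈ k '' I ↔ (p ∈ I ∧ p ≠ Sum.inl e) ∨ (p = Sum.inr (e, 2) ∧ Sum.inl e ∈ I) := by
    intro p
    constructor
    · rintro ⟨q, hq, rfl⟩
      by_cases hqe : q = Sum.inl e
      · rw [hqe] at hq ⊢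
        exact .inr ⟨hke, hq⟩
      · rw [hk q hqe]
        exact .inl ⟨hq, hqe⟩
    · rintro (⟨hp, hpe⟩ | ⟨rfl, he⟩)
      · exact ⟨p, hp, hk p hpe⟩
      · exact ⟨_, he, hke⟩
  have hK : insert (Sum.inr (e, 0)) (k '' I) ⊆ u24Ground N (insert e L) := by
    refine insert_subset (inr_mem_u24Ground.2 (.inl rfl)) fun p hp ↦ ?_
    obtain ⟨hp, hpe⟩ | ⟨rfl, -⟩ := (hmem p).1 hp
    · obtain a | ⟨l, i⟩ := p
      · have h1 := inl_mem_u24Ground.1 (hI hp)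
        refine inl_mem_u24Ground.2 ⟨h1.1, ?_⟩
        rintro (rfl | h2)
        · exact hpe rfl
        · exact h1.2 h2
      · exact inr_mem_u24Ground.2 (.inr (inr_mem_u24Ground.1 (hI hp)))
    · exact inr_mem_u24Ground.2 (.inl rfl)
  have hfib : ∀ i, i ∈ u24Fiber (insert (Sum.inr (e, 0)) (k '' I)) e ↔
      i = 0 ∨ i = 2 ∧ Sum.inl e ∈ I := by
    intro i
    simp [u24Fiber, hmem, hinr]
  have hnt : (u24Fiber (insert (Sum.inr (e, 0)) (k '' I)) e).Nontrivial ↔ Sum.inl e ∈ I := by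
    constructor
    · rintro ⟨i, hi, j, hj, hij⟩
      rw [hfib] at hi hj
      by_contra h
      exact hij ((hi.resolve_right fun h' ↦ h h'.2).trans (hj.resolve_right fun h' ↦ h h'.2).symm)
    · exact fun h ↦ ⟨0, (hfib 0).2 (.inl rfl), 2, (hfib 2).2 (.inr ⟨rfl, h⟩), by simp⟩
  -- With `(e, 0)` contracted and `(e, 1)` deleted, `(e, 2)` plays the part of `e`: the copy spans
  -- its basepoint exactly when `(e, 2)` is present.
  have hset : insert (Sum.inr (e, 0)) (k '' I) \ range (fun i ↦ Sum.inr (e, i)) ∪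
      {x | x = Sum.inl e ∧ (u24Fiber (insert (Sum.inr (e, 0)) (k '' I)) e).Nontrivial} = I := by
    ext p
    simp only [hnt, mem_union, mem_sdiff, mem_insert_iff, hmem, mem_range, not_exists,
      mem_ofPred_eq]
    constructor
    · rintro (⟨rfl | h | ⟨rfl, -⟩, h2⟩ | ⟨rfl, h⟩)
      · exact (h2 0 rfl).elim
      · exact h.1
      · exact (h2 2 rfl).elim
      · exact h
    · intro hp
      by_cases hpe : p = Sum.inl e
      · exact .inr ⟨hpe, hpe ▸ hp⟩
      · exact .inl ⟨.inr (.inl ⟨hp, hpe⟩), fun i hi ↦ hinr i (hi ▸ hp)⟩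
  rw [delete_indep_iff, he0.contractElem_indep_iff, u24Sum_insert_indep_iff heN heL hK, hset]
  constructor
  · exact fun h ↦ h.1.2.2
  · refine fun h ↦ ⟨⟨?_, fun h1 ↦ ?_, h⟩, ?_⟩
    · simp [hmem, hinr]
    · have := (hfib 1).1 (h1 ▸ mem_univ _)
      simp at this
    · simp [hmem, hinr]

/-- Minimality enters here: the 2-sum at all of `L \ {e}` is, up to renaming `e`, a proper minor,
hence frame. -/
theorem exists_isFrameRep_of_isStrictMinor_isFrame (hN : N.Finite)
    (hnl : ∀ x ∈ N.E, N.IsNonloop x) (hL : L ⊆ N.E) (he : e ∈ L)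
    (hM : ∀ M', M' <m u24Sum N L → M'.IsFrame) :
    ∃ (Q : Matroid ((α ⊕ α × Fin 3) ⊕ ℕ)) (B : Set ((α ⊕ α × Fin 3) ⊕ ℕ))
      (φ : α ⊕ α × Fin 3 → (α ⊕ α × Fin 3) ⊕ ℕ), Q.RankFinite ∧
      (u24Sum N (L \ {e})).IsFrameRep Q B φ ∧
      B.ncard = (u24Sum N (L \ {e})).rk (u24Sum N (L \ {e})).E := by
  classical
  have hins : insert e (L \ {e}) = L := by simp [he]
  have heL : e ∉ L \ {e} := fun h ↦ h.2 rfl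
  have hL' : L \ {e} ⊆ N.E := sdiff_subset.trans hL
  have hfin := u24Sum_finite hN hL
  have hfin' := u24Sum_finite hN hL'
  set M' := ((u24Sum N L) ／ {Sum.inr (e, 0)}) ＼ {Sum.inr (e, 1)} with hM'
  have hM'E : M'.E = (u24Sum N L).E \ {Sum.inr (e, 0), Sum.inr (e, 1)} := by
    rw [hM', delete_ground, contract_ground, sdiff_sdiff, singleton_union]
  have h0 : Sum.inr (e, 0) ∈ (u24Sum N L).E := inr_mem_u24Ground.2 he
  have hstrict : M' <m u24Sum N L := by
    refine ⟨contract_delete_isMinor _ _ _, fun h ↦ ?_⟩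
    have := h.subset h0
    rw [hM'E] at this
    exact this.2 (.inl rfl)
  set k : α ⊕ α × Fin 3 → α ⊕ α × Fin 3 := fun p ↦ if p = Sum.inl e then Sum.inr (e, 2) else p
    with hkdef
  have hke : k (Sum.inl e) = Sum.inr (e, 2) := by simp [hkdef]
  have hk : ∀ p, p ≠ Sum.inl e → k p = p := fun p hp ↦ by simp [hkdef, hp]
  have hinr : ∀ i, Sum.inr (e, i) ∉ u24Ground N (L \ {e}) := fun i hi ↦
    heL (inr_mem_u24Ground.1 hi)
  have hinj : InjOn k (u24Ground N (L \ {e})) := by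
    intro p hp q hq hpq
    by_cases hpe : p = Sum.inl e <;> by_cases hqe : q = Sum.inl e
    · rw [hpe, hqe]
    · rw [hpe, hke, hk q hqe] at hpq
      exact (hinr 2 (hpq ▸ hq)).elim
    · rw [hqe, hke, hk p hpe] at hpq
      exact (hinr 2 (hpq ▸ hp)).elim
    · rwa [hk p hpe, hk q hqe] at hpq
  have hmaps : k '' u24Ground N (L \ {e}) = M'.E := by
    rw [hM'E]
    apply subset_antisymm
    · rintro _ ⟨p, hp, rfl⟩
      by_cases hpe : p = Sum.inl e
      · rw [hpe, hke]
        exact ⟨inr_mem_u24Ground.2 he, by simp⟩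
      · rw [hk p hpe]
        refine ⟨?_, ?_⟩
        · obtain a | ⟨l, i⟩ := p
          · have h1 := inl_mem_u24Ground.1 hp
            exact inl_mem_u24Ground.2 ⟨h1.1, fun h ↦ h1.2 ⟨h, fun h' ↦ hpe (by rw [h'])⟩⟩
          · exact inr_mem_u24Ground.2 (inr_mem_u24Ground.1 hp).1
        · rintro (rfl | rfl)
          exacts [hinr 0 hp, hinr 1 hp]
    · rintro (a | ⟨l, i⟩) ⟨hp, hp'⟩
      · have h1 := inl_mem_u24Ground.1 hp
        have hae : Sum.inl a ≠ (Sum.inl e : α ⊕ α × Fin 3) := by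
          rintro h
          exact h1.2 (Sum.inl_injective h ▸ he)
        exact ⟨_, inl_mem_u24Ground.2 ⟨h1.1, fun h ↦ h1.2 h.1⟩, hk _ hae⟩
      · by_cases hle : l = e
        · subst hle
          refine ⟨Sum.inl l, inl_mem_u24Ground.2 ⟨hL he, heL⟩, ?_⟩
          rw [hke]
          simp only [mem_insert_iff, Sum.inr.injEq, Prod.mk.injEq, true_and,
            mem_singleton_iff] at hp' ⊢
          omega
        · exact ⟨_, inr_mem_u24Ground.2 ⟨inr_mem_u24Ground.1 hp, hle⟩, hk _ (by simp)⟩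
  have hI : ∀ I ⊆ (u24Sum N (L \ {e})).E, (u24Sum N (L \ {e})).Indep I ↔ M'.Indep (k '' I) := by
    intro I hI
    have := indep_contract_delete_u24Sum_iff hnl (hins.symm ▸ hL) heL hke hk hI
    rw [hins] at this
    exact this.symm
  have hM'fin : M'.Finite := by rw [hM']; infer_instance
  have hM'nl : ∀ x ∈ M'.E, M'.IsNonloop x := by
    intro x hx
    rw [← hmaps] at hx
    obtain ⟨p, hp, rfl⟩ := hx
    rw [← indep_singleton, ← image_singleton, ← hI _ (singleton_subset_iff.2 hp), indep_singleton]
    exact u24Sum_isNonloop hnl hL' hp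
  obtain ⟨Q, B, hQ, hR, hB⟩ := (hM M' hstrict).exists_isFrameRep hM'nl
  have hmt : MapsTo k (u24Sum N (L \ {e})).E M'.E := mapsTo_iff_image_subset.2 hmaps.subset
  refine ⟨Q, B, Sum.inl ∘ k, hQ, hR.comp hinj hmt hI, ?_⟩
  rw [hB, ← hmaps]
  exact rk_image_of_indep_iff hinj hmt hI subset_rfl

end Minors

/-! ### Two frame lines that coincide after a contraction -/

section Linking

variable {β : Type*} {Q : Matroid β} {B P : Set β} {x y a b u v e : β}

/-- Modulo `P`, if `e` were spanned by `y`, then so would be `u`, which lies on the line of `e` and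
`v`. But `u` is parallel to `x`, and `x` is not spanned by `y`. -/
theorem notMem_closure_insert_of_parallel (hu : u ∈ Q.closure (insert x P)) (huP : u ∉ Q.closure P)
    (hv : v ∈ Q.closure (insert y P)) (hPE : P ⊆ Q.E) (hyE : y ∈ Q.E)
    (hxy : x ∉ Q.closure (insert y P)) (he : e ∈ Q.closure {u, v}) (hev : e ∉ Q.closure {v}) :
    e ∉ Q.closure (insert y P) := by
  intro hey
  have h1 := mem_closure_pair_swap he hev
  have h2 : u ∈ Q.closure (insert y P) :=
    Q.closure_subset_closure_of_subset_closure (pair_subset hey hv) h1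
  have h3 := mem_closure_insert_swap hu huP
  refine hxy (Q.closure_subset_closure_of_subset_closure (insert_subset h2 ?_) h3)
  exact (subset_insert _ _).trans (Q.subset_closure _ (insert_subset hyE hPE))

/-- The rank inequality says that modulo `P` the pairs `{x, y}` and `{u, v}` both have rank two and
span the same line. Distinct parallel classes of `B` are independent modulo `P`, so `x` and `y` are
parallel to `u` and `v` in some order. Being properly between `u` and `v`, `e` is then properly
between `x` and `y`. -/
theorem PairSpanned.mem_closure_and_notMem_closure [Q.RankFinite] (hB : Q.Indep B)
    (hP : Q.PairSpanned B P) (hx : x ∈ B) (hy : y ∈ B) (hu : u ∈ B) (hv : v ∈ B)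
    (hr : Q.rk P + Q.rk (P ∪ {x, y} ∪ {u, v}) + 2 ≤ Q.rk (P ∪ {x, y}) + Q.rk (P ∪ {u, v}))
    (he : e ∈ Q.closure {u, v}) (heu : e ∉ Q.closure {u}) (hev : e ∉ Q.closure {v}) :
    e ∈ Q.closure (P ∪ {x, y}) ∧ e ∉ Q.closure (insert x P) ∧ e ∉ Q.closure (insert y P) := by
  have hBE := hB.subset_ground
  have hPE : P ⊆ Q.E := hP.subset_closure.trans (Q.closure_subset_ground _)
  have hpair : ∀ {a b : β}, P ∪ {a, b} = insert a (insert b P) := by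
    intro a b
    ext z
    simp only [mem_union, mem_insert_iff, mem_singleton_iff]
    tauto
  have hsep : ∀ {a b}, a ∈ B → b ∈ B → Q.rk P + 2 ≤ Q.rk (P ∪ {a, b}) →
      a ∉ Q.closure P ∧ b ∉ Q.closure (insert a P) := by
    intro a b ha hb hab
    have h1 := Q.rk_insert_le b P
    have h2 := Q.rk_insert_le a P
    rw [hpair] at hab
    constructor
    · intro h
      have := rk_insert_of_mem_closure (Q.closure_subset_closure (subset_insert b P) h)
      omega
    · intro h
      have := rk_insert_of_mem_closure h
      rw [insert_comm] at this
      omega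
  have m1 : Q.rk (P ∪ {u, v}) ≤ Q.rk (P ∪ {x, y} ∪ {u, v}) :=
    rk_mono _ (union_subset_union_left _ subset_union_left)
  have m2 : Q.rk (P ∪ {x, y}) ≤ Q.rk (P ∪ {x, y} ∪ {u, v}) := rk_mono _ subset_union_left
  have hub : ∀ a b, Q.rk (P ∪ {a, b}) ≤ Q.rk P + 2 := by
    intro a b
    have h1 := Q.rk_insert_le b P
    have h2 := Q.rk_insert_le a (insert b P)
    rw [hpair]
    omega
  have m3 := hub x y
  have m4 := hub u v
  obtain ⟨hxP, hyx⟩ := hsep hx hy (by omega)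
  obtain ⟨hyP, hxy⟩ := hsep hy hx (by rw [pair_comm]; omega)
  obtain ⟨huP, hvu⟩ := hsep hu hv (by omega)
  obtain ⟨hvP, huv⟩ := hsep hv hu (by rw [pair_comm]; omega)
  have hE : P ∪ {x, y} ∪ {u, v} ⊆ Q.E := union_subset
    (union_subset hPE (pair_subset (hBE hx) (hBE hy))) (pair_subset (hBE hu) (hBE hv))
  have s1 := subset_closure_of_rk_le subset_union_left hE (by omega)
  have s2 := subset_closure_of_rk_le (X := P ∪ {u, v})
    (union_subset_union_left _ subset_union_left) hE (by omega)
  have key : ∀ {a}, a ∈ B → a ∉ Q.closure P → a ∈ Q.closure (P ∪ {u, v}) →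
      u ∈ Q.parallelClass B P a ∨ v ∈ Q.parallelClass B P a := by
    intro a ha haP hauv
    by_contra! hc
    refine hP.notMem_closure_union hB ha haP (Q.closure_subset_closure ?_ hauv)
    exact union_subset_union_right _ (pair_subset ⟨hu, hc.1⟩ ⟨hv, hc.2⟩)
  have kx := key hx hxP (s2 (.inl (.inr (.inl rfl))))
  have ky := key hy hyP (s2 (.inl (.inr (.inr rfl))))
  have hdisj : ∀ {w}, w ∈ Q.parallelClass B P x → w ∉ Q.parallelClass B P y := by
    rintro w ⟨-, h1, h2⟩ ⟨-, h3, -⟩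
    refine hxy (Q.closure_subset_closure_of_subset_closure (insert_subset h3 ?_)
      (mem_closure_insert_swap h1 h2))
    exact (subset_insert _ _).trans (Q.subset_closure _ (insert_subset (hBE hy) hPE))
  refine ⟨Q.closure_subset_closure_of_subset_closure
    (subset_union_right.trans s1) he, ?_⟩
  rcases kx with hux | hvx
  · have hvy := ky.resolve_left (hdisj hux)
    exact ⟨notMem_closure_insert_of_parallel hvy.2.1 hvP hux.2.1 hPE (hBE hx) hyx
        (pair_comm u v ▸ he) heu,
      notMem_closure_insert_of_parallel hux.2.1 huP hvy.2.1 hPE (hBE hy) hxy he hev⟩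
  · have huy := ky.resolve_right (hdisj hvx)
    exact ⟨notMem_closure_insert_of_parallel huy.2.1 huP hvx.2.1 hPE (hBE hx) hyx he hev,
      notMem_closure_insert_of_parallel hvx.2.1 hvP huy.2.1 hPE (hBE hy) hxy
        (pair_comm u v ▸ he) heu⟩

end Linking

/-! ### A circuit through three elements of `L`, and the resulting `N₉`-minor -/

section Circuit

variable {α : Type u} {β : Type*} {N : Matroid α} {Q : Matroid β} {B : Set β} {ψ : α → β}
  {e f g : α}

/-- Linking `{f, g}` to the frame line `{u, v}` of `e` gives `P` modulo which `e` is on the line of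
`f` and `g` but parallel to neither. A circuit witnessing this inside `P ∪ {e, f, g}` cannot omit
`f` or `g`. -/
theorem IsFrameRep.exists_isCircuit [Q.RankFinite] (hN : N.Finite) (h3 : N.IsKConnected 3)
    (hE : 4 ≤ N.E.ncard) (hR : N.IsFrameRep Q B ψ) (hB : B.ncard = N.rk N.E) (he : e ∈ N.E)
    (hf : f ∈ N.E) (hg : g ∈ N.E) (hfg : f ≠ g) (hψf : ψ f ∈ B) (hψg : ψ g ∈ B)
    (hψe : ∀ b ∈ B, ψ e ∉ Q.closure {b}) : ∃ C, N.IsCircuit C ∧ e ∈ C ∧ f ∈ C ∧ g ∈ C := by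
  have hEf := hN.ground_finite
  obtain ⟨u, hu, v, hv, heuv⟩ := hR.pairSpanned _ (mem_image_of_mem ψ he)
  have hclB := hR.pairSpanned.subset_closure
  have hne : ∀ {a}, ψ a ∈ B → a ≠ e := by
    rintro a ha rfl
    exact hψe _ ha (Q.mem_closure_of_mem' rfl (hR.indep.subset_ground ha))
  have hfe := hne hψf
  have hge := hne hψg
  have huv : u ≠ v := by
    rintro rfl
    exact hψe u hu (by simpa using heuv)
  set D := N.E \ {e, f, g} with hD
  have hDE : D ⊆ N.E := sdiff_subset
  have hruv : Q.rk {u, v} = 2 := by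
    rw [(hR.indep.subset (pair_subset hu hv)).rk_eq_ncard, ncard_pair huv]
  -- The linking hypothesis with `k = 2`. A cut corresponds to a bipartition of `N.E` with `f, g` on
  -- one side and `e` on the other, where `e` is spanned by `{u, v}`.
  have hcut : ∀ A ⊆ ψ '' D, Q.rk ({ψ f, ψ g} ∪ {u, v} ∪ ψ '' D ∪ ∅) + Q.rk ∅ + 2 ≤
      Q.rk ({ψ f, ψ g} ∪ A ∪ ∅) + Q.rk ({u, v} ∪ ψ '' D \ A ∪ ∅) := by
    intro A hA
    rw [union_empty, union_empty, union_empty, rk_empty]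
    have h1 : Q.rk ({ψ f, ψ g} ∪ {u, v} ∪ ψ '' D) ≤ N.rk N.E := by
      rw [← hB, ← hR.indep.rk_eq_ncard]
      refine rk_le_of_subset_closure (union_subset (union_subset ?_ ?_)
        ((image_mono hDE).trans hclB))
      · exact pair_subset (hclB (mem_image_of_mem _ hf)) (hclB (mem_image_of_mem _ hg))
      · exact (pair_subset hu hv).trans (Q.subset_closure _ hR.indep.subset_ground)
    set Z := {z ∈ D | ψ z ∈ A} with hZ
    have hZA : ψ '' Z = A := by
      ext b
      constructor
      · rintro ⟨z, hz, rfl⟩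
        exact hz.2
      · intro hb
        obtain ⟨z, hz, rfl⟩ := hA hb
        exact ⟨z, ⟨hz, hb⟩, rfl⟩
    have hZW : ψ '' (D \ Z) ⊆ ψ '' D \ A := by
      rintro _ ⟨z, hz, rfl⟩
      exact ⟨mem_image_of_mem ψ hz.1, fun h ↦ hz.2 ⟨hz.1, h⟩⟩
    set X := {f, g} ∪ Z with hX
    have hXE : X ⊆ N.E := union_subset (pair_subset hf hg) fun z hz ↦ hz.1.1
    have heX : e ∉ X := by
      rintro ((rfl | rfl) | h)
      · exact hfe rfl
      · exact hge rfl
      · exact h.1.2 (.inl rfl)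
    have hXc : N.E \ X = insert e (D \ Z) := by
      ext z
      by_cases hz : z = e
      · simp [hz, he, heX]
      · simp only [hX, hD, mem_sdiff, mem_union, mem_insert_iff, mem_singleton_iff, hz, false_or]
        tauto
    have h2 : Q.rk ({ψ f, ψ g} ∪ A) = N.rk X := by
      rw [← hR.rk_image X hXE, hX, image_union, image_pair, hZA]
    have h3' : N.rk (N.E \ X) ≤ Q.rk ({u, v} ∪ ψ '' D \ A) := by
      rw [← hR.rk_image _ sdiff_subset, hXc, image_insert_eq]
      refine rk_le_of_subset_closure (insert_subset ?_ (hZW.trans (subset_union_right.trans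
        (Q.subset_closure _ ?_))))
      · exact Q.closure_subset_closure subset_union_left heuv
      · refine union_subset ((pair_subset hu hv).trans hR.indep.subset_ground) ?_
        rintro _ ⟨⟨z, hz, rfl⟩, -⟩
        exact hR.mem_ground (hDE hz)
    have h4 : 2 ≤ Q.rk ({u, v} ∪ ψ '' D \ A) := by
      rw [← hruv]
      exact rk_mono _ subset_union_left
    have hXn : 2 ≤ X.ncard := by
      rw [← ncard_pair hfg]
      exact ncard_le_ncard subset_union_left (hEf.subset hXE)
    -- If the side of `e` is `{e}` alone, the other side already has full rank and `{u, v}`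
    -- contributes 2. Otherwise both sides have at least two elements and 3-connectivity applies.
    obtain h0 | hne' := (D \ Z).eq_empty_or_nonempty
    · have h5 : X = N.E \ {e} := by
        rw [← sdiff_sdiff_cancel_left hXE, hXc, h0, insert_empty_eq]
      rw [h5, h3.rk_sdiff_singleton hN hE he] at h2
      omega
    · have h5 : 1 < (N.E \ X).ncard := by
        rw [hXc, one_lt_ncard (hEf.sdiff.sdiff.insert _)]
        obtain ⟨z, hz⟩ := hne'
        exact ⟨e, .inl rfl, z, .inr hz, fun h ↦ hz.1.2 (.inl h.symm)⟩
      by_contra! hc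
      have := h3.ncard_le_one_or_ncard_le_one hN hXE (by omega)
      omega
  obtain ⟨P, hPD, hP⟩ := Q.exists_linking {ψ f, ψ g} {u, v} 2 ((hEf.subset hDE).image ψ) ∅ hcut
  simp only [union_empty] at hP
  have hPp : Q.PairSpanned B P := hR.pairSpanned.mono (hPD.trans (image_mono hDE))
  obtain ⟨c1, c2, c3⟩ := hPp.mem_closure_and_notMem_closure hR.indep hψf hψg hu hv hP heuv
    (hψe u hu) (hψe v hv)
  obtain ⟨P', hP', rfl⟩ := subset_image_iff.1 hPD
  have hP'E := hP'.trans hDE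
  rw [← image_pair, ← image_union, hR.mem_closure_image_iff he
    (union_subset hP'E (pair_subset hf hg))] at c1
  rw [← image_insert_eq, hR.mem_closure_image_iff he (insert_subset hf hP'E)] at c2
  rw [← image_insert_eq, hR.mem_closure_image_iff he (insert_subset hg hP'E)] at c3
  have heP : e ∉ P' ∪ {f, g} := by
    rintro (h | h | h)
    · exact (hP' h).2 (.inl rfl)
    · exact hfe h.symm
    · exact hge h.symm
  obtain ⟨C, hCs, hC, heC⟩ := exists_isCircuit_of_mem_closure c1 heP
  have hcl := hC.mem_closure_sdiff_singleton_of_mem heC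
  refine ⟨C, hC, heC, ?_, ?_⟩
  · by_contra hfC
    refine c3 (N.closure_subset_closure ?_ hcl)
    rintro z ⟨hz, hze⟩
    obtain rfl | h | rfl | rfl := hCs hz
    · exact (hze rfl).elim
    · exact .inr h
    · exact (hfC hz).elim
    · exact .inl rfl
  · by_contra hgC
    refine c2 (N.closure_subset_closure ?_ hcl)
    rintro z ⟨hz, hze⟩
    obtain rfl | h | rfl | rfl := hCs hz
    · exact (hze rfl).elim
    · exact .inr h
    · exact .inl rfl
    · exact (hgC hz).elim

/-- Contracting all but three elements of a circuit, with the attached copies of `U_{2,4}`. -/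
theorem u24Sum_uniformOn_isStrictMinor {L C S : Set α} (hL : L ⊆ N.E) (hC : N.IsCircuit C)
    (hSC : S ⊆ C) (hSL : S ⊆ L) (hS : S.ncard = 3) (hNS : S ≠ N.E) :
    u24Sum (uniformOn 2 S) S <m u24Sum N L := by
  have hSf : S.Finite := finite_of_ncard_ne_zero (by omega)
  -- The set to be contracted. Two elements of each copy over `C \ S` suffice to span its basepoint;
  -- leaving out `(l, 2)` keeps `X` independent, with trace `C \ S`.
  set X : Set (α ⊕ α × Fin 3) := {p ∈ u24Lift N L (C \ S) | ∀ l, p ≠ Sum.inr (l, 2)} with hX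
  set R : Set (α ⊕ α × Fin 3) := Sum.inr '' (S ×ˢ univ) with hR
  have hRinl : ∀ a, Sum.inl a ∉ R := by simp [hR]
  have hRinr : ∀ {l i}, Sum.inr (l, i) ∈ R ↔ l ∈ S := by simp [hR]
  have hRM : R ⊆ (u24Sum N L).E := by
    rintro _ ⟨⟨l, i⟩, hl, rfl⟩
    exact inr_mem_u24Ground.2 (hSL hl.1)
  have hXS : ∀ {l i}, Sum.inr (l, i) ∈ X → l ∉ S := fun h ↦ (inr_mem_u24Lift.1 h.1).2.2
  have hX2 : ∀ {l}, Sum.inr (l, 2) ∉ X := fun h ↦ h.2 _ rfl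
  have hRX : Disjoint R X := by
    rw [disjoint_left]
    rintro _ ⟨⟨l, i⟩, hl, rfl⟩ h
    exact hXS h hl.1
  have hfib : ∀ {I}, I ⊆ R → ∀ l, u24Fiber (I ∪ X) l ≠ univ ↔ u24Fiber I l ≠ univ := by
    intro I hI l
    by_cases hl : l ∈ S
    · have : u24Fiber (I ∪ X) l = u24Fiber I l := by
        ext i
        exact or_iff_left fun h ↦ hXS h hl
      rw [this]
    · have h1 : ∀ i, i ∉ u24Fiber I l := fun i hi ↦ hl (hRinr.1 (hI hi))
      refine iff_of_true (fun h ↦ ?_) fun h ↦ h1 0 (h ▸ mem_univ _)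
      have : (2 : Fin 3) ∈ u24Fiber (I ∪ X) l := h ▸ mem_univ _
      exact this.elim (h1 2) hX2
  have htrX : u24Trace X = C \ S := by
    ext a
    constructor
    · rintro (ha | ⟨i, hi, -⟩)
      · exact (inl_mem_u24Lift.1 ha.1).2
      · exact (inr_mem_u24Lift.1 hi.1).2
    · intro ha
      by_cases haL : a ∈ L
      · have h1 : ∀ i, i ≠ 2 → Sum.inr (a, i) ∈ X := fun i hi ↦
          ⟨inr_mem_u24Lift.2 ⟨haL, ha⟩, fun l h ↦ hi (by simpa using congrArg (Sum.elim (fun _ ↦ 2) Prod.snd) h)⟩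
        exact .inr ⟨0, h1 0 (by simp), 1, h1 1 (by simp), by simp⟩
      · exact .inl ⟨inl_mem_u24Lift.2 ⟨⟨hC.subset_ground ha.1, haL⟩, ha⟩, by simp⟩
  have htr : ∀ {I}, I ⊆ R → u24Trace (I ∪ X) = u24Trace I ∪ C \ S := by
    intro I hI
    rw [← htrX]
    apply subset_antisymm
    · rintro a (ha | ha)
      · exact ha.imp .inl .inl
      · by_cases haS : a ∈ S
        · refine .inl (.inr ?_)
          obtain ⟨i, hi, j, hj, hij⟩ := ha
          exact ⟨i, hi.resolve_right fun h ↦ hXS h haS, j,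
            hj.resolve_right fun h ↦ hXS h haS, hij⟩
        · obtain ⟨i, hi, j, hj, hij⟩ := ha
          exact .inr (.inr ⟨i, hi.resolve_left fun h ↦ haS (hRinr.1 (hI h)), j,
            hj.resolve_left fun h ↦ haS (hRinr.1 (hI h)), hij⟩)
    · exact union_subset (u24Trace_mono subset_union_left) (u24Trace_mono subset_union_right)
  have hXM : X ⊆ (u24Sum N L).E := fun p hp ↦ hp.1.1
  -- Contracting all but three elements of a circuit leaves `U_{2,3}` on those three.
  have hsp : ∀ {T}, T ⊆ S → (N.Indep (T ∪ C \ S) ↔ T.encard ≤ 2) := by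
    intro T hT
    rw [← (hSf.subset hT).cast_ncard_eq]
    constructor
    · intro h
      by_contra! hc
      have h3 : 3 ≤ T.ncard := by exact_mod_cast Order.add_one_le_of_lt hc
      rw [Set.eq_of_subset_of_ncard_le hT (by omega) hSf, union_sdiff_cancel hSC] at h
      exact hC.not_indep h
    · intro h
      refine hC.ssubset_indep ⟨union_subset (hT.trans hSC) sdiff_subset, fun hc ↦ ?_⟩
      have h4 : S ⊆ T := fun s hs ↦ (hc (hSC hs)).resolve_right fun h ↦ h.2 hs
      have h5 := ncard_le_ncard h4 (hSf.subset hT)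
      have h6 : T.ncard ≤ 2 := by exact_mod_cast h
      omega
  have hXi : (u24Sum N L).Indep X := by
    refine ⟨hXM, fun l h ↦ hX2 (show 2 ∈ u24Fiber X l from h ▸ mem_univ _), ?_⟩
    have := (hsp (empty_subset S)).2 (by simp)
    rwa [empty_union, ← htrX] at this
  have hgr : u24Ground (uniformOn 2 S) S = R := by
    ext (a | ⟨l, i⟩)
    · rw [inl_mem_u24Ground]
      exact iff_of_false (fun h ↦ h.2 h.1) (hRinl a)
    · rw [inr_mem_u24Ground, hRinr]
  have hRc : R ⊆ (u24Sum N L ／ X).E := by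
    rw [contract_ground]
    exact subset_sdiff.2 ⟨hRM, hRX⟩
  have heq : u24Sum (uniformOn 2 S) S = (u24Sum N L ／ X) ↾ R := by
    refine ext_indep hgr fun I hI ↦ ?_
    rw [u24Sum_ground, hgr] at hI
    have hTS : u24Trace I ⊆ S := by
      rintro a (ha | ⟨i, hi, -⟩)
      · exact (hRinl a (hI ha)).elim
      · exact hRinr.1 (hI hi)
    rw [restrict_indep_iff, hXi.contract_indep_iff, u24Sum_indep_iff, u24Sum_indep_iff, u24Indep,
      u24Indep, htr hI, hgr, hsp hTS]
    have h1 : (uniformOn 2 S).Indep (u24Trace I) ↔ u24Trace I ⊆ S ∧ (u24Trace I).encard ≤ 2 :=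
      Iff.rfl
    simp only [hfib hI, h1, hI, hTS, hRX.mono_left hI, true_and, and_true,
      union_subset (hI.trans hRM) hXM, ← u24Sum_ground N L]
  refine ⟨?_, fun hm ↦ ?_⟩
  · rw [heq]
    rw [← delete_compl hRc]
    exact contract_delete_isMinor _ _ _
  · obtain ⟨z, hz, hzS⟩ := exists_of_ssubset ((hSL.trans hL).ssubset_of_ne hNS)
    have hsub := hm.subset
    rw [u24Sum_ground, u24Sum_ground, hgr] at hsub
    by_cases hzL : z ∈ L
    · exact hzS (hRinr.1 (hsub (inr_mem_u24Ground.2 hzL) (a := Sum.inr (z, 0))))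
    · exact hRinl z (hsub (inl_mem_u24Ground.2 ⟨hz, hzL⟩))

end Circuit

/-! ### `N₉` is not a frame matroid -/

section Nine

variable {α : Type u} {β : Type*} {Q : Matroid β} {B : Set β} {f g h : β} {S : Set α}

theorem PairSpanned.exists_support [Q.RankFinite] (hB : Q.Indep B)
    (hp : Q.PairSpanned B {f, g, h}) (hT : Q.IsTriangle f g h) :
    ∃ s ⊆ B, {f, g, h} ⊆ Q.closure s ∧ (s.ncard = 2 ∨ (s.ncard = 3 ∧
      ∀ a ∈ s, ∃ x ∈ ({f, g, h} : Set β), x ∈ Q.closure (s \ {a}))) := by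
  obtain ⟨b, hb, c, hc, hbc, h1, -⟩ | ⟨a, ha, b, hb, c, hc, hab, hbc, hac, h1, h2, h3⟩ :=
    hB.exists_line_or_triangle_of_isTriangle hp hT
  · exact ⟨{b, c}, pair_subset hb hc, h1, .inl (ncard_pair hbc)⟩
  · have hsub : ∀ {s : Set β} {x y z : β}, y ∈ s → z ∈ s → x ≠ y → x ≠ z → {y, z} ⊆ s \ {x} :=
      fun hy hz hxy hxz ↦ pair_subset ⟨hy, hxy.symm⟩ ⟨hz, hxz.symm⟩
    have hs : ({a, b, c} : Set β).ncard = 3 := ncard_eq_three.2 ⟨a, b, c, hab, hac, hbc, rfl⟩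
    refine ⟨{a, b, c}, insert_subset ha (pair_subset hb hc), insert_subset
      (Q.closure_subset_closure (by simp) h1) (pair_subset
        (Q.closure_subset_closure ?_ h2) (Q.closure_subset_closure ?_ h3)), .inr ⟨hs, ?_⟩⟩
    · exact pair_subset (by simp) (by simp)
    · exact pair_subset (by simp) (by simp)
    · rintro x (rfl | rfl | rfl)
      · exact ⟨f, by simp, Q.closure_subset_closure
          (hsub (by simp) (by simp) hab hac) h1⟩
      · exact ⟨g, by simp, Q.closure_subset_closure
          (hsub (by simp) (by simp) hab.symm hbc) h2⟩
      · exact ⟨h, by simp, Q.closure_subset_closure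
          (hsub (by simp) (by simp) hac.symm hbc.symm) h3⟩

/-- Inclusion-exclusion. If one set has three elements, the union of the other two already has five;
each configuration of sizes then makes the pairwise intersections either too small to cover a 3-set
or too large for the bounds on the pairwise unions. -/
theorem false_of_ncard_union {s t w : Set β} (hs : s.Finite) (ht : t.Finite) (hw : w.Finite)
    (h : (s ∪ t ∪ w).ncard = 5) (hst : 4 ≤ (s ∪ t).ncard) (hsw : 4 ≤ (s ∪ w).ncard)
    (htw : 4 ≤ (t ∪ w).ncard) (hs3 : s.ncard = 2 ∨ (s.ncard = 3 ∧ s ⊆ t ∪ w))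
    (ht3 : t.ncard = 2 ∨ (t.ncard = 3 ∧ t ⊆ s ∪ w))
    (hw3 : w.ncard = 2 ∨ (w.ncard = 3 ∧ w ⊆ s ∪ t)) : False := by
  have key : ∀ {a b c : Set β}, a.Finite → b.Finite → c.Finite → (a ∪ b ∪ c).ncard = 5 →
      a ⊆ b ∪ c → a.ncard ≤ (a ∩ b).ncard + (a ∩ c).ncard ∧ (b ∪ c).ncard = 5 := by
    intro a b c ha hb hc h5 habc
    constructor
    · calc a.ncard = (a ∩ b ∪ a ∩ c).ncard := by
            rw [← inter_union_distrib_left, inter_eq_left.2 habc]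
        _ ≤ _ := ncard_union_le _ _
    · rwa [union_assoc, union_eq_right.2 habc] at h5
  have e1 := ncard_union_add_ncard_inter s t hs ht
  have e2 := ncard_union_add_ncard_inter s w hs hw
  have e3 := ncard_union_add_ncard_inter t w ht hw
  have e4 := ncard_union_add_ncard_inter (s ∪ t) w (hs.union ht) hw
  have e5 : ((s ∪ t) ∩ w).ncard ≤ (s ∩ w).ncard + (t ∩ w).ncard := by
    rw [union_inter_distrib_right]
    exact ncard_union_le _ _
  have ks := key hs ht hw h
  have kt := key ht hs hw (by rwa [union_comm t s])
  have kw := key hw hs ht (by rwa [union_assoc, union_comm])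
  rw [inter_comm t s] at kt
  rw [inter_comm w s, inter_comm w t] at kw
  obtain h1 | ⟨h1, h1'⟩ := hs3 <;> obtain h2 | ⟨h2, h2'⟩ := ht3 <;>
    obtain h3 | ⟨h3, h3'⟩ := hw3
  · omega
  · have := kw h3'; omega
  · have := kt h2'; omega
  · have := kw h3'; have := kt h2'; omega
  · have := ks h1'; omega
  · have := ks h1'; have := kw h3'; omega
  · have := ks h1'; have := kt h2'; omega
  · have := ks h1'; have := kt h2'; have := kw h3'; omega

theorem uniformOn_rk_le (r : ℕ) (S Z : Set α) : (uniformOn r S).rk Z ≤ r := by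
  obtain ⟨I, hI⟩ := (uniformOn r S).exists_isBasis' Z
  have h1 : I.encard ≤ r := hI.indep.2
  rw [← rk_congr_closure hI.closure_eq_closure, hI.indep.rk_eq_ncard]
  rw [← (finite_of_encard_le_coe h1).cast_ncard_eq] at h1
  exact_mod_cast h1

theorem uniformOn_rk_pair {i j : α} (hi : i ∈ S) (hj : j ∈ S) (hij : i ≠ j) :
    (uniformOn 2 S).rk {i, j} = 2 := by
  have h1 : (uniformOn 2 S).Indep {i, j} := ⟨pair_subset hi hj, by rw [encard_pair hij]; rfl⟩
  rw [h1.rk_eq_ncard, ncard_pair hij]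

theorem uniformOn_isNonloop {i : α} (hi : i ∈ S) : (uniformOn 2 S).IsNonloop i := by
  rw [← indep_singleton]
  exact ⟨singleton_subset_iff.2 hi, by rw [encard_singleton]; norm_num⟩

/-- The matroid `N₉` is not a frame matroid. -/
theorem not_isFrame_u24Sum_uniformOn (hS : S.ncard = 3) :
    ¬ (u24Sum (uniformOn 2 S) S).IsFrame := by
  intro hM
  obtain ⟨i, j, k, hij, hik, hjk, hSe⟩ := ncard_eq_three.1 hS
  have hi : i ∈ S := by simp [hSe]
  have hj : j ∈ S := by simp [hSe]
  have hk : k ∈ S := by simp [hSe]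
  have hSf : S.Finite := finite_of_ncard_ne_zero (by omega)
  have hN : (uniformOn 2 S).Finite := ⟨hSf⟩
  have hSE : S ⊆ (uniformOn 2 S).E := subset_rfl
  have hfin := u24Sum_finite hN hSE
  obtain ⟨Q, B, hQ, hR, hB⟩ := hM.exists_isFrameRep fun x hx ↦
    u24Sum_isNonloop (fun y hy ↦ uniformOn_isNonloop hy) hSE hx
  have hrS : (uniformOn 2 S).rk S = 2 := by
    refine le_antisymm (uniformOn_rk_le _ _ _) ((uniformOn_rk_pair hi hj hij).ge.trans ?_)
    exact rk_mono _ (pair_subset hi hj)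
  -- The rank of `U_{2,3}` is 2, and each of the three copies adds 1.
  have hB5 : B.ncard = 5 := by
    have h1 := rk_u24Lift hN hSE (Z := S) subset_rfl
    rw [hB, ← u24Lift_ground hSE]
    change (u24Sum (uniformOn 2 S) S).rk (u24Lift (uniformOn 2 S) S S) = 5
    rw [h1, hrS, inter_self, hS]
  set F : α → Set ((α ⊕ α × Fin 3) ⊕ ℕ) := fun l ↦
    Sum.inl '' u24Lift (uniformOn 2 S) S {l} with hF
  have hFe : ∀ l ∈ S, F l = {Sum.inl (Sum.inr (l, 0)), Sum.inl (Sum.inr (l, 1)),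
      Sum.inl (Sum.inr (l, 2))} := fun l hl ↦ by
    simp only [hF, u24Lift_singleton hl, image_insert_eq, image_singleton]
  have hsupp : ∀ l ∈ S, ∃ s ⊆ B, F l ⊆ Q.closure s ∧ (s.ncard = 2 ∨ (s.ncard = 3 ∧
      ∀ a ∈ s, ∃ x ∈ F l, x ∈ Q.closure (s \ {a}))) := by
    intro l hl
    have hT := hR.isTriangle (u24Sum_isTriangle hN hSE hl (uniformOn_isNonloop hl))
    have hp : Q.PairSpanned B (F l) := hR.pairSpanned.mono (image_mono u24Lift_subset)
    rw [hFe l hl] at hp ⊢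
    exact hp.exists_support hR.indep hT
  have hpair : ∀ {l m}, l ∈ S → m ∈ S → l ≠ m → Q.rk (F l ∪ F m) = 4 := by
    intro l m hl hm hlm
    have h1 := rk_u24Lift hN hSE (Z := {l, m}) (pair_subset hl hm)
    rw [uniformOn_rk_pair hl hm hlm, inter_eq_left.2 (pair_subset hl hm), ncard_pair hlm] at h1
    rw [← image_union, hR.rk_image _ (union_subset u24Lift_subset u24Lift_subset)]
    refine Eq.trans ?_ h1
    congr 1
    ext p
    simp only [u24Lift, mem_union, mem_sep_iff, mem_insert_iff, mem_singleton_iff]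
    tauto
  have hadd : ∀ {l m n x}, l ∈ S → m ∈ S → n ∈ S → l ≠ m → l ≠ n → m ≠ n → x ∈ F l →
      Q.rk (insert x (F m ∪ F n)) = 5 := by
    rintro l m n _ hl hm hn hlm hln hmn ⟨p, hp, rfl⟩
    have hsub : u24Lift (uniformOn 2 S) S {m} ∪ u24Lift (uniformOn 2 S) S {n} ⊆
      (u24Sum (uniformOn 2 S) S).E := union_subset u24Lift_subset u24Lift_subset
    rw [rk_insert_of_notMem_closure (hR.mem_ground hp.1), hpair hm hn hmn]
    rw [← image_union, hR.mem_closure_image_iff hp.1 hsub]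
    obtain a | ⟨a, q⟩ := p
    · obtain ⟨⟨ha, ha'⟩, -⟩ := inl_mem_u24Lift.1 hp
      exact (ha' ha).elim
    · obtain ⟨-, rfl⟩ := inr_mem_u24Lift.1 hp
      refine inr_notMem_closure_u24Sum hl ?_
      rintro r (h | h)
      · exact hlm (inr_mem_u24Lift.1 h).2
      · exact hln (inr_mem_u24Lift.1 h).2
  choose! s hsB hFs hs using hsupp
  have hsf : ∀ {l}, l ∈ S → (s l).Finite := fun hl ↦ hR.indep.finite.subset (hsB _ hl)
  have hrk : ∀ {Y}, Y ⊆ B → Q.rk Y = Y.ncard := fun hY ↦ (hR.indep.subset hY).rk_eq_ncard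
  have hcl : ∀ {l Y}, l ∈ S → s l ⊆ Y → F l ⊆ Q.closure Y := fun hl hY ↦
    (hFs _ hl).trans (Q.closure_subset_closure hY)
  have h4 : ∀ {l m}, l ∈ S → m ∈ S → l ≠ m → 4 ≤ (s l ∪ s m).ncard := by
    intro l m hl hm hlm
    rw [← hpair hl hm hlm, ← hrk (union_subset (hsB l hl) (hsB m hm))]
    exact rk_le_of_subset_closure
      (union_subset (hcl hl subset_union_left) (hcl hm subset_union_right))
  -- Two triangles have rank 4 together, and any single element of the third brings the rank to 5.
  -- So a part of `B` that supports two triangles and spans one element of the third is all of `B`.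
  have hall : ∀ {l m n}, l ∈ S → m ∈ S → n ∈ S → l ≠ m → l ≠ n → m ≠ n →
      ∀ Y ⊆ B, (∃ x ∈ F l, x ∈ Q.closure Y) → s m ⊆ Y → s n ⊆ Y → Y = B := by
    intro l m n hl hm hn hlm hln hmn Y hY hx hmY hnY
    obtain ⟨x, hx, hxY⟩ := hx
    refine Set.eq_of_subset_of_ncard_le hY ?_ hR.indep.finite
    rw [hB5, ← hadd hl hm hn hlm hln hmn hx, ← hrk hY]
    exact rk_le_of_subset_closure
      (insert_subset hxY (union_subset (hcl hm hmY) (hcl hn hnY)))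
  -- Dropping `a` from a support of three elements still leaves one element of the triangle spanned,
  -- so `a` must occur in one of the other supports.
  have htri : ∀ {l m n}, l ∈ S → m ∈ S → n ∈ S → l ≠ m → l ≠ n → m ≠ n →
      (s l).ncard = 2 ∨ ((s l).ncard = 3 ∧ s l ⊆ s m ∪ s n) := by
    intro l m n hl hm hn hlm hln hmn
    refine (hs l hl).imp id fun h ↦ ⟨h.1, fun a ha ↦ ?_⟩
    by_contra hamn
    obtain ⟨x, hx, hxa⟩ := h.2 a ha
    have h1 := hall hl hm hn hlm hln hmn (s l \ {a} ∪ (s m ∪ s n))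
      (union_subset (sdiff_subset.trans (hsB l hl)) (union_subset (hsB m hm) (hsB n hn)))
      ⟨x, hx, Q.closure_subset_closure subset_union_left hxa⟩
      (subset_union_left.trans subset_union_right) (subset_union_right.trans subset_union_right)
    obtain h2 | h2 := h1.symm.subset (hsB l hl ha)
    · exact h2.2 rfl
    · exact hamn h2
  refine false_of_ncard_union (hsf hi) (hsf hj) (hsf hk) ?_ (h4 hi hj hij) (h4 hi hk hik)
    (h4 hj hk hjk) (htri hi hj hk hij hik hjk) (htri hj hi hk hij.symm hjk hik)
    (htri hk hi hj hik.symm hjk.symm hij)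
  have hxi : ∃ x ∈ F i, x ∈ Q.closure (s i ∪ s j ∪ s k) :=
    ⟨_, (hFe i hi).symm.subset (mem_insert _ _),
      hcl hi (subset_union_left.trans subset_union_left) ((hFe i hi).symm.subset (mem_insert _ _))⟩
  rw [hall hi hj hk hij hik hjk _
    (union_subset (union_subset (hsB i hi) (hsB j hj)) (hsB k hk)) hxi
    (subset_union_right.trans subset_union_left) subset_union_right, hB5]

end Nine

/-! ### The case of at least four elements, and the three-element case -/

section Main

variable {α : Type u} {β : Type*} {N : Matroid α} {Q : Matroid β} {B : Set β} {ψ : α → β}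
  {L : Set α} {e : α} {b : β}

/-- A nonloop in the closure of `{b}` is parallel to `b`, so exchanging the two alters no closure.
-/
theorem IsFrameRep.update [DecidableEq α] [Q.RankFinite] (hR : N.IsFrameRep Q B ψ)
    (he : N.IsNonloop e) (hb : b ∈ B) (heb : ψ e ∈ Q.closure {b}) :
    N.IsFrameRep Q B (Function.update ψ e b) := by
  have hbE := hR.indep.subset_ground hb
  have hne : ψ e ∉ Q.closure ∅ := by
    intro h
    have h1 := hR.rk_image {e} (singleton_subset_iff.2 he.mem_ground)
    rw [image_singleton, he.indep.rk_eq_ncard, ncard_singleton] at h1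
    have h2 := rk_le_of_subset_closure (singleton_subset_iff.2 h)
    rw [rk_empty] at h2
    omega
  have hbe : b ∈ Q.closure {ψ e} := by
    simpa using mem_closure_insert_swap (X := ∅) (y := b) (by simpa using heb) hne
  have hval : ∀ y, y ≠ e → Function.update ψ e b y = ψ y := fun y hy ↦
    Function.update_of_ne hy _ _
  refine ⟨hR.indep, fun Z hZ ↦ ?_, ?_⟩
  · rw [← hR.rk_image Z hZ]
    apply le_antisymm
    · refine rk_le_of_subset_closure ?_
      rintro _ ⟨y, hy, rfl⟩
      by_cases hye : y = e
      · rw [hye] at hy ⊢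
        rw [Function.update_self]
        exact Q.closure_subset_closure (singleton_subset_iff.2 (mem_image_of_mem ψ hy)) hbe
      · rw [hval y hye]
        exact Q.mem_closure_of_mem' (mem_image_of_mem ψ hy) (hR.mem_ground (hZ hy))
    · refine rk_le_of_subset_closure ?_
      rintro _ ⟨y, hy, rfl⟩
      have hy' := mem_image_of_mem (Function.update ψ e b) hy
      by_cases hye : y = e
      · rw [hye, Function.update_self] at hy'
        rw [hye]
        exact Q.closure_subset_closure (singleton_subset_iff.2 hy') heb
      · rw [hval y hye] at hy'
        exact Q.mem_closure_of_mem' hy' (hR.mem_ground (hZ hy))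
  · rintro _ ⟨y, hy, rfl⟩
    by_cases hye : y = e
    · rw [hye, Function.update_self]
      exact ⟨b, hb, b, hb, Q.mem_closure_of_mem' (.inl rfl) hbE⟩
    · rw [hval y hye]
      exact hR.pairSpanned _ (mem_image_of_mem ψ hy)

theorem isFrame_u24Sum_of_four_le (hN : N.Finite) (h3 : N.IsKConnected 3) (hE : 4 ≤ N.E.ncard)
    (hL : L ⊆ N.E) (hL3 : 3 ≤ L.ncard) (hM : ∀ M', M' <m u24Sum N L → M'.IsFrame) :
    (u24Sum N L).IsFrame := by
  classical
  have hnl : ∀ x ∈ N.E, N.IsNonloop x := fun x hx ↦ h3.isNonloop hN (by omega) (by omega) hx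
  obtain ⟨S, hSL, hS⟩ := exists_subset_card_eq hL3
  obtain ⟨e, f, g, hef, heg, hfg, rfl⟩ := ncard_eq_three.1 hS
  have he : e ∈ L := hSL (by simp)
  have hf : f ∈ L \ {e} := ⟨hSL (by simp), hef.symm⟩
  have hg : g ∈ L \ {e} := ⟨hSL (by simp), heg.symm⟩
  obtain ⟨Q, B, φ, hQ, hR, hB⟩ := exists_isFrameRep_of_isStrictMinor_isFrame hN hnl hL he hM
  have hn := ncard_sdiff_singleton_add_one he (hN.ground_finite.subset hL)
  obtain ⟨B', ψ, hψ, hB', hψL⟩ := hR.exists_isFrameRep_of_u24Sum hN h3 hE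
    (sdiff_subset.trans hL) (by omega) hB
  -- Either `e` too can be moved into the frame, and the whole 2-sum is frame, or `e` lies properly
  -- on a frame line, and a circuit through `e, f, g` yields a non-frame proper minor.
  by_cases hj : ∃ b ∈ B', ψ e ∈ Q.closure {b}
  · obtain ⟨b, hb, heb⟩ := hj
    refine (hψ.update (hnl e (hL he)) hb heb).isFrame_u24Sum hN hL fun l hl ↦ ?_
    by_cases hle : l = e
    · rw [hle, Function.update_self]
      exact hb
    · rw [Function.update_of_ne hle]
      exact hψL l ⟨hl, hle⟩
  · push Not at hj
    obtain ⟨C, hC, heC, hfC, hgC⟩ := hψ.exists_isCircuit hN h3 hE hB' (hL he) (hL hf.1) (hL hg.1)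
      hfg (hψL f hf) (hψL g hg) hj
    refine (not_isFrame_u24Sum_uniformOn hS (hM _ (u24Sum_uniformOn_isStrictMinor hL hC
      (insert_subset heC (pair_subset hfC hgC)) hSL hS ?_))).elim
    intro h
    rw [← h] at hE
    omega

/-- In rank one all elements are parallel, so the constant map to one element represents `N` with a
single frame element. -/
theorem isFrame_u24Sum_of_rk_le_one (hN : N.Finite) (hnl : ∀ x ∈ N.E, N.IsNonloop x)
    (hr : N.rk N.E ≤ 1) (hL : L ⊆ N.E) (he : e ∈ N.E) : (u24Sum N L).IsFrame := by
  have hei := (hnl e he).indep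
  refine IsFrameRep.isFrame_u24Sum (Q := N) (B := {e}) (ψ := fun _ ↦ e) hN
    ⟨hei, fun Z hZ ↦ ?_, ?_⟩ hL fun l _ ↦ rfl
  · obtain rfl | ⟨z, hz⟩ := Z.eq_empty_or_nonempty
    · rw [image_empty]
    · rw [Set.Nonempty.image_const ⟨z, hz⟩, hei.rk_eq_ncard, ncard_singleton]
      have h1 := N.rk_mono hZ
      have h2 := N.rk_mono (singleton_subset_iff.2 hz)
      rw [(hnl z (hZ hz)).indep.rk_eq_ncard, ncard_singleton] at h2
      omega
  · rintro _ ⟨z, -, rfl⟩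
    exact ⟨e, rfl, e, rfl, N.mem_closure_of_mem' (.inl rfl) he⟩

/-- There are no loops and no coloops, so the rank is one or two. When it is two, the absence of
coloops makes every pair independent. -/
theorem indep_iff_ncard_le_two (hN : N.Finite) (h3 : N.IsKConnected 3) (hE : N.E.ncard = 3)
    (hr : N.rk N.E ≠ 1) {I : Set α} (hI : I ⊆ N.E) : N.Indep I ↔ I.ncard ≤ 2 := by
  have hEf := hN.ground_finite
  have hnl : ∀ x ∈ N.E, N.IsNonloop x := fun x hx ↦ h3.isNonloop hN (by omega) (by omega) hx
  have hsep : ∀ x ∈ N.E, N.rk N.E ≤ N.rk (N.E \ {x}) := by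
    intro x hx
    have h1 := N.rk_singleton_le x
    have h2 := ncard_sdiff_singleton_add_one hx hEf
    by_contra! hc
    obtain h | h := h3.eq_empty_or_eq_empty hN (by omega) (singleton_subset_iff.2 hx) (by omega)
    · simp at h
    · rw [h, ncard_empty] at h2
      omega
  obtain ⟨z, hz⟩ : N.E.Nonempty := (ncard_pos hEf).1 (by omega)
  have hr1 : 1 ≤ N.rk N.E := by
    have := N.rk_mono (singleton_subset_iff.2 hz)
    rwa [(hnl z hz).indep.rk_eq_ncard, ncard_singleton] at this
  have hle : N.rk N.E ≤ 2 := by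
    have h1 := hsep z hz
    have h2 := N.rk_le_ncard (X := N.E \ {z}) hEf.sdiff
    have h3 := ncard_sdiff_singleton_add_one hz hEf
    omega
  constructor
  · intro h
    rw [← h.rk_eq_ncard]
    exact (N.rk_mono hI).trans hle
  · intro h
    have hIf := hEf.subset hI
    obtain h0 | h1 | h2 : I.ncard = 0 ∨ I.ncard = 1 ∨ I.ncard = 2 := by omega
    · rw [(ncard_eq_zero hIf).1 h0]
      exact N.empty_indep
    · obtain ⟨x, rfl⟩ := ncard_eq_one.1 h1
      exact (hnl x (hI rfl)).indep
    · refine indep_of_ncard_le_rk hIf ?_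
      obtain ⟨w, hw⟩ := ncard_eq_one.1 (show (N.E \ I).ncard = 1 by
        have := ncard_sdiff_add_ncard_of_subset hI hEf
        omega)
      have hwE : w ∈ N.E := (hw.symm.subset rfl).1
      have := hsep w hwE
      rw [← hw, sdiff_sdiff_cancel_left hI] at this
      omega

theorem u24Sum_isIsoTo_nNine (hN : N.Finite) (h3 : N.IsKConnected 3) (hE : N.E.ncard = 3)
    (hr : N.rk N.E ≠ 1) : (u24Sum N N.E).IsIsoTo nNine := by
  have hEf := hN.ground_finite
  have : Fintype N.E := hEf.fintype
  have hc : Fintype.card N.E = 3 := by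
    rw [← Nat.card_eq_fintype_card, Nat.card_coe_set_eq, hE]
  let eq := Fintype.equivFinOfCardEq hc
  classical
  set g : α → Fin 3 := fun x ↦ if h : x ∈ N.E then eq ⟨x, h⟩ else 0 with hg
  have hgv : ∀ x (h : x ∈ N.E), g x = eq ⟨x, h⟩ := fun x h ↦ by simp [hg, h]
  have hinj : InjOn g N.E := by
    intro x hx y hy hxy
    rw [hgv x hx, hgv y hy] at hxy
    exact congrArg Subtype.val (eq.injective hxy)
  have himg : g '' N.E = univ := by
    refine eq_univ_of_forall fun i ↦ ⟨(eq.symm i).1, (eq.symm i).2, ?_⟩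
    rw [hgv _ (eq.symm i).2]
    simp
  have hI : ∀ Z ⊆ N.E, N.Indep Z ↔ (uniformOn 2 (univ : Set (Fin 3))).Indep (g '' Z) := by
    intro Z hZ
    have h1 : (uniformOn 2 (univ : Set (Fin 3))).Indep (g '' Z) ↔
      g '' Z ⊆ univ ∧ (g '' Z).encard ≤ (2 : ℕ) := Iff.rfl
    rw [h1, indep_iff_ncard_le_two hN h3 hE hr hZ, (hinj.mono hZ).encard_image,
      ← (hEf.subset hZ).cast_ncard_eq, Nat.cast_le, and_iff_right (subset_univ _)]
  have hbij : BijOn (u24Map g) (u24Sum N N.E).E nNine.E := by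
    refine ⟨?_, u24Map_injOn subset_rfl hinj, ?_⟩
    · rintro (a | ⟨a, i⟩) h
      · exact ((inl_mem_u24Ground.1 h).2 (inl_mem_u24Ground.1 h).1).elim
      · exact inr_mem_u24Ground.2 (mem_univ _)
    · rintro (c | ⟨c, i⟩) h
      · exact ((inl_mem_u24Ground.1 h).2 (mem_univ _)).elim
      · obtain ⟨a, ha, rfl⟩ := himg.symm.subset (mem_univ c)
        exact ⟨Sum.inr (a, i), inr_mem_u24Ground.2 ha, rfl⟩
  refine ⟨hbij.equiv, fun I ↦ ?_⟩
  have hIE : Subtype.val '' I ⊆ u24Ground N N.E := by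
    rintro _ ⟨x, -, rfl⟩
    exact x.2
  have himage : Subtype.val '' (hbij.equiv '' I) = u24Map g '' (Subtype.val '' I) := by
    rw [image_image, image_image]
    rfl
  rw [himage, u24Sum_indep_iff, u24Indep_iff_u24Indep_image subset_rfl hinj
    (fun _ _ ↦ mem_univ _) hI hIE, himg]
  rfl

end Main

end Matroid

theorem mainTheorem8 {α : Type u} (N : Matroid α) (L : Set α)
    (hfin : N.Finite) (h3 : N.IsKConnected 3) (hL : L ⊆ N.E) (hcard : 3 ≤ L.encard)
    (hM : (Matroid.u24Sum N L).IsFrameExcludedMinor) :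
    (Matroid.u24Sum N L).IsIsoTo Matroid.nNine := by
  obtain ⟨-, hnf, hmin⟩ := hM
  have hEf := hfin.ground_finite
  have hLf := hEf.subset hL
  have hL3 : 3 ≤ L.ncard := by
    rw [← hLf.cast_ncard_eq] at hcard
    exact_mod_cast hcard
  have hE3 := ncard_le_ncard hL hEf
  obtain hE | hE := Nat.lt_or_ge 3 N.E.ncard
  · exact (hnf (Matroid.isFrame_u24Sum_of_four_le hfin h3 hE hL hL3 hmin)).elim
  -- With at most three elements in `N.E` and at least three in `L`, the two sets agree. Rank one is
  -- excluded because it would make the 2-sum frame.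
  · obtain rfl : L = N.E := Set.eq_of_subset_of_ncard_le hL (by omega) hEf
    refine Matroid.u24Sum_isIsoTo_nNine hfin h3 (by omega) fun hr ↦ hnf ?_
    obtain ⟨e, he⟩ : N.E.Nonempty := (ncard_pos hEf).1 (by omega)
    exact Matroid.isFrame_u24Sum_of_rk_le_one hfin
      (fun x hx ↦ h3.isNonloop hfin (by omega) (by omega) hx) hr.le subset_rfl he
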